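/- **Setting.** Identify $\mathbf R^2$ with $\mathbf C$. For masses $m_1,\dots,m_n>0$ with $\sum_i m_i=1$, consider the planar $n$-body problem with Hamiltonian $H(p,q)=\sum_i\frac{|p_i|^2}{2m_i}-U(q)$, $U(q)=\sum_{i<j}\frac{m_im_j}{|q_i-q_j|}$. A central configuration is a collision-free $q\in\mathbf C^n$ such that, for some $\lambda\in\mathbf R$, $\frac{\partial U}{\partial q_i}(q)=-\lambda m_i(q_i-q_c)$ for all $i$, where $q_c=\sum_i m_iq_i$; its normalization $a=(a_1,\dots,a_n)$ is the translate and positive multiple of $q$ with $\sum_i m_ia_i=0$, $\sum_i m_i|a_i|^2=1$. Put $\mu=U(a)$. For $e\in[0,1)$ and $p>0$ the elliptic relative equilibrium (ERE) with eccentricity $e$ is $q_i(t)=r(t)e^{\sqrt{-1}\,\theta(t)}a_i$, $p_i=m_i\dot q_i$, where $r=\frac{p}{1+e\cos\theta}$ and $r^2\dot\theta=\sqrt{\mu p}$. The linearized Hamiltonian system at the ERE is $\dot\zeta=JH''(p(t),q(t))\zeta$, $J=\begin{pmatrix}0&-I\\ I&0\end{pmatrix}$. Let $V\in\mathbf C^{n\times(n-1)}$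 have first column $a$ and columns that are orthogonal to $(1,\dots,1)^T$ and orthonormal for $\sum_i m_i\overline{u_i}v_i$, and let $\sigma=(\mu p)^{1/4}$. Such a $V$ gives the linear change of coordinates $(Z,z)\mapsto(p,q)$ on $\mathbf C^{n-1}\times\mathbf C^{n-1}=\mathbf R^{4(n-1)}$, $$q=\tfrac{r}{\sigma}\,e^{\sqrt{-1}\,\theta}\,Vz,\qquad p=\mathrm{diag}(m_1,\dots,m_n)\,e^{\sqrt{-1}\,\theta}\,V\left(\tfrac{\sigma}{r}Z+\tfrac{\dot r}{\sigma}z\right).$$ We say that, by $V$, the linearized system reduces to $\xi'=JB(\theta)\xi$ ($B$ symmetric) if, for every ERE of eccentricity $e$ over $a$, the ERE solves the $n$-body problem, this change of coordinates is symplectic with image $\{\sum_i p_i=0,\ \sum_i m_iq_i=0\}$, and in the coordinates $\xi=(Z,z)$, with the true anomaly $\theta$ as independent variable, the linearized system is exactly $\xi'=JB(\theta)\xi$. **Theorem.** Let $e\in[0,1)$. Consider the planar $4$-body problem with masses $m=(m_1,m_2,m_3,m_4)\in(\mathbf R^+)^4$, $\sum_{i=1}^4 m_i=1$, and central configurations $(q_1,q_2,q_3,q_4)$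 of these masses, in a limit in which $m_4\to0$, $m_i\to m_{i,0}>0$ and $q_i\to q_{i,0}$ for $i=1,2,3$, and $q_4\to z^*$, where $q_{1,0},q_{2,0},q_{3,0}$ form an equilateral triangle of side $1$. Then $z^*\ne q_{i,0}$ for $i=1,2,3$, and for suitable choices of $V$ (depending on $m$ and $q$) the linearized Hamiltonian system at the ERE with eccentricity $e$ reduces to systems $\xi'=JB(\theta)\xi$ on $\mathbf R^{12}$ whose coefficient matrices $B(\theta)$ converge, uniformly in $\theta$, to that of the direct sum of three independent Hamiltonian systems on $\mathbf R^4$, $\xi'=JB_k(\theta)\xi$, $k=0,1,2$, with $$B_k(\theta)=\begin{pmatrix}1&0&0&1\\0&1&-1&0\\0&-1&1-\frac{\kappa_k}{1+e\cos\theta}&0\\1&0&0&1-\frac{\kappa_k'}{1+e\cos\theta}\end{pmatrix},$$ as follows. 1. $\kappa_0=3$, $\kappa_0'=0$: for all positive masses of total mass $1$, this is the system to which the linearized system of the $2$-body problem at a Kepler orbit of eccentricity $e$ reduces. 2. $\kappa_1=\frac{3+\sqrt{9-\beta_L}}2$, $\kappa_1'=\frac{3-\sqrt{9-\beta_L}}2$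 with $\beta_L=\frac{27(m_{1,0}m_{2,0}+m_{2,0}m_{3,0}+m_{3,0}m_{1,0})}{(m_{1,0}+m_{2,0}+m_{3,0})^2}$: for a suitable $V$, the linearized system of the $3$-body problem with masses $m_{1,0},m_{2,0},m_{3,0}$ at the Lagrangian ERE with eccentricity $e$ over the triangle $q_{1,0},q_{2,0},q_{3,0}$ reduces to the direct sum of the systems $k=0$ and $k=1$. 3. (Essential part) $\kappa_2=\lambda_3=1+\alpha+3\beta$, $\kappa_2'=\lambda_4=1+\alpha-3\beta$, where $$\alpha=\frac12\sum_{i=1}^3\frac{m_{i,0}}{|q_{i,0}-z^*|^3},\qquad \beta=\frac12\left|\sum_{i=1}^3\frac{m_{i,0}(q_{i,0}-z^*)^2}{|q_{i,0}-z^*|^5}\right|.$$ -/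

import Mathlib

open Filter Topology
open scoped ComplexConjugate

noncomputable section

namespace FourBody

/-! ### Phase space, Hamiltonian systems and their linearization -/

/-- Coordinates of `n` points in the plane: `(c, i)` is the `c`-th coordinate of the `i`-th point. -/
abbrev Coord (n : ℕ) : Type := Fin 2 × Fin n

/-- The phase space `ℝ^{4n}` with coordinates `(p, q)`: `Sum.inl` is momentum, `Sum.inr` position. -/
abbrev Phase (n : ℕ) : Type := Coord n ⊕ Coord n → ℝ

/-- The momenta, the plane being identified with `ℂ`. -/
def mom {n : ℕ} (x : Phase n) (i : Fin n) : ℂ := ⟨x (Sum.inl (0, i)), x (Sum.inl (1, i))⟩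

/-- The positions, the plane being identified with `ℂ`. -/
def pos {n : ℕ} (x : Phase n) (i : Fin n) : ℂ := ⟨x (Sum.inr (0, i)), x (Sum.inr (1, i))⟩

/-- The phase point with momenta `P` and positions `Q`. -/
def phasePoint {n : ℕ} (P Q : Fin n → ℂ) : Phase n :=
  Sum.elim (fun k => if k.1 = 0 then (P k.2).re else (P k.2).im)
    (fun k => if k.1 = 0 then (Q k.2).re else (Q k.2).im)

/-- The vector of partial derivatives. -/
def grad {κ : Type*} [Fintype κ] [DecidableEq κ] (f : (κ → ℝ) → ℝ) (x : κ → ℝ) : κ → ℝ :=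
  fun k => fderiv ℝ f x (Pi.single k 1)

/-- The matrix of second partial derivatives. -/
def hessian {κ : Type*} [Fintype κ] [DecidableEq κ] (f : (κ → ℝ) → ℝ) (x : κ → ℝ) :
    Matrix κ κ ℝ :=
  Matrix.of fun k k' => fderiv ℝ (fun y => grad f y k) x (Pi.single k' 1)

/-- `x' = J ∇H(x)`, that is `p' = -∂H/∂q`, `q' = ∂H/∂p`; here `J = (0, -1; 1, 0)`. -/
def SolvesHamilton {n : ℕ} (H : Phase n → ℝ) (x : ℝ → Phase n) : Prop :=
  ∀ t, HasDerivAt x ((Matrix.J (Coord n) ℝ).mulVec (grad H (x t))) t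

/-- `ξ'(t) = J B(t) ξ(t)`. -/
def SolvesLinear {n : ℕ} (B : ℝ → Matrix (Coord n ⊕ Coord n) (Coord n ⊕ Coord n) ℝ)
    (ξ : ℝ → Phase n) : Prop :=
  ∀ t, HasDerivAt ξ ((Matrix.J (Coord n) ℝ * B t).mulVec (ξ t)) t

/-- The standard symplectic form. -/
def symplecticForm {n : ℕ} (x y : Phase n) : ℝ := x ⬝ᵥ (Matrix.J (Coord n) ℝ).mulVec y

/-! ### The planar `n`-body problem -/

/-- The force function `U`. -/
def potential {n : ℕ} (m : Fin n → ℝ) (q : Fin n → ℂ) : ℝ :=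
  ∑ i, ∑ j ∈ Finset.Ioi i, m i * m j / ‖q i - q j‖

def hamiltonian {n : ℕ} (m : Fin n → ℝ) (x : Phase n) : ℝ :=
  ∑ i, ‖mom x i‖ ^ 2 / (2 * m i) - potential m (pos x)

/-- The centre of mass. -/
def centre {n : ℕ} (m : Fin n → ℝ) (q : Fin n → ℂ) : ℂ := (∑ i, m i * q i) / ((∑ i, m i : ℝ) : ℂ)

/-- Central configuration: a collision-free configuration with
`∂U/∂q_i = -lam m_i (q_i - centre)` for all `i`, for some real `lam`. -/
def IsCentralConfiguration {n : ℕ} (m : Fin n → ℝ) (q : Fin n → ℂ) : Prop :=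
  Function.Injective q ∧ ∃ lam : ℝ, ∀ i,
    ∑ j ∈ Finset.univ.erase i, (m i * m j : ℂ) * (q j - q i) / ((‖q i - q j‖ ^ 3 : ℝ) : ℂ)
      = -lam * m i * (q i - centre m q)

/-- The configuration moved to centre of mass `0` and scaled so that `∑ m_i |a_i|² = 1`. -/
def normalized {n : ℕ} (m : Fin n → ℝ) (q : Fin n → ℂ) : Fin n → ℂ := fun i =>
  (q i - centre m q) / ((Real.sqrt (∑ j, m j * ‖q j - centre m q‖ ^ 2) : ℝ) : ℂ)

/-! ### Elliptic relative equilibria -/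

/-- The Kepler ellipse `r = p / (1 + e cos θ)`. -/
def radius (p e s : ℝ) : ℝ := p / (1 + e * Real.cos s)

/-- `θ` is the true anomaly, as a function of time, of a Kepler motion with force constant `μ`
along the ellipse with parameter `p` and eccentricity `e`:  `r² θ' = (μ p)^{1/2}`. -/
def IsTrueAnomaly (μ p e : ℝ) (θ : ℝ → ℝ) : Prop :=
  ∀ t, HasDerivAt θ (Real.sqrt (μ * p) / radius p e (θ t) ^ 2) t

/-- The homographic motion `q_i(t) = r(t) R(θ(t)) a_i`. -/
def erePos {n : ℕ} (a : Fin n → ℂ) (p e : ℝ) (θ : ℝ → ℝ) (t : ℝ) (i : Fin n) : ℂ :=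
  (radius p e (θ t) : ℂ) * Complex.exp (θ t * Complex.I) * a i

/-- The elliptic relative equilibrium in phase space: `p_i = m_i q_i'`. -/
def ere {n : ℕ} (m : Fin n → ℝ) (a : Fin n → ℂ) (p e : ℝ) (θ : ℝ → ℝ) (t : ℝ) : Phase n :=
  phasePoint (fun i => m i * deriv (fun s => erePos a p e θ s i) t) (erePos a p e θ t)

/-! ### Symplectic reduction -/

/-- The columns of `V` are orthonormal for `∑ m_i conj(u_i) v_i`, orthogonal to `(1, …, 1)`, and the
first one is the configuration `a`. Together with `(1, …, 1)` they form a unitary basis. -/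
structure IsFrame {k : ℕ} (m : Fin (k + 2) → ℝ) (a : Fin (k + 2) → ℂ)
    (V : Matrix (Fin (k + 2)) (Fin (k + 1)) ℂ) : Prop where
  first : ∀ i, V i 0 = a i
  centred : ∀ j, ∑ i, m i * V i j = 0
  orthonormal : ∀ j j', ∑ i, m i * conj (V i j) * V i j' = if j = j' then 1 else 0

/-- The linear change of coordinates at time `t`: for `(Z, z)` in the reduced phase space,
`q = V X`, `p = M V Y` (the inverse transpose of `X ↦ V X`, as `V` is orthonormal), where
`X = (r/σ) R(θ) z` and `Y = R(θ) ((σ/r) Z + (r'/σ) z)`, with `σ = (μ p)^{1/4}`, `μ = U(a)`. -/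
def changeOfCoords {k : ℕ} (m : Fin (k + 2) → ℝ) (a : Fin (k + 2) → ℂ)
    (V : Matrix (Fin (k + 2)) (Fin (k + 1)) ℂ) (p e : ℝ) (θ : ℝ → ℝ) (t : ℝ)
    (x : Phase (k + 1)) : Phase (k + 2) :=
  let σ : ℝ := (potential m a * p) ^ (1 / 4 : ℝ)
  let r : ℝ → ℝ := fun s => radius p e (θ s)
  let rot : ℂ := Complex.exp (θ t * Complex.I)
  phasePoint
    (fun i => m i * ∑ j, V i j *
      (rot * (((σ / r t : ℝ) : ℂ) * mom x j + ((deriv r t / σ : ℝ) : ℂ) * pos x j)))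
    (fun i => ∑ j, V i j * (rot * (((r t / σ : ℝ) : ℂ) * pos x j)))

/-- Total linear momentum and centre of mass are zero. -/
def centredPhase {n : ℕ} (m : Fin n → ℝ) : Set (Phase n) :=
  {x | ∑ i, mom x i = 0 ∧ ∑ i, m i * pos x i = 0}

/-- For every elliptic relative equilibrium of eccentricity `e` over the normalized configuration
`a` (any size `p`, any parametrization `θ` by time): it is a solution of the `n`-body problem; the
change of coordinates given by `V` is a symplectic map of the reduced phase space onto the phase
space with fixed centre of mass; and in the new coordinates, with the true anomaly as time, the
linearized Hamiltonian system is `ξ' = J B ξ`, with `B` symmetric. -/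
def LinearizationReducesTo {k : ℕ} (m : Fin (k + 2) → ℝ) (a : Fin (k + 2) → ℂ) (e : ℝ)
    (V : Matrix (Fin (k + 2)) (Fin (k + 1)) ℂ)
    (B : ℝ → Matrix (Coord (k + 1) ⊕ Coord (k + 1)) (Coord (k + 1) ⊕ Coord (k + 1)) ℝ) : Prop :=
  (∀ s, (B s).IsSymm) ∧
  ∀ (p : ℝ) (θ : ℝ → ℝ), 0 < p → IsTrueAnomaly (potential m a) p e θ →
    SolvesHamilton (hamiltonian m) (ere m a p e θ) ∧
    (∀ t x y, symplecticForm (changeOfCoords m a V p e θ t x) (changeOfCoords m a V p e θ t y)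
      = symplecticForm x y) ∧
    (∀ t, Set.range (changeOfCoords m a V p e θ t) = centredPhase m) ∧
    ∀ ξ : ℝ → Phase (k + 1),
      SolvesLinear (fun t => hessian (hamiltonian m) (ere m a p e θ t))
          (fun t => changeOfCoords m a V p e θ t (ξ (θ t)))
        ↔ SolvesLinear B ξ

/-! ### The independent parts -/

/-- The coefficient matrix of the sum of independent Hamiltonian systems on `ℝ^4`. -/
def directSum {n : ℕ} (C : Fin n → Matrix (Fin 2 ⊕ Fin 2) (Fin 2 ⊕ Fin 2) ℝ) :
    Matrix (Coord n ⊕ Coord n) (Coord n ⊕ Coord n) ℝ :=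
  Matrix.fromBlocks
    (Matrix.blockDiagonal fun j => (C j).toBlocks₁₁) (Matrix.blockDiagonal fun j => (C j).toBlocks₁₂)
    (Matrix.blockDiagonal fun j => (C j).toBlocks₂₁) (Matrix.blockDiagonal fun j => (C j).toBlocks₂₂)

/-- The matrix
`(1, 0, 0, 1; 0, 1, -1, 0; 0, -1, 1 - l/(1 + e cos s), 0; 1, 0, 0, 1 - l'/(1 + e cos s))`. -/
def part (l l' e s : ℝ) : Matrix (Fin 2 ⊕ Fin 2) (Fin 2 ⊕ Fin 2) ℝ :=
  Matrix.fromBlocks !![1, 0; 0, 1] !![0, 1; -1, 0] !![0, -1; 1, 0]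
    !![1 - l / (1 + e * Real.cos s), 0; 0, 1 - l' / (1 + e * Real.cos s)]

/-- The Kepler part. -/
def keplerPart (e s : ℝ) : Matrix (Fin 2 ⊕ Fin 2) (Fin 2 ⊕ Fin 2) ℝ :=
  Matrix.fromBlocks !![1, 0; 0, 1] !![0, 1; -1, 0] !![0, -1; 1, 0]
    !![-((2 - e * Real.cos s) / (1 + e * Real.cos s)), 0; 0, 1]

/-- The mass parameter of the elliptic Lagrangian solution. -/
def betaL (m : Fin 3 → ℝ) : ℝ :=
  27 * (m 0 * m 1 + m 1 * m 2 + m 2 * m 0) / (m 0 + m 1 + m 2) ^ 2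

/-- The essential part of the elliptic Lagrangian solution with mass parameter `b`. -/
def lagrangePart (b e s : ℝ) : Matrix (Fin 2 ⊕ Fin 2) (Fin 2 ⊕ Fin 2) ℝ :=
  part ((3 + Real.sqrt (9 - b)) / 2) ((3 - Real.sqrt (9 - b)) / 2) e s

def alpha (m : Fin 3 → ℝ) (q : Fin 3 → ℂ) (z : ℂ) : ℝ :=
  1 / 2 * ∑ i, m i / ‖q i - z‖ ^ 3

def beta (m : Fin 3 → ℝ) (q : Fin 3 → ℂ) (z : ℂ) : ℝ :=
  1 / 2 * ‖∑ i, (m i : ℂ) * (q i - z) ^ 2 / ((‖q i - z‖ ^ 5 : ℝ) : ℂ)‖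

end FourBody

end

/-!
The change of coordinates is a frame applied to rotating and pulsating coordinates, so everything is
decided by the second derivative of `U` at `a`, which in a frame `V` acts as `z ↦ P z + Q conj(z)`
with `P` Hermitian and `Q` symmetric. The reduced system is a direct sum as soon as `P` and `Q` are
real and diagonal. The first column of `V` is `a` itself, where Euler's identity for the homogeneous
function `U` gives the Kepler part; for an equilateral triangle `P` is moreover scalar, and the
phase of the second column can be chosen to make `Q` real.

When `m₄ → 0`, the fourth body cannot approach a primary, since the attraction of that primary would
be the only unbounded term in its equation. Take the second column of `V` supported on the primaries
and the third one orthogonal to the first two: up to the factor `m₄^{-1/2}` it tends to the motion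
of the fourth body alone. Then `P` and `Q` converge to the matrices of the triangle bordered by the
second derivative of the potential of the primaries at `z`, whose invariants are `α` and `β`. Fixed
phases of the columns make the limit of `Q` real and diagonal.
-/

noncomputable section

namespace FourBody

/-! ### Phase points as pairs of complex vectors -/

section Phase

variable {n : ℕ}

@[simp] lemma mom_phasePoint (P Q : Fin n → ℂ) : mom (phasePoint P Q) = P := by
  funext i; apply Complex.ext <;> simp [mom, phasePoint]

@[simp] lemma pos_phasePoint (P Q : Fin n → ℂ) : pos (phasePoint P Q) = Q := by
  funext i; apply Complex.ext <;> simp [pos, phasePoint]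

@[simp] lemma phasePoint_mom_pos (x : Phase n) : phasePoint (mom x) (pos x) = x := by
  funext k
  rcases k with ⟨c, i⟩ | ⟨c, i⟩ <;> fin_cases c <;> simp [mom, pos, phasePoint]

/-- The phase space as the space of pairs (momenta, positions) of complex vectors. -/
def phaseEquiv (n : ℕ) : Phase n ≃L[ℝ] (Fin n → ℂ) × (Fin n → ℂ) :=
  LinearEquiv.toContinuousLinearEquiv
    { toFun := fun x => (mom x, pos x)
      invFun := fun y => phasePoint y.1 y.2
      map_add' := fun x y => by ext i <;> simp [mom, pos, Complex.ext_iff]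
      map_smul' := fun c x => by ext i <;> simp [mom, pos, Complex.ext_iff]
      left_inv := phasePoint_mom_pos
      right_inv := fun y => by simp }

/-- `mom` as a continuous linear map. -/
def momL (n : ℕ) : Phase n →L[ℝ] Fin n → ℂ :=
  (ContinuousLinearMap.fst ℝ _ _).comp (phaseEquiv n).toContinuousLinearMap

/-- `pos` as a continuous linear map. -/
def posL (n : ℕ) : Phase n →L[ℝ] Fin n → ℂ :=
  (ContinuousLinearMap.snd ℝ _ _).comp (phaseEquiv n).toContinuousLinearMap

@[simp] lemma momL_apply (x : Phase n) : momL n x = mom x := rfl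

@[simp] lemma posL_apply (x : Phase n) : posL n x = pos x := rfl

lemma hasDerivAt_phase_iff {f : ℝ → Phase n} {f' : Phase n} {t : ℝ} :
    HasDerivAt f f' t ↔ HasDerivAt (fun s => mom (f s)) (mom f') t ∧
      HasDerivAt (fun s => pos (f s)) (pos f') t := by
  refine ⟨fun h => ⟨(momL n).hasFDerivAt.comp_hasDerivAt t h,
    (posL n).hasFDerivAt.comp_hasDerivAt t h⟩, fun h => ?_⟩
  simpa [Function.comp_def, phaseEquiv] using
    (phaseEquiv n).symm.hasFDerivAt.comp_hasDerivAt t (h.1.prodMk h.2)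

lemma dotProduct_phase (x y : Phase n) :
    x ⬝ᵥ y = ∑ i, inner ℝ (mom x i) (mom y i) + ∑ i, inner ℝ (pos x i) (pos y i) := by
  simp only [dotProduct, Fintype.sum_sum_type, Fintype.sum_prod_type, Fin.sum_univ_two,
    ← Finset.sum_add_distrib]
  simp [mom, pos, Complex.inner, mul_comm]

lemma J_mulVec (x : Phase n) : (Matrix.J (Coord n) ℝ).mulVec x = phasePoint (-pos x) (mom x) := by
  conv_lhs => rw [← Sum.elim_comp_inl_inr x]
  rw [Matrix.J, Matrix.fromBlocks_mulVec]
  funext k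
  rcases k with ⟨c, i⟩ | ⟨c, i⟩ <;> fin_cases c <;>
    simp [mom, pos, phasePoint, Matrix.neg_mulVec]

lemma symplecticForm_eq (x y : Phase n) :
    symplecticForm x y
      = ∑ i, inner ℝ (pos x i) (mom y i) - ∑ i, inner ℝ (mom x i) (pos y i) := by
  simp only [symplecticForm, J_mulVec, dotProduct_phase, mom_phasePoint, pos_phasePoint,
    Pi.neg_apply, inner_neg_right, Finset.sum_neg_distrib]
  ring

end Phase

/-! ### Gradients and Hessian matrices -/

section Gradient

variable {κ : Type*} [Fintype κ] [DecidableEq κ] {f : (κ → ℝ) → ℝ} {x : κ → ℝ}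

lemma grad_eq_of_hasFDerivAt {g : κ → ℝ} {L : (κ → ℝ) →L[ℝ] ℝ} (h : HasFDerivAt f L x)
    (hL : ∀ v, L v = g ⬝ᵥ v) : grad f x = g := by
  funext k
  rw [grad, h.fderiv, hL, dotProduct_single, mul_one]

lemma hessian_mulVec_of_hasFDerivAt {g : (κ → ℝ) → κ → ℝ} {L : (κ → ℝ) →L[ℝ] κ → ℝ}
    (h : grad f =ᶠ[𝓝 x] g) (hg : HasFDerivAt g L x) (v : κ → ℝ) :
    (hessian f x).mulVec v = L v := by
  have hgrad (k : κ) : HasFDerivAt (fun y => grad f y k) ((ContinuousLinearMap.proj k).comp L) x :=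
    hasFDerivAt_pi'.1 (hg.congr_of_eventuallyEq h) k
  funext k
  conv_rhs => rw [pi_eq_sum_univ' v, map_sum, Finset.sum_apply]
  simp only [Matrix.mulVec, dotProduct, hessian, Matrix.of_apply, (hgrad k).fderiv, map_smul,
    ContinuousLinearMap.comp_apply, ContinuousLinearMap.proj_apply, Pi.smul_apply, smul_eq_mul,
    mul_comm]

end Gradient

/-! ### The Newtonian kernel -/

lemma hasFDerivAt_inv_norm_pow {E : Type*} [NormedAddCommGroup E] [InnerProductSpace ℝ E]
    (k : ℕ) {w : E} (hw : w ≠ 0) :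
    HasFDerivAt (fun w : E => (‖w‖ ^ k)⁻¹) (-(k / ‖w‖ ^ (k + 2)) • innerSL ℝ w) w := by
  have hn : ‖w‖ ≠ 0 := norm_ne_zero_iff.2 hw
  have hnorm := (hasStrictFDerivAt_norm_sq w).hasFDerivAt.sqrt (pow_ne_zero 2 hn)
  simp only [Real.sqrt_sq (norm_nonneg _)] at hnorm
  refine (((hasDerivAt_pow k ‖w‖).fun_inv (pow_ne_zero k hn)).comp_hasFDerivAt w
    hnorm).congr_fderiv (ContinuousLinearMap.ext fun v => ?_)
  rcases k with _ | k
  · simp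
  simp only [smul_apply, smul_eq_mul, nsmul_eq_mul]
  rw [Nat.add_sub_cancel]
  push_cast
  field_simp
  ring

/-- The attraction `w / |w|³` of a unit mass at `w` on the origin; it is `0` at `w = 0`. -/
def kernel (w : ℂ) : ℂ := w / ((‖w‖ ^ 3 : ℝ) : ℂ)

/-- The derivative of `kernel` at `w`. -/
def kernelDeriv (w : ℂ) : ℂ →L[ℝ] ℂ :=
  (-(1 / 2) / ‖w‖ ^ 3 : ℝ) • ContinuousLinearMap.id ℝ ℂ
    - (3 / 2 * w ^ 2 / ((‖w‖ ^ 5 : ℝ) : ℂ)) • (Complex.conjCLE : ℂ →L[ℝ] ℂ)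

lemma kernelDeriv_apply (w h : ℂ) :
    kernelDeriv w h = -(1 / 2) / ((‖w‖ ^ 3 : ℝ) : ℂ) * h
      - 3 / 2 * w ^ 2 / ((‖w‖ ^ 5 : ℝ) : ℂ) * conj h := by
  simp [kernelDeriv]

lemma hasFDerivAt_kernel {w : ℂ} (hw : w ≠ 0) : HasFDerivAt kernel (kernelDeriv w) w := by
  have hc : (‖w‖ : ℂ) ≠ 0 := by simpa using hw
  have hkernel : kernel = fun w : ℂ => (‖w‖ ^ 3)⁻¹ • id w := by
    funext w; simp [kernel, div_eq_inv_mul]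
  rw [hkernel]
  refine ((hasFDerivAt_inv_norm_pow 3 hw).smul (hasFDerivAt_id w)).congr_fderiv
    (ContinuousLinearMap.ext fun h => ?_)
  have hinner : ((inner ℝ w h : ℝ) : ℂ) = (h * conj w + conj h * w) / 2 := by
    rw [Complex.inner, Complex.re_eq_add_conj]; simp
  rw [kernelDeriv_apply]
  simp only [add_apply, smul_apply, ContinuousLinearMap.smulRight_apply,
    ContinuousLinearMap.id_apply, innerSL_apply_apply, id, smul_eq_mul, Complex.real_smul]
  push_cast
  rw [hinner]
  field_simp
  rw [← Complex.mul_conj']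
  ring

lemma kernel_neg (w : ℂ) : kernel (-w) = -kernel w := by
  rw [kernel, kernel, norm_neg, neg_div]

lemma kernelDeriv_neg_neg (w h : ℂ) : kernelDeriv (-w) (-h) = -kernelDeriv w h := by
  simp only [kernelDeriv_apply, norm_neg, map_neg]
  ring

lemma kernel_mul (c w : ℂ) : kernel (c * w) = c / ((‖c‖ ^ 3 : ℝ) : ℂ) * kernel w := by
  simp only [kernel, norm_mul, mul_pow, Complex.ofReal_mul]
  exact mul_div_mul_comm ..

lemma kernelDeriv_mul (c w h : ℂ) :
    kernelDeriv (c * w) (c * h) = c / ((‖c‖ ^ 3 : ℝ) : ℂ) * kernelDeriv w h := by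
  rcases eq_or_ne c 0 with rfl | hc
  · simp
  rcases eq_or_ne w 0 with rfl | hw
  · simp [kernelDeriv_apply]
  have hc' : (‖c‖ : ℂ) ≠ 0 := by simpa using hc
  have hw' : (‖w‖ : ℂ) ≠ 0 := by simpa using hw
  simp only [kernelDeriv_apply, norm_mul, mul_pow, map_mul]
  push_cast
  field_simp
  rw [mul_sub, ← Complex.mul_conj']
  ring

lemma conj_mul_kernel (w : ℂ) : conj w * kernel w = ((‖w‖⁻¹ : ℝ) : ℂ) := by
  rcases eq_or_ne w 0 with rfl | hw
  · simp
  have hw' : (‖w‖ : ℂ) ≠ 0 := by simpa using hw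
  rw [kernel, ← mul_div_assoc, Complex.conj_mul']
  push_cast
  field_simp

lemma norm_kernel (w : ℂ) : ‖kernel w‖ = (‖w‖ ^ 2)⁻¹ := by
  rcases eq_or_ne w 0 with rfl | hw
  · simp [kernel]
  have hw' : ‖w‖ ≠ 0 := norm_ne_zero_iff.2 hw
  rw [kernel, norm_div, Complex.norm_of_nonneg (by positivity)]
  field_simp

/-! ### The force and its derivative -/

section Force

variable {n : ℕ} (m : Fin n → ℝ)

/-- The force `∂U/∂q_i` on the `i`-th body, with the attraction of a body on itself being `0`. -/
def force (q : Fin n → ℂ) (i : Fin n) : ℂ := ∑ j, (m i * m j : ℂ) * kernel (q j - q i)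

/-- The derivative of `force m` at `q` in the direction `h`. -/
def forceDeriv (q h : Fin n → ℂ) (i : Fin n) : ℂ :=
  ∑ j, (m i * m j : ℂ) * kernelDeriv (q j - q i) (h j - h i)

lemma sum_mul_sum_of_antisymm {ι : Type*} [Fintype ι] (u : ι → ℂ) {G : ι → ι → ℂ}
    (hG : ∀ i j, G j i = -G i j) :
    ∑ i, u i * ∑ j, G i j = -(1 / 2) * ∑ i, ∑ j, (u j - u i) * G i j := by
  have hswap : ∑ i, ∑ j, u j * G i j = -∑ i, ∑ j, u i * G i j := by
    rw [Finset.sum_comm]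
    simp only [← Finset.sum_neg_distrib, ← mul_neg, ← hG]
  simp only [sub_mul, Finset.sum_sub_distrib, hswap, Finset.mul_sum]
  ring

lemma sum_mul_force (u q : Fin n → ℂ) :
    ∑ i, u i * force m q i
      = -(1 / 2) * ∑ i, ∑ j, (m i * m j : ℂ) * ((u j - u i) * kernel (q j - q i)) := by
  simp only [force]
  rw [sum_mul_sum_of_antisymm u fun i j => by rw [← neg_sub (q j), kernel_neg]; ring]
  simp only [mul_left_comm]

lemma sum_mul_forceDeriv (u q h : Fin n → ℂ) :
    ∑ i, u i * forceDeriv m q h i = -(1 / 2) *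
      ∑ i, ∑ j, (m i * m j : ℂ) * ((u j - u i) * kernelDeriv (q j - q i) (h j - h i)) := by
  simp only [forceDeriv]
  rw [sum_mul_sum_of_antisymm u fun i j => by
    rw [← neg_sub (q j), ← neg_sub (h j), kernelDeriv_neg_neg]; ring]
  simp only [mul_left_comm]

lemma sum_forceDeriv (q h : Fin n → ℂ) : ∑ i, forceDeriv m q h i = 0 := by
  simpa using sum_mul_forceDeriv m 1 q h

lemma force_mul (c : ℂ) (q : Fin n → ℂ) (i : Fin n) :
    force m (fun i => c * q i) i = c / ((‖c‖ ^ 3 : ℝ) : ℂ) * force m q i := by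
  simp only [force, ← mul_sub, kernel_mul, Finset.mul_sum, mul_left_comm]

lemma forceDeriv_mul (c : ℂ) (q h : Fin n → ℂ) (i : Fin n) :
    forceDeriv m (fun i => c * q i) (fun i => c * h i) i
      = c / ((‖c‖ ^ 3 : ℝ) : ℂ) * forceDeriv m q h i := by
  simp only [forceDeriv, ← mul_sub, kernelDeriv_mul, Finset.mul_sum, mul_left_comm]

lemma two_mul_potential (q : Fin n → ℂ) :
    2 * potential m q = ∑ i, ∑ j, m i * m j * ‖q j - q i‖⁻¹ := by
  have hoff := Finset.sum_sum_Ioi_add_eq_sum_sum_off_diag fun i j => m i * m j * ‖q i - q j‖⁻¹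
  calc 2 * potential m q
      = ∑ i, ∑ j ∈ Finset.Ioi i, (m j * m i * ‖q j - q i‖⁻¹ + m i * m j * ‖q i - q j‖⁻¹) := by
        simp only [potential, Finset.mul_sum, norm_sub_rev (q _) (q _), mul_comm (m _) (m _),
          two_mul, div_eq_mul_inv]
    _ = ∑ i, ∑ j, m i * m j * ‖q j - q i‖⁻¹ := by
        rw [hoff]
        refine Finset.sum_congr rfl fun i _ => ?_
        rw [← Finset.sum_compl_add_sum {i} fun j => m i * m j * ‖q j - q i‖⁻¹]
        simp [mul_comm (m i)]

lemma sum_conj_mul_force (q : Fin n → ℂ) :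
    ∑ i, conj (q i) * force m q i = -(potential m q : ℂ) := by
  have h := congrArg (fun x : ℝ => (x : ℂ)) (two_mul_potential m q)
  push_cast at h
  rw [sum_mul_force m (fun i => conj (q i)) q]
  simp only [← map_sub, conj_mul_kernel, Complex.ofReal_inv, ← h]
  ring

variable {m}

lemma potential_pos {q : Fin n → ℂ} (hm : ∀ i, 0 < m i) (hq : Function.Injective q)
    {i j : Fin n} (hij : i < j) : 0 < potential m q := by
  have hterm (i : Fin n) : ∀ j ∈ Finset.Ioi i, 0 < m i * m j / ‖q i - q j‖ := fun j hj =>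
    div_pos (mul_pos (hm i) (hm j))
      (norm_sub_pos_iff.2 (hq.ne (Finset.mem_Ioi.1 hj).ne))
  exact Finset.sum_pos' (fun i _ => Finset.sum_nonneg fun j hj => (hterm i j hj).le)
    ⟨i, Finset.mem_univ _, Finset.sum_pos (hterm i) ⟨j, Finset.mem_Ioi.2 hij⟩⟩

end Force

/-! ### The equations of motion and their linearization -/

section Hamiltonian

variable {n : ℕ} {m : Fin n → ℝ}

lemma hasFDerivAt_sub_apply (q : Fin n → ℂ) (i j : Fin n) :
    HasFDerivAt (fun q : Fin n → ℂ => q j - q i)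
      (ContinuousLinearMap.proj (R := ℝ) (φ := fun _ => ℂ) j - ContinuousLinearMap.proj i) q :=
  (hasFDerivAt_apply j q).sub (hasFDerivAt_apply i q)

lemma inner_ofReal_mul_left (c : ℝ) (w z : ℂ) : inner ℝ ((c : ℂ) * w) z = c * inner ℝ w z := by
  rw [← Complex.real_smul, real_inner_smul_left]

lemma sum_inner_force (m : Fin n → ℝ) (q h : Fin n → ℂ) :
    ∑ i, inner ℝ (force m q i) (h i)
      = -(1 / 2) * ∑ i, ∑ j, m i * m j * inner ℝ (kernel (q j - q i)) (h j - h i) := by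
  have hre := congrArg Complex.re (sum_mul_force m (fun i => conj (h i)) q)
  have hcoef : -(1 / 2 : ℂ) = ((-(1 / 2) : ℝ) : ℂ) := by norm_num
  simp only [hcoef, Complex.re_ofReal_mul, Complex.re_sum, ← Complex.ofReal_mul, ← map_sub] at hre
  simp only [real_inner_comm (h _), real_inner_comm (h _ - h _), Complex.inner,
    mul_comm _ (conj _), hre]

lemma hasFDerivAt_potential (m : Fin n → ℝ) {q : Fin n → ℂ} (hq : Function.Injective q) :
    HasFDerivAt (potential m)
      (∑ i, (innerSL ℝ (force m q i)).comp (ContinuousLinearMap.proj i)) q := by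
  have hterm (i j : Fin n) : HasFDerivAt (fun q : Fin n → ℂ => m i * m j * ‖q j - q i‖⁻¹)
      ((m i * m j) • -(innerSL ℝ (kernel (q j - q i))).comp
        (ContinuousLinearMap.proj (R := ℝ) (φ := fun _ => ℂ) j - ContinuousLinearMap.proj i))
      q := by
    rcases eq_or_ne i j with rfl | hij
    · simpa using hasFDerivAt_const (0 : ℝ) q
    have h := (hasFDerivAt_inv_norm_pow 1 (sub_ne_zero.2 (hq.ne hij.symm))).comp q
      (hasFDerivAt_sub_apply q i j)
    simp only [pow_one] at h
    refine (h.const_mul (m i * m j)).congr_fderiv (ContinuousLinearMap.ext fun v => ?_)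
    simp only [kernel, div_eq_inv_mul, ← Complex.ofReal_inv, smul_apply, neg_apply,
      ContinuousLinearMap.comp_apply, innerSL_apply_apply, inner_ofReal_mul_left, smul_eq_mul]
    norm_num
  have hU : potential m = fun q => 1 / 2 * ∑ i, ∑ j, m i * m j * ‖q j - q i‖⁻¹ := by
    funext q
    rw [← two_mul_potential]; ring
  rw [hU]
  refine ((HasFDerivAt.fun_sum fun i _ => HasFDerivAt.fun_sum fun j _ =>
    hterm i j).const_mul (1 / 2)).congr_fderiv (ContinuousLinearMap.ext fun h => ?_)
  simp only [smul_apply, sum_apply, neg_apply, sub_apply, ContinuousLinearMap.comp_apply,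
    ContinuousLinearMap.proj_apply, innerSL_apply_apply, smul_eq_mul, sum_inner_force, mul_neg,
    Finset.sum_neg_distrib]
  ring

lemma hasFDerivAt_force (m : Fin n → ℝ) {q : Fin n → ℂ} (hq : Function.Injective q) :
    HasFDerivAt (force m) (ContinuousLinearMap.pi fun i => ∑ j, (m i * m j : ℂ) •
      (kernelDeriv (q j - q i)).comp
        (ContinuousLinearMap.proj (R := ℝ) (φ := fun _ => ℂ) j - ContinuousLinearMap.proj i))
      q := by
  refine hasFDerivAt_pi.2 fun i => HasFDerivAt.fun_sum fun j _ => ?_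
  refine HasFDerivAt.const_mul ?_ _
  rcases eq_or_ne i j with rfl | hij
  · simpa [kernel] using hasFDerivAt_const (𝕜 := ℝ) (0 : ℂ) q
  · exact (hasFDerivAt_kernel (sub_ne_zero.2 (hq.ne hij.symm))).comp q
      (hasFDerivAt_sub_apply q i j)

lemma hasFDerivAt_hamiltonian {x : Phase n} (hx : Function.Injective (pos x)) :
    HasFDerivAt (hamiltonian m)
      (∑ i, (innerSL ℝ (mom x i / m i)).comp
          ((ContinuousLinearMap.proj (φ := fun _ => ℂ) i).comp (momL n))
        - (∑ i, (innerSL ℝ (force m (pos x) i)).comp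
          (ContinuousLinearMap.proj (φ := fun _ => ℂ) i)).comp (posL n)) x := by
  have hkin (i : Fin n) : HasFDerivAt (fun x : Phase n => ‖mom x i‖ ^ 2 / (2 * m i))
      ((innerSL ℝ (mom x i / m i)).comp
        ((ContinuousLinearMap.proj (φ := fun _ => ℂ) i).comp (momL n))) x := by
    have hmom := ((ContinuousLinearMap.proj (R := ℝ) (φ := fun _ => ℂ) i).comp
      (momL n)).hasFDerivAt (x := x)
    have h := ((hasStrictFDerivAt_norm_sq (mom x i)).hasFDerivAt.comp x hmom).mul_const
      (2 * m i)⁻¹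
    refine (h.congr_fderiv (ContinuousLinearMap.ext fun v => ?_))
    simp only [div_eq_inv_mul, ← Complex.ofReal_inv, smul_apply, ContinuousLinearMap.comp_apply,
      innerSL_apply_apply, inner_ofReal_mul_left, smul_eq_mul, nsmul_eq_mul, mul_inv]
    push_cast
    ring
  exact (HasFDerivAt.fun_sum fun i _ => hkin i).sub
    ((hasFDerivAt_potential m hx).comp x (posL n).hasFDerivAt)

lemma grad_hamiltonian {x : Phase n} (hx : Function.Injective (pos x)) :
    grad (hamiltonian m) x = phasePoint (fun i => mom x i / m i) (-force m (pos x)) :=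
  grad_eq_of_hasFDerivAt (hasFDerivAt_hamiltonian hx) fun v => by
    simp only [dotProduct_phase, mom_phasePoint, pos_phasePoint, Pi.neg_apply, inner_neg_left,
      Finset.sum_neg_distrib, ← sub_eq_add_neg, sub_apply, sum_apply,
      ContinuousLinearMap.comp_apply, ContinuousLinearMap.proj_apply, momL_apply, posL_apply,
      innerSL_apply_apply]

lemma eventually_injective {X : Type*} [TopologicalSpace X] [T2Space X] {q : Fin n → X}
    (hq : Function.Injective q) : ∀ᶠ q' in 𝓝 q, Function.Injective q' := by
  have hne : ∀ᶠ q' in 𝓝 q, ∀ i j, i ≠ j → q' i ≠ q' j := by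
    simp only [eventually_all]
    exact fun i j hij =>
      (isOpen_ne_fun (continuous_apply i) (continuous_apply j)).eventually_mem (hq.ne hij)
  filter_upwards [hne] with q' hq' i j using not_imp_not.1 (hq' i j)

lemma hessian_hamiltonian_mulVec {x : Phase n} (hx : Function.Injective (pos x)) (v : Phase n) :
    (hessian (hamiltonian m) x).mulVec v
      = phasePoint (fun i => mom v i / m i) (-forceDeriv m (pos x) (pos v)) := by
  have hgrad : grad (hamiltonian m) =ᶠ[𝓝 x] fun y =>
      (phaseEquiv n).symm (fun i => mom y i / m i, -force m (pos y)) := by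
    filter_upwards [(posL n).continuous.continuousAt.eventually (eventually_injective hx)]
      with y hy using grad_hamiltonian hy
  have hvel : HasFDerivAt (fun (y : Phase n) i => mom y i / m i)
      (ContinuousLinearMap.pi fun i => (m i : ℂ)⁻¹ •
        (ContinuousLinearMap.proj (R := ℝ) (φ := fun _ => ℂ) i).comp (momL n)) x := by
    refine ((ContinuousLinearMap.hasFDerivAt _).congr_of_eventuallyEq
      (Eventually.of_forall fun y => ?_))
    funext i
    simp [div_eq_inv_mul]
  have hforce := ((hasFDerivAt_force m hx).comp x (posL n).hasFDerivAt).neg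
  have h := (phaseEquiv n).symm.hasFDerivAt.comp x (hvel.prodMk hforce)
  rw [hessian_mulVec_of_hasFDerivAt hgrad h]
  change phasePoint _ _ = phasePoint _ _
  congr 1
  · funext i
    simp [div_eq_inv_mul]
  · funext i
    simp [forceDeriv]

end Hamiltonian

/-! ### Real matrices of real-linear maps of complex vectors -/

section RealMatrix

variable {n : ℕ}

/-- The real coordinates of a complex vector. -/
def coordVec (w : Fin n → ℂ) : Coord n → ℝ :=
  fun k => if k.1 = 0 then (w k.2).re else (w k.2).im

lemma phasePoint_eq_sumElim (P Q : Fin n → ℂ) :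
    phasePoint P Q = Sum.elim (coordVec P) (coordVec Q) := rfl

/-- The matrix, in real coordinates, of the real-linear map `w ↦ P w + Q conj(w)`. -/
def realMatrix (P Q : Matrix (Fin n) (Fin n) ℂ) : Matrix (Coord n) (Coord n) ℝ :=
  Matrix.of fun k l =>
    if k.1 = 0 then
      if l.1 = 0 then (P k.2 l.2 + Q k.2 l.2).re else (Q k.2 l.2 - P k.2 l.2).im
    else
      if l.1 = 0 then (P k.2 l.2 + Q k.2 l.2).im else (P k.2 l.2 - Q k.2 l.2).re

lemma realMatrix_mulVec (P Q : Matrix (Fin n) (Fin n) ℂ) (w : Fin n → ℂ) :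
    (realMatrix P Q).mulVec (coordVec w) = coordVec (P.mulVec w + Q.mulVec (star w)) := by
  funext ⟨c, j⟩
  simp only [Matrix.mulVec, dotProduct, Fintype.sum_prod_type, Fin.sum_univ_two, coordVec,
    Pi.add_apply, ← Finset.sum_add_distrib, Complex.re_sum, Complex.im_sum]
  fin_cases c <;>
    simp only [Fin.zero_eta, Fin.mk_one, Fin.isValue, one_ne_zero, ↓reduceIte] <;>
    refine Finset.sum_congr rfl fun k _ => ?_ <;> simp [realMatrix] <;> ring

lemma isSymm_realMatrix {P Q : Matrix (Fin n) (Fin n) ℂ} (hP : P.IsHermitian) (hQ : Q.IsSymm) :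
    (realMatrix P Q).IsSymm := by
  ext ⟨c, j⟩ ⟨d, k⟩
  have hPjk : P k j = conj (P j k) := (hP.apply k j).symm
  fin_cases c <;> fin_cases d <;> simp [realMatrix, hPjk, hQ.apply j k] <;> ring

/-- The coefficient matrix of the reduced linearized system, where `z ↦ P z + Q conj(z)` is the
second derivative of the force function divided by its value. -/
def reducedMatrix (P Q : Matrix (Fin n) (Fin n) ℂ) (e s : ℝ) :
    Matrix (Coord n ⊕ Coord n) (Coord n ⊕ Coord n) ℝ :=
  Matrix.fromBlocks 1 (realMatrix (Matrix.diagonal fun _ => -Complex.I) 0)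
    (realMatrix (Matrix.diagonal fun _ => Complex.I) 0)
    (1 - (1 + e * Real.cos s)⁻¹ • (1 + realMatrix P Q))

lemma isSymm_reducedMatrix {P Q : Matrix (Fin n) (Fin n) ℂ} (hP : P.IsHermitian) (hQ : Q.IsSymm)
    (e s : ℝ) : (reducedMatrix P Q e s).IsSymm := by
  refine Matrix.IsSymm.fromBlocks Matrix.isSymm_one ?_ ?_
  · ext ⟨c, j⟩ ⟨d, k⟩
    rcases eq_or_ne j k with rfl | h
    · fin_cases c <;> fin_cases d <;> simp [realMatrix]
    · fin_cases c <;> fin_cases d <;> simp [realMatrix, h, h.symm]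
  · exact Matrix.isSymm_one.sub ((Matrix.isSymm_one.add (isSymm_realMatrix hP hQ)).smul _)

lemma reducedMatrix_mulVec (P Q : Matrix (Fin n) (Fin n) ℂ) (e s : ℝ) (x : Phase n) :
    (reducedMatrix P Q e s).mulVec x
      = phasePoint (mom x - Complex.I • pos x)
        (Complex.I • mom x + (pos x - (1 + e * Real.cos s)⁻¹ •
          (pos x + (P.mulVec (pos x) + Q.mulVec (star (pos x)))))) := by
  have hscalar (c : ℂ) (w : Fin n → ℂ) :
      (realMatrix (Matrix.diagonal fun _ => c) 0).mulVec (coordVec w) = coordVec (c • w) := by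
    rw [realMatrix_mulVec, Matrix.zero_mulVec, add_zero]
    congr 1
    funext j
    simp [Matrix.mulVec_diagonal]
  conv_lhs => rw [← phasePoint_mom_pos x, phasePoint_eq_sumElim]
  rw [reducedMatrix, Matrix.fromBlocks_mulVec]
  simp only [Sum.elim_comp_inl, Sum.elim_comp_inr, hscalar, Matrix.one_mulVec, Matrix.sub_mulVec,
    Matrix.smul_mulVec, Matrix.add_mulVec, realMatrix_mulVec]
  rw [phasePoint_eq_sumElim]
  generalize (1 + e * Real.cos s)⁻¹ = b
  congr 1 <;> funext ⟨c, j⟩ <;> fin_cases c <;> simp [coordVec] <;> ring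

lemma reducedMatrix_diagonal (f g : Fin n → ℝ) (e s : ℝ) :
    reducedMatrix (Matrix.diagonal fun j => (f j : ℂ)) (Matrix.diagonal fun j => (g j : ℂ)) e s
      = directSum fun j => part (1 + f j + g j) (1 + f j - g j) e s := by
  ext x y
  rcases x with ⟨c, j⟩ | ⟨c, j⟩ <;> rcases y with ⟨d, k⟩ | ⟨d, k⟩ <;> by_cases h : j = k
  all_goals
    first | subst h | skip
    fin_cases c <;> fin_cases d <;>
      simp [reducedMatrix, directSum, realMatrix, part, Matrix.blockDiagonal_apply, *] <;> ring

lemma part_three_zero {e s : ℝ} (h : 1 + e * Real.cos s ≠ 0) : part 3 0 e s = keplerPart e s := by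
  have hk : 1 - 3 / (1 + e * Real.cos s) = -((2 - e * Real.cos s) / (1 + e * Real.cos s)) := by
    field_simp; ring
  simp [part, keplerPart, hk]

end RealMatrix

/-! ### Frames -/

section MassInner

variable {n : ℕ}

/-- The Hermitian form `∑ m_i conj(u_i) v_i`. -/
def massInner (m : Fin n → ℝ) : (Fin n → ℂ) →ₗ⋆[ℂ] (Fin n → ℂ) →ₗ[ℂ] ℂ :=
  LinearMap.mk₂'ₛₗ (starRingEnd ℂ) (RingHom.id ℂ) (fun u v => ∑ i, m i * conj (u i) * v i)
    (fun u u' v => by simp [mul_add, add_mul, Finset.sum_add_distrib])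
    (fun c u v => by simp [Finset.mul_sum, mul_assoc, mul_left_comm])
    (fun u v v' => by simp [mul_add, Finset.sum_add_distrib])
    (fun c u v => by simp [Finset.mul_sum, mul_left_comm])

lemma massInner_apply (m : Fin n → ℝ) (u v : Fin n → ℂ) :
    massInner m u v = ∑ i, m i * conj (u i) * v i := rfl

lemma massInner_one_left (m : Fin n → ℝ) (v : Fin n → ℂ) : massInner m 1 v = ∑ i, m i * v i := by
  simp [massInner_apply]

lemma conj_massInner (m : Fin n → ℝ) (u v : Fin n → ℂ) :
    conj (massInner m u v) = massInner m v u := by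
  simp only [massInner_apply, map_sum, map_mul, Complex.conj_conj, Complex.conj_ofReal]
  exact Finset.sum_congr rfl fun i _ => by ring

lemma massInner_self (m : Fin n → ℝ) (v : Fin n → ℂ) :
    massInner m v v = ((∑ i, m i * ‖v i‖ ^ 2 : ℝ) : ℂ) := by
  push_cast
  rw [massInner_apply]
  exact Finset.sum_congr rfl fun i _ => by rw [← Complex.mul_conj']; ring

lemma massInner_inv_sqrt_smul_self {m : Fin n → ℝ} {v : Fin n → ℂ} {N : ℝ} (hN : 0 < N)
    (hv : massInner m v v = N) :
    massInner m ((Real.sqrt N : ℂ)⁻¹ • v) ((Real.sqrt N : ℂ)⁻¹ • v) = 1 := by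
  have hsq : (Real.sqrt N : ℂ) ^ 2 = N := by exact_mod_cast Real.sq_sqrt hN.le
  have hN' : (N : ℂ) ≠ 0 := by exact_mod_cast hN.ne'
  rw [map_smul, map_smulₛₗ, LinearMap.smul_apply, hv, map_inv₀, Complex.conj_ofReal, smul_smul,
    ← mul_inv, ← sq, hsq, smul_eq_mul, inv_mul_cancel₀ hN']

end MassInner

section Frame

variable {k : ℕ} {m : Fin (k + 2) → ℝ} {a : Fin (k + 2) → ℂ}
  {V : Matrix (Fin (k + 2)) (Fin (k + 1)) ℂ}

lemma isFrame_iff : IsFrame m a V ↔ V.col 0 = a ∧ (∀ j, massInner m 1 (V.col j) = 0) ∧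
    ∀ j j', massInner m (V.col j) (V.col j') = if j = j' then 1 else 0 := by
  simp only [massInner_one_left]
  exact ⟨fun h => ⟨funext h.first, h.centred, h.orthonormal⟩,
    fun h => ⟨fun i => congrFun h.1 i, h.2.1, h.2.2⟩⟩

lemma isFrame_of_lt (hfst : V.col 0 = a) (hone : ∀ j, massInner m 1 (V.col j) = 0)
    (hself : ∀ j, massInner m (V.col j) (V.col j) = 1)
    (hlt : ∀ i j, i < j → massInner m (V.col i) (V.col j) = 0) : IsFrame m a V := by
  refine isFrame_iff.2 ⟨hfst, hone, fun i j => ?_⟩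
  rcases lt_trichotomy i j with h | rfl | h
  · rw [hlt i j h, if_neg h.ne]
  · rw [hself, if_pos rfl]
  · rw [← conj_massInner, hlt j i h, map_zero, if_neg h.ne']

lemma massInner_mulVec {n l : ℕ} (m : Fin n → ℝ) (u : Fin n → ℂ) (V : Matrix (Fin n) (Fin l) ℂ)
    (y : Fin l → ℂ) : massInner m u (V.mulVec y) = ∑ j, y j * massInner m u (V.col j) := by
  rw [Matrix.mulVec_eq_sum, map_sum]
  simp [Matrix.col_def]

lemma IsFrame.massInner_col_mulVec (hV : IsFrame m a V) (y : Fin (k + 1) → ℂ) (j : Fin (k + 1)) :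
    massInner m (V.col j) (V.mulVec y) = y j := by
  simp [massInner_mulVec, (isFrame_iff.1 hV).2.2]

lemma IsFrame.massInner_one_mulVec (hV : IsFrame m a V) (y : Fin (k + 1) → ℂ) :
    massInner m 1 (V.mulVec y) = 0 := by
  simp [massInner_mulVec, (isFrame_iff.1 hV).2.1]

lemma IsFrame.massInner_mulVec_mulVec (hV : IsFrame m a V) (x y : Fin (k + 1) → ℂ) :
    massInner m (V.mulVec x) (V.mulVec y) = ∑ j, conj (x j) * y j := by
  rw [← conj_massInner, massInner_mulVec]
  simp only [map_sum, map_mul, conj_massInner, hV.massInner_col_mulVec]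

lemma IsFrame.range_mulVec (hV : IsFrame m a V) (hm : ∀ i, 0 < m i) :
    LinearMap.range V.mulVecLin = LinearMap.ker (massInner m 1) := by
  have hinj : Function.Injective V.mulVecLin := fun x y hxy => by
    funext j
    rw [← hV.massInner_col_mulVec x j, ← hV.massInner_col_mulVec y j]
    exact congrArg (massInner m (V.col j)) hxy
  have hne : massInner m 1 ≠ 0 := fun h => by
    have := congrArg (fun φ => φ (Pi.single 0 1)) h
    simp [massInner_one_left, Pi.single_apply, (hm 0).ne'] at this
  refine Submodule.eq_of_le_of_finrank_eq ?_ ?_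
  · rintro _ ⟨y, rfl⟩
    exact hV.massInner_one_mulVec y
  · have := Module.Dual.finrank_ker_add_one_of_ne_zero hne
    rw [LinearMap.finrank_range_of_inj hinj]
    simp only [Module.finrank_fin_fun] at this ⊢
    omega

lemma IsFrame.eq_mulVec (hV : IsFrame m a V) (hm : ∀ i, 0 < m i) {w : Fin (k + 2) → ℂ}
    (hw : massInner m 1 w = 0) : w = V.mulVec fun j => massInner m (V.col j) w := by
  obtain ⟨y, rfl⟩ : w ∈ LinearMap.range V.mulVecLin := by rwa [hV.range_mulVec hm]
  simp only [Matrix.mulVecLin_apply, hV.massInner_col_mulVec]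

end Frame

/-! ### The second derivative of the force function in a frame -/

section Hess

variable {n l : ℕ} (m : Fin n → ℝ) (a : Fin n → ℂ) (V : Matrix (Fin n) (Fin l) ℂ)

/-- The complex linear part of the second derivative of `U` at `a` in the basis `V`. -/
def hessLin : Matrix (Fin l) (Fin l) ℂ :=
  Matrix.of fun j k => 1 / 4 * ∑ i, ∑ i', (m i * m i' : ℂ) / ((‖a i' - a i‖ ^ 3 : ℝ) : ℂ) *
    (conj (V i' j - V i j) * (V i' k - V i k))

/-- The conjugate linear part of the second derivative of `U` at `a` in the basis `V`. -/
def hessConj : Matrix (Fin l) (Fin l) ℂ :=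
  Matrix.of fun j k => 3 / 4 * ∑ i, ∑ i',
    (m i * m i' : ℂ) * (a i' - a i) ^ 2 / ((‖a i' - a i‖ ^ 5 : ℝ) : ℂ) *
      (conj (V i' j - V i j) * conj (V i' k - V i k))

lemma isHermitian_hessLin : (hessLin m a V).IsHermitian := by
  ext j k
  simp only [hessLin, Matrix.conjTranspose_apply, Matrix.of_apply, Complex.star_def, map_mul,
    map_sum, map_div₀, Complex.conj_conj, Complex.conj_ofReal, map_one, map_ofNat,
    mul_comm (conj _) (_ - _)]

lemma isSymm_hessConj : (hessConj m a V).IsSymm := by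
  ext j k
  simp only [hessConj, Matrix.transpose_apply, Matrix.of_apply,
    mul_comm (conj (V _ k - V _ k)) (conj (V _ j - V _ j))]

lemma sum_conj_mul_forceDeriv_mulVec (z : Fin l → ℂ) (j : Fin l) :
    ∑ i, conj (V i j) * forceDeriv m a (V.mulVec z) i
      = ((hessLin m a V).mulVec z + (hessConj m a V).mulVec (star z)) j := by
  rw [sum_mul_forceDeriv m fun i => conj (V i j)]
  simp only [Pi.add_apply, Matrix.mulVec, dotProduct, hessLin, hessConj, Matrix.of_apply,
    Finset.mul_sum, Finset.sum_mul, ← Finset.sum_add_distrib]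
  conv_rhs => rw [Finset.sum_comm]
  refine Finset.sum_congr rfl fun i _ => ?_
  conv_rhs => rw [Finset.sum_comm]
  refine Finset.sum_congr rfl fun i' _ => ?_
  rw [← Finset.sum_sub_distrib]
  simp only [kernelDeriv_apply, ← sub_mul, map_sum, map_sub, map_mul, Finset.mul_sum]
  exact Finset.sum_congr rfl fun k _ => by rw [Pi.star_apply, Complex.star_def]; ring

lemma IsFrame.forceDeriv_mulVec {k : ℕ} {m : Fin (k + 2) → ℝ} {a : Fin (k + 2) → ℂ}
    {V : Matrix (Fin (k + 2)) (Fin (k + 1)) ℂ} (hV : IsFrame m a V) (hm : ∀ i, 0 < m i)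
    (z : Fin (k + 1) → ℂ) (i : Fin (k + 2)) :
    forceDeriv m a (V.mulVec z) i
      = m i * V.mulVec ((hessLin m a V).mulVec z + (hessConj m a V).mulVec (star z)) i := by
  have hm' (i : Fin (k + 2)) : (m i : ℂ) ≠ 0 := by exact_mod_cast (hm i).ne'
  have hcancel (u : Fin (k + 2) → ℂ) :
      massInner m u (fun i => forceDeriv m a (V.mulVec z) i / m i)
        = ∑ i, conj (u i) * forceDeriv m a (V.mulVec z) i := by
    rw [massInner_apply]
    exact Finset.sum_congr rfl fun i _ => by have := hm' i; field_simp
  have hcentred : massInner m 1 (fun i => forceDeriv m a (V.mulVec z) i / m i) = 0 := by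
    simp [hcancel, sum_forceDeriv]
  have h := congrFun (hV.eq_mulVec hm hcentred) i
  simp only [hcancel, Matrix.col_apply, sum_conj_mul_forceDeriv_mulVec] at h
  rw [← h, mul_div_cancel₀ _ (hm' i)]

end Hess

/-! ### Kepler motion -/

lemma surjective_of_le_deriv {θ θ' : ℝ → ℝ} (hθ : ∀ t, HasDerivAt θ (θ' t) t) {c : ℝ} (hc : 0 < c)
    (hc' : ∀ t, c ≤ θ' t) : Function.Surjective θ := by
  have hd (t : ℝ) : HasDerivAt (fun t => θ t - c * t) (θ' t - c) t := by
    simpa using (hθ t).fun_sub ((hasDerivAt_id t).const_mul c)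
  have hmono : Monotone fun t => θ t - c * t :=
    monotone_of_deriv_nonneg (fun t => (hd t).differentiableAt) fun t => by
      rw [(hd t).deriv]
      exact sub_nonneg.2 (hc' t)
  have hcont : Continuous θ := continuous_iff_continuousAt.2 fun t => (hθ t).continuousAt
  refine hcont.surjective ?_ ?_
  · refine tendsto_atTop_mono' atTop ?_
      (tendsto_atTop_add_const_left atTop (θ 0) (tendsto_id.const_mul_atTop hc))
    filter_upwards [eventually_ge_atTop 0] with t ht
    have := hmono ht
    simp only [mul_zero, sub_zero, id_eq] at this ⊢
    linarith
  · refine tendsto_atBot_mono' atBot ?_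
      (tendsto_atBot_add_const_left atBot (θ 0) (tendsto_id.const_mul_atBot hc))
    filter_upwards [eventually_le_atBot 0] with t ht
    have := hmono ht
    simp only [mul_zero, sub_zero, id_eq] at this ⊢
    linarith

lemma hasDerivAt_comp_iff_of_le_deriv {E : Type*} [NormedAddCommGroup E] [NormedSpace ℝ E]
    {θ θ' : ℝ → ℝ} (hθ : ∀ t, HasDerivAt θ (θ' t) t) {c : ℝ} (hc : 0 < c) (hc' : ∀ t, c ≤ θ' t)
    (ξ G : ℝ → E) :
    (∀ t, HasDerivAt (fun t => ξ (θ t)) (θ' t • G (θ t)) t) ↔ ∀ s, HasDerivAt ξ (G s) s := by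
  have hpos (t : ℝ) : 0 < θ' t := hc.trans_le (hc' t)
  refine ⟨fun h s => ?_, fun h t => (h (θ t)).scomp t (hθ t)⟩
  have hmono : StrictMono θ := strictMono_of_deriv_pos fun t => by
    rw [(hθ t).deriv]; exact hpos t
  let g := hmono.orderIsoOfSurjective θ (surjective_of_le_deriv hθ hc hc')
  have hg (s : ℝ) : θ (g.symm s) = s := g.apply_symm_apply s
  have hd : HasDerivAt g.symm (θ' (g.symm s))⁻¹ s :=
    HasDerivAt.of_local_left_inverse g.symm.continuous.continuousAt (hθ _) (hpos _).ne'
      (Eventually.of_forall hg)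
  have := (h (g.symm s)).scomp s hd
  simpa [Function.comp_def, hg, smul_smul, inv_mul_cancel₀ (hpos (g.symm s)).ne'] using this

section Kepler

variable {e μ p : ℝ} {θ : ℝ → ℝ}

lemma one_sub_le_one_add_mul_cos (he₀ : 0 ≤ e) (s : ℝ) : 1 - e ≤ 1 + e * Real.cos s := by
  linarith [mul_le_mul_of_nonneg_left (Real.neg_one_le_cos s) he₀]

lemma one_add_mul_cos_pos (he₀ : 0 ≤ e) (he₁ : e < 1) (s : ℝ) : 0 < 1 + e * Real.cos s :=
  (sub_pos.2 he₁).trans_le (one_sub_le_one_add_mul_cos he₀ s)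

lemma radius_pos (he₀ : 0 ≤ e) (he₁ : e < 1) (hp : 0 < p) (s : ℝ) : 0 < radius p e s :=
  div_pos hp (one_add_mul_cos_pos he₀ he₁ s)

lemma radius_mul_one_add_mul_cos (he₀ : 0 ≤ e) (he₁ : e < 1) (s : ℝ) :
    radius p e s * (1 + e * Real.cos s) = p :=
  div_mul_cancel₀ p (one_add_mul_cos_pos he₀ he₁ s).ne'

lemma IsTrueAnomaly.hasDerivAt_radius (he₀ : 0 ≤ e) (he₁ : e < 1) (hp : 0 < p)
    (hθ : IsTrueAnomaly μ p e θ) (t : ℝ) :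
    HasDerivAt (fun s => radius p e (θ s)) (Real.sqrt (μ * p) / p * (e * Real.sin (θ t))) t := by
  have hD := (one_add_mul_cos_pos he₀ he₁ (θ t)).ne'
  simp only [radius, div_eq_mul_inv p]
  refine ((((hθ t).cos.const_mul e).const_add 1).fun_inv hD |>.const_mul p).congr_deriv ?_
  simp only [radius]
  field_simp

lemma IsTrueAnomaly.hasDerivAt_deriv_radius (hμ : 0 ≤ μ) (hp : 0 < p)
    (hθ : IsTrueAnomaly μ p e θ) (t : ℝ) :
    HasDerivAt (fun s => Real.sqrt (μ * p) / p * (e * Real.sin (θ s)))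
      (μ * (e * Real.cos (θ t)) / radius p e (θ t) ^ 2) t := by
  refine (((hθ t).sin.const_mul e).const_mul (Real.sqrt (μ * p) / p)).congr_deriv ?_
  calc _ = (Real.sqrt (μ * p) * Real.sqrt (μ * p)) / p * (e * Real.cos (θ t))
        / radius p e (θ t) ^ 2 := by ring
    _ = _ := by rw [Real.mul_self_sqrt (mul_nonneg hμ hp.le)]; field_simp

lemma exists_pos_le_sqrt_div_radius_sq (he₀ : 0 ≤ e) (he₁ : e < 1) (hμ : 0 < μ) (hp : 0 < p) :
    ∃ c > 0, ∀ s, c ≤ Real.sqrt (μ * p) / radius p e s ^ 2 := by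
  have he : 0 < 1 - e := sub_pos.2 he₁
  refine ⟨Real.sqrt (μ * p) / (p / (1 - e)) ^ 2, by positivity, fun s => ?_⟩
  have hr := radius_pos he₀ he₁ hp s
  have hle : radius p e s ≤ p / (1 - e) :=
    div_le_div_of_nonneg_left hp.le he (one_sub_le_one_add_mul_cos he₀ s)
  gcongr

lemma hasDerivAt_exp_mul_I {θ' t : ℝ} (hθ : HasDerivAt θ θ' t) :
    HasDerivAt (fun s => Complex.exp (θ s * Complex.I))
      (Complex.exp (θ t * Complex.I) * (θ' * Complex.I)) t :=
  (hθ.ofReal_comp.mul_const Complex.I).cexp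

lemma norm_ofReal_mul_exp {r : ℝ} (hr : 0 ≤ r) (s : ℝ) :
    ‖(r : ℂ) * Complex.exp (s * Complex.I)‖ = r := by
  rw [norm_mul, Complex.norm_exp_ofReal_mul_I, Complex.norm_of_nonneg hr, mul_one]

/-- The position `r e^{iθ}` on the Kepler ellipse. -/
def keplerPos (p e : ℝ) (θ : ℝ → ℝ) (t : ℝ) : ℂ :=
  radius p e (θ t) * Complex.exp (θ t * Complex.I)

/-- The velocity on the Kepler ellipse, expressed through the true anomaly. -/
def keplerVel (μ p e : ℝ) (θ : ℝ → ℝ) (t : ℝ) : ℂ :=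
  (((Real.sqrt (μ * p) / p * (e * Real.sin (θ t)) : ℝ) : ℂ)
    + ((Real.sqrt (μ * p) * (radius p e (θ t))⁻¹ : ℝ) : ℂ) * Complex.I)
      * Complex.exp (θ t * Complex.I)

lemma norm_keplerPos (he₀ : 0 ≤ e) (he₁ : e < 1) (hp : 0 < p) (t : ℝ) :
    ‖keplerPos p e θ t‖ = radius p e (θ t) :=
  norm_ofReal_mul_exp (radius_pos he₀ he₁ hp _).le _

lemma keplerPos_ne_zero (he₀ : 0 ≤ e) (he₁ : e < 1) (hp : 0 < p) (t : ℝ) :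
    keplerPos p e θ t ≠ 0 :=
  norm_ne_zero_iff.1 ((norm_keplerPos he₀ he₁ hp t).trans_ne (radius_pos he₀ he₁ hp _).ne')

lemma IsTrueAnomaly.hasDerivAt_keplerPos (he₀ : 0 ≤ e) (he₁ : e < 1) (hp : 0 < p)
    (hθ : IsTrueAnomaly μ p e θ) (t : ℝ) :
    HasDerivAt (keplerPos p e θ) (keplerVel μ p e θ t) t := by
  refine ((hθ.hasDerivAt_radius he₀ he₁ hp t).ofReal_comp.mul
    (hasDerivAt_exp_mul_I (hθ t))).congr_deriv ?_
  have hr : (radius p e (θ t) : ℂ) ≠ 0 := by exact_mod_cast (radius_pos he₀ he₁ hp _).ne'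
  rw [keplerVel]
  push_cast
  field_simp

lemma IsTrueAnomaly.hasDerivAt_keplerVel (he₀ : 0 ≤ e) (he₁ : e < 1) (hμ : 0 ≤ μ) (hp : 0 < p)
    (hθ : IsTrueAnomaly μ p e θ) (t : ℝ) :
    HasDerivAt (keplerVel μ p e θ) (-μ * kernel (keplerPos p e θ t)) t := by
  have hr := (radius_pos he₀ he₁ hp (θ t)).ne'
  refine ((((hθ.hasDerivAt_deriv_radius hμ hp t).ofReal_comp.add
    ((((hθ.hasDerivAt_radius he₀ he₁ hp t).fun_inv hr).const_mul _).ofReal_comp.mul_const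
      Complex.I)).mul (hasDerivAt_exp_mul_I (hθ t)))).congr_deriv ?_
  have hw : (Real.sqrt (μ * p) : ℂ) ^ 2 = μ * p := by
    exact_mod_cast Real.sq_sqrt (mul_nonneg hμ hp.le)
  have hrp : (radius p e (θ t) : ℂ) * (1 + e * Complex.cos (θ t)) = p := by
    exact_mod_cast congrArg Complex.ofReal (radius_mul_one_add_mul_cos (p := p) he₀ he₁ (θ t))
  have hr' : (radius p e (θ t) : ℂ) ≠ 0 := by exact_mod_cast hr
  have hp' : (p : ℂ) ≠ 0 := by exact_mod_cast hp.ne'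
  rw [kernel, norm_keplerPos he₀ he₁ hp, keplerPos]
  simp only [Pi.add_apply]
  push_cast
  generalize (radius p e (θ t) : ℂ) = R at *
  field_simp
  linear_combination (Real.sqrt (μ * p) : ℂ) ^ 2 * p * Complex.I_sq - p * hw + μ * p * hrp

end Kepler

/-! ### Homographic motions -/

/-- `a` is a central configuration with centre of mass `0` and `∑ m_i |a_i|² = 1`; the multiplier
is then the force function `U(a)`. -/
structure IsNormalizedCentral {n : ℕ} (m : Fin n → ℝ) (a : Fin n → ℂ) : Prop where
  injective : Function.Injective a
  centred : ∑ i, (m i : ℂ) * a i = 0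
  inertia : ∑ i, m i * ‖a i‖ ^ 2 = 1
  force_eq : ∀ i, force m a i = -potential m a * m i * a i

lemma injective_const_mul {n : ℕ} {a : Fin n → ℂ} (ha : Function.Injective a) {c : ℂ}
    (hc : c ≠ 0) : Function.Injective fun i => c * a i :=
  (mul_right_injective₀ hc).comp ha

lemma IsNormalizedCentral.solvesHamilton_of_kepler {n : ℕ} {m : Fin n → ℝ} {a : Fin n → ℂ}
    (ha : IsNormalizedCentral m a) (hm : ∀ i, 0 < m i) {c v : ℝ → ℂ} (hc0 : ∀ t, c t ≠ 0)
    (hc : ∀ t, HasDerivAt c (v t) t)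
    (hv : ∀ t, HasDerivAt v (-potential m a * kernel (c t)) t) :
    SolvesHamilton (hamiltonian m)
      fun t => phasePoint (fun i => m i * (v t * a i)) fun i => c t * a i := by
  intro t
  have hm' (i : Fin n) : (m i : ℂ) ≠ 0 := by exact_mod_cast (hm i).ne'
  have hinj : Function.Injective
      (pos (phasePoint (fun i => m i * (v t * a i)) fun i => c t * a i)) := by
    simpa only [pos_phasePoint] using injective_const_mul ha.injective (hc0 t)
  rw [grad_hamiltonian hinj, J_mulVec, hasDerivAt_phase_iff]
  simp only [mom_phasePoint, pos_phasePoint, neg_neg]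
  refine ⟨hasDerivAt_pi.2 fun i => ?_, hasDerivAt_pi.2 fun i => ?_⟩
  · refine (((hv t).mul_const (a i)).const_mul (m i : ℂ)).congr_deriv ?_
    rw [force_mul, ha.force_eq, kernel]
    ring
  · rw [mul_div_cancel_left₀ _ (hm' i)]
    exact (hc t).mul_const (a i)

lemma IsTrueAnomaly.ere_eq {n : ℕ} {μ p e : ℝ} {θ : ℝ → ℝ} (he₀ : 0 ≤ e) (he₁ : e < 1)
    (hp : 0 < p) (hθ : IsTrueAnomaly μ p e θ) (m : Fin n → ℝ) (a : Fin n → ℂ) :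
    ere m a p e θ = fun t => phasePoint (fun i => m i * (keplerVel μ p e θ t * a i))
      fun i => keplerPos p e θ t * a i := by
  funext t
  have h (i : Fin n) : deriv (fun s => erePos a p e θ s i) t = keplerVel μ p e θ t * a i :=
    ((hθ.hasDerivAt_keplerPos he₀ he₁ hp t).mul_const (a i)).deriv
  simp only [ere, h]
  rfl

/-! ### Reduction of the linearized system -/

lemma hasDerivAt_smul_iff {𝕂 E : Type*} [NormedField 𝕂] [NormedAlgebra ℝ 𝕂]
    [NormedAddCommGroup E] [NormedSpace ℝ E] [NormedSpace 𝕂 E] [IsScalarTower ℝ 𝕂 E]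
    {f : ℝ → 𝕂} {f' : 𝕂} {t : ℝ} (hf : HasDerivAt f f' t) (hf0 : ∀ s, f s ≠ 0) {z : ℝ → E}
    {w : E} :
    HasDerivAt (fun s => f s • z s) (f t • w + f' • z t) t ↔ HasDerivAt z w t := by
  refine ⟨fun h => ?_, fun h => hf.smul h⟩
  have hz : DifferentiableAt ℝ z t := by
    refine ((hf.differentiableAt.fun_inv (hf0 t)).fun_smul h.differentiableAt).congr_of_eventuallyEq
      (Eventually.of_forall fun s => ?_)
    simp only [smul_smul, inv_mul_cancel₀ (hf0 s), one_smul]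
  have hw : f t • deriv z t = f t • w :=
    add_right_cancel ((hf.smul hz.hasDerivAt).unique h)
  exact smul_right_injective E (hf0 t) hw ▸ hz.hasDerivAt

lemma hasDerivAt_add_iff {E : Type*} [NormedAddCommGroup E] [NormedSpace ℝ E] {f g : ℝ → E}
    {f' g' : E} {t : ℝ} (hg : HasDerivAt g g' t) :
    HasDerivAt (fun s => f s + g s) (f' + g') t ↔ HasDerivAt f f' t :=
  ⟨fun h => by simpa using h.fun_sub hg, fun h => h.fun_add hg⟩

section Rotating

variable {n : ℕ}

/-- Rotating and pulsating coordinates: positions are measured in the frame which turns by `θ` and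
is scaled by `r / σ`, momenta in the dual frame, up to the shear by `ρ = r'`. -/
def rotating (σ r ρ θ : ℝ) (x : Phase n) : Phase n :=
  phasePoint (Complex.exp (θ * Complex.I) • ((σ / r) • mom x + (ρ / σ) • pos x))
    (Complex.exp (θ * Complex.I) • ((r / σ) • pos x))

lemma inner_exp_mul_I_mul (s : ℝ) (w z : ℂ) :
    inner ℝ (Complex.exp (s * Complex.I) * w) (Complex.exp (s * Complex.I) * z)
      = inner ℝ w z := by
  have hE : Complex.exp (s * Complex.I) * conj (Complex.exp (s * Complex.I)) = 1 := by
    rw [Complex.mul_conj', Complex.norm_exp_ofReal_mul_I]; simp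
  rw [Complex.inner, Complex.inner, map_mul, mul_mul_mul_comm, hE, one_mul]

lemma symplecticForm_rotating {σ r : ℝ} (hσ : σ ≠ 0) (hr : r ≠ 0) (ρ θ : ℝ) (x y : Phase n) :
    symplecticForm (rotating σ r ρ θ x) (rotating σ r ρ θ y) = symplecticForm x y := by
  rw [symplecticForm_eq, symplecticForm_eq, ← Finset.sum_sub_distrib, ← Finset.sum_sub_distrib]
  refine Finset.sum_congr rfl fun j _ => ?_
  simp only [rotating, mom_phasePoint, pos_phasePoint, Pi.smul_apply, Pi.add_apply, smul_eq_mul,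
    inner_exp_mul_I_mul, inner_add_left, inner_add_right, real_inner_smul_left,
    real_inner_smul_right]
  field_simp
  ring

lemma surjective_rotating {σ r : ℝ} (hσ : σ ≠ 0) (hr : r ≠ 0) (ρ θ : ℝ) :
    Function.Surjective (rotating (n := n) σ r ρ θ) := by
  intro y
  have hE := Complex.exp_ne_zero (θ * Complex.I)
  have hr' : (r : ℂ) ≠ 0 := by exact_mod_cast hr
  have hσ' : (σ : ℂ) ≠ 0 := by exact_mod_cast hσ
  set z : Fin n → ℂ := (σ / r) • (Complex.exp (θ * Complex.I))⁻¹ • pos y with hz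
  refine ⟨phasePoint ((r / σ) • ((Complex.exp (θ * Complex.I))⁻¹ • mom y - (ρ / σ) • z)) z, ?_⟩
  rw [← phasePoint_mom_pos y, rotating]
  simp only [mom_phasePoint, pos_phasePoint]
  congr 1 <;> funext j
  · simp only [Pi.smul_apply, Pi.add_apply, Pi.sub_apply, smul_eq_mul, Complex.real_smul]
    push_cast
    field_simp
    ring
  · simp only [hz, Pi.smul_apply, smul_eq_mul, Complex.real_smul]
    push_cast
    field_simp

lemma hasDerivAt_rotating_pos_iff {r θ : ℝ → ℝ} {σ ρ t : ℝ} (hσ : σ ≠ 0) (hr0 : ∀ s, r s ≠ 0)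
    (hr : HasDerivAt r ρ t) (hθ : HasDerivAt θ (σ ^ 2 / r t ^ 2) t) {z : ℝ → Fin n → ℂ}
    {Z : Fin n → ℂ} :
    HasDerivAt (fun s => Complex.exp (θ s * Complex.I) • (r s / σ) • z s)
      (Complex.exp (θ t * Complex.I) • ((σ / r t) • Z + (ρ / σ) • z t)) t
    ↔ HasDerivAt z ((σ ^ 2 / r t ^ 2) • (Z - Complex.I • z t)) t := by
  have hrt' : (r t : ℂ) ≠ 0 := by exact_mod_cast hr0 t
  have hσ' : (σ : ℂ) ≠ 0 := by exact_mod_cast hσ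
  have hrσ : HasDerivAt (fun s => r s / σ) (ρ / σ) t := hr.div_const σ
  rw [← hasDerivAt_smul_iff hrσ (fun s => div_ne_zero (hr0 s) hσ) (z := z),
    ← hasDerivAt_smul_iff (hasDerivAt_exp_mul_I hθ) (fun s => Complex.exp_ne_zero _)
      (z := fun s => (r s / σ) • z s)]
  refine iff_of_eq (congrArg (HasDerivAt _ · t) ?_)
  funext j
  simp only [Pi.smul_apply, Pi.add_apply, Pi.sub_apply, Complex.real_smul, smul_eq_mul]
  push_cast
  field_simp
  ring

lemma hasDerivAt_rotating_iff {r ρ θ : ℝ → ℝ} {σ ρ' t : ℝ} (hσ : σ ≠ 0) (hr0 : ∀ s, r s ≠ 0)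
    (hr : HasDerivAt r (ρ t) t) (hρ : HasDerivAt ρ ρ' t)
    (hθ : HasDerivAt θ (σ ^ 2 / r t ^ 2) t) (x : ℝ → Phase n) (A : Fin n → ℂ) :
    HasDerivAt (fun s => rotating σ (r s) (ρ s) (θ s) (x s))
      (phasePoint (Complex.exp (θ t * Complex.I) • A) (Complex.exp (θ t * Complex.I) •
        ((σ / r t) • mom (x t) + (ρ t / σ) • pos (x t)))) t
    ↔ HasDerivAt x (phasePoint
        ((σ ^ 2 / r t ^ 2) • -(Complex.I • mom (x t)) + (r t / σ) • (A - (ρ' / σ) • pos (x t)))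
        ((σ ^ 2 / r t ^ 2) • (mom (x t) - Complex.I • pos (x t)))) t := by
  have hrt := hr0 t
  have hrt' : (r t : ℂ) ≠ 0 := by exact_mod_cast hrt
  have hσ' : (σ : ℂ) ≠ 0 := by exact_mod_cast hσ
  have hE := hasDerivAt_exp_mul_I hθ
  have hE0 (s : ℝ) := Complex.exp_ne_zero (θ s * Complex.I)
  have hσr : HasDerivAt (fun s => σ / r s) (-(σ * ρ t / r t ^ 2)) t :=
    ((hasDerivAt_const t σ).fun_div hr hrt).congr_deriv (by ring)
  have hρσ : HasDerivAt (fun s => ρ s / σ) (ρ' / σ) t := hρ.div_const σ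
  rw [hasDerivAt_phase_iff, hasDerivAt_phase_iff]
  simp only [rotating, mom_phasePoint, pos_phasePoint]
  rw [hasDerivAt_rotating_pos_iff hσ hr0 hr hθ]
  refine and_congr_left fun hz => ?_
  rw [← hasDerivAt_smul_iff hσr (fun s => div_ne_zero hσ (hr0 s)) (z := fun s => mom (x s)),
    ← hasDerivAt_add_iff (hρσ.fun_smul hz) (f := fun s => (σ / r s) • mom (x s)),
    ← hasDerivAt_smul_iff hE hE0 (z := fun s => (σ / r s) • mom (x s) + (ρ s / σ) • pos (x s))]
  refine iff_of_eq (congrArg (HasDerivAt _ · t) ?_)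
  funext j
  simp only [Pi.smul_apply, Pi.add_apply, Pi.sub_apply, Pi.neg_apply, Complex.real_smul,
    smul_eq_mul]
  push_cast
  field_simp
  ring

end Rotating

section FrameMap

variable {k : ℕ} {m : Fin (k + 2) → ℝ} {a : Fin (k + 2) → ℂ}
  {V : Matrix (Fin (k + 2)) (Fin (k + 1)) ℂ}

/-- The symplectic embedding of the reduced phase space given by a frame: `q = V X`,
`p = diag(m) V Y`. -/
def frameMap (m : Fin (k + 2) → ℝ) (V : Matrix (Fin (k + 2)) (Fin (k + 1)) ℂ)
    (x : Phase (k + 1)) : Phase (k + 2) :=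
  phasePoint (fun i => m i * V.mulVec (mom x) i) (V.mulVec (pos x))

lemma changeOfCoords_eq {p e ρ t : ℝ} {θ : ℝ → ℝ}
    (h : HasDerivAt (fun s => radius p e (θ s)) ρ t) (x : Phase (k + 1)) :
    changeOfCoords m a V p e θ t x = frameMap m V
      (rotating ((potential m a * p) ^ (1 / 4 : ℝ)) (radius p e (θ t)) ρ (θ t) x) := by
  rw [changeOfCoords, frameMap, rotating, mom_phasePoint, pos_phasePoint]
  congr 1
  simp only [h.deriv, Matrix.mulVec, dotProduct, Pi.smul_apply, Pi.add_apply, smul_eq_mul,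
    Complex.real_smul]

lemma IsFrame.symplecticForm_frameMap (hV : IsFrame m a V) (x y : Phase (k + 1)) :
    symplecticForm (frameMap m V x) (frameMap m V y) = symplecticForm x y := by
  have h (u v : Fin (k + 1) → ℂ) :
      ∑ i, inner ℝ (V.mulVec u i) (m i * V.mulVec v i) = ∑ j, inner ℝ (u j) (v j) := by
    have := congrArg Complex.re (hV.massInner_mulVec_mulVec u v)
    simpa only [massInner_apply, Complex.re_sum, Complex.inner, mul_assoc, mul_left_comm,
      mul_comm (V.mulVec v _), mul_comm (v _)] using this
  have h' (u v : Fin (k + 1) → ℂ) :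
      ∑ i, inner ℝ (m i * V.mulVec u i) (V.mulVec v i) = ∑ j, inner ℝ (u j) (v j) := by
    simpa only [real_inner_comm] using h v u
  simp only [symplecticForm_eq, frameMap, mom_phasePoint, pos_phasePoint, h, h']

lemma IsFrame.range_frameMap (hV : IsFrame m a V) (hm : ∀ i, 0 < m i) :
    Set.range (frameMap m V) = centredPhase m := by
  have hm' (i : Fin (k + 2)) : (m i : ℂ) ≠ 0 := by exact_mod_cast (hm i).ne'
  have hcentred (y : Fin (k + 1) → ℂ) : ∑ i, m i * V.mulVec y i = 0 :=
    (massInner_one_left m _).symm.trans (hV.massInner_one_mulVec y)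
  refine Set.Subset.antisymm ?_ fun x ⟨hmom, hpos⟩ => ?_
  · rintro _ ⟨x, rfl⟩
    simp only [centredPhase, frameMap, Set.mem_ofPred_eq, mom_phasePoint, pos_phasePoint]
    exact ⟨hcentred _, hcentred _⟩
  · obtain ⟨X, hX⟩ : ∃ X, pos x = V.mulVec X :=
      ⟨_, hV.eq_mulVec hm ((massInner_one_left m _).trans hpos)⟩
    obtain ⟨Y, hY⟩ : ∃ Y, (fun i => mom x i / m i) = V.mulVec Y :=
      ⟨_, hV.eq_mulVec hm <| by
        simpa only [massInner_one_left, mul_div_cancel₀ _ (hm' _)] using hmom⟩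
    refine ⟨phasePoint Y X, ?_⟩
    rw [frameMap, mom_phasePoint, pos_phasePoint, ← hX, ← hY]
    simp only [mul_div_cancel₀ _ (hm' _)]
    exact phasePoint_mom_pos x

lemma IsFrame.hasDerivAt_mulVec_iff (hV : IsFrame m a V) {y : ℝ → Fin (k + 1) → ℂ}
    {y' : Fin (k + 1) → ℂ} {t : ℝ} :
    HasDerivAt (fun s => V.mulVec (y s)) (V.mulVec y') t ↔ HasDerivAt y y' t := by
  refine ⟨fun h => hasDerivAt_pi.2 fun j => ?_, fun h => ?_⟩
  · simpa only [Function.comp_def, ContinuousLinearMap.coe_restrictScalars',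
      LinearMap.coe_toContinuousLinearMap', hV.massInner_col_mulVec] using
      ((massInner m (V.col j)).toContinuousLinearMap.restrictScalars ℝ).hasFDerivAt.comp_hasDerivAt
        t h
  · exact (V.mulVecLin.toContinuousLinearMap.restrictScalars ℝ).hasFDerivAt.comp_hasDerivAt t h

lemma IsFrame.hasDerivAt_frameMap_iff (hV : IsFrame m a V) (hm : ∀ i, 0 < m i)
    {y : ℝ → Phase (k + 1)} {y' : Phase (k + 1)} {t : ℝ} :
    HasDerivAt (fun s => frameMap m V (y s)) (frameMap m V y') t ↔ HasDerivAt y y' t := by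
  have hmass (u : ℝ → Fin (k + 2) → ℂ) (u' : Fin (k + 2) → ℂ) :
      HasDerivAt (fun s i => (m i : ℂ) * u s i) (fun i => m i * u' i) t ↔ HasDerivAt u u' t := by
    rw [hasDerivAt_pi, hasDerivAt_pi]
    refine forall_congr' fun i => ?_
    simpa using hasDerivAt_smul_iff (hasDerivAt_const t (m i)) (fun _ => (hm i).ne')
      (z := fun s => u s i) (w := u' i)
  rw [hasDerivAt_phase_iff, hasDerivAt_phase_iff]
  simp only [frameMap, mom_phasePoint, pos_phasePoint, hmass, hV.hasDerivAt_mulVec_iff]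

lemma IsFrame.J_mul_hessian_mulVec_frameMap (hV : IsFrame m a V) (hm : ∀ i, 0 < m i)
    (ha : Function.Injective a) {σ r : ℝ} (hr : 0 < r) (ρ θ : ℝ) {y : Phase (k + 2)}
    (hy : pos y = fun i => r * Complex.exp (θ * Complex.I) * a i) (x : Phase (k + 1)) :
    (Matrix.J (Coord (k + 2)) ℝ * hessian (hamiltonian m) y).mulVec
        (frameMap m V (rotating σ r ρ θ x))
      = frameMap m V (phasePoint
          (Complex.exp (θ * Complex.I) • (r ^ 2 * σ)⁻¹ •
            ((hessLin m a V).mulVec (pos x) + (hessConj m a V).mulVec (star (pos x))))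
          (Complex.exp (θ * Complex.I) • ((σ / r) • mom x + (ρ / σ) • pos x))) := by
  have hm' (i : Fin (k + 2)) : (m i : ℂ) ≠ 0 := by exact_mod_cast (hm i).ne'
  have hr' : (r : ℂ) ≠ 0 := by exact_mod_cast hr.ne'
  have hinj : Function.Injective (pos y) :=
    hy ▸ injective_const_mul ha (mul_ne_zero hr' (Complex.exp_ne_zero _))
  have hscale : V.mulVec (pos (rotating σ r ρ θ x))
      = fun i => r * Complex.exp (θ * Complex.I) * V.mulVec (σ⁻¹ • pos x) i := by
    funext i
    simp only [rotating, pos_phasePoint, Matrix.mulVec_smul, Pi.smul_apply, smul_eq_mul,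
      Complex.real_smul]
    push_cast
    ring
  have hstar : star (σ⁻¹ • pos x) = σ⁻¹ • star (pos x) := by simp
  rw [← Matrix.mulVec_mulVec, hessian_hamiltonian_mulVec hinj, J_mulVec, frameMap, frameMap]
  simp only [mom_phasePoint, pos_phasePoint, neg_neg, mul_div_cancel_left₀ _ (hm' _)]
  congr 1
  funext i
  rw [hy, hscale, forceDeriv_mul, hV.forceDeriv_mulVec hm, norm_ofReal_mul_exp hr.le, hstar]
  simp only [Matrix.mulVec_smul, ← smul_add, Pi.smul_apply, smul_eq_mul, Complex.real_smul]
  push_cast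
  field_simp

lemma IsNormalizedCentral.solvesHamilton (ha : IsNormalizedCentral m a) (hm : ∀ i, 0 < m i)
    {e p : ℝ} {θ : ℝ → ℝ} (he₀ : 0 ≤ e) (he₁ : e < 1) (hp : 0 < p)
    (hθ : IsTrueAnomaly (potential m a) p e θ) :
    SolvesHamilton (hamiltonian m) (ere m a p e θ) := by
  rw [hθ.ere_eq he₀ he₁ hp]
  exact ha.solvesHamilton_of_kepler hm (keplerPos_ne_zero he₀ he₁ hp)
    (hθ.hasDerivAt_keplerPos he₀ he₁ hp)
    (hθ.hasDerivAt_keplerVel he₀ he₁ (potential_pos hm ha.injective Fin.zero_lt_one).le hp)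

lemma J_mul_reducedMatrix_mulVec_eq {n : ℕ} {P Q : Matrix (Fin n) (Fin n) ℂ} {μ σ r e s : ℝ}
    (hμ : μ ≠ 0) (hσ : σ ≠ 0) (hr : r ≠ 0) (hD : 1 + e * Real.cos s ≠ 0)
    (hσμ : σ ^ 4 = μ * (r * (1 + e * Real.cos s))) (x : Phase n) :
    (σ ^ 2 / r ^ 2) • (Matrix.J (Coord n) ℝ *
        reducedMatrix ((μ : ℂ)⁻¹ • P) ((μ : ℂ)⁻¹ • Q) e s).mulVec x
      = phasePoint
        ((σ ^ 2 / r ^ 2) • -(Complex.I • mom x)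
          + (r / σ) • ((r ^ 2 * σ)⁻¹ • (P.mulVec (pos x) + Q.mulVec (star (pos x)))
            - (μ * (e * Real.cos s) / r ^ 2 / σ) • pos x))
        ((σ ^ 2 / r ^ 2) • (mom x - Complex.I • pos x)) := by
  have hsmul (c : ℝ) (u v : Fin n → ℂ) : c • phasePoint u v = phasePoint (c • u) (c • v) :=
    ((phaseEquiv n).symm.map_smul c (u, v)).symm
  rw [← Matrix.mulVec_mulVec, reducedMatrix_mulVec, J_mulVec, hsmul]
  simp only [mom_phasePoint, pos_phasePoint, Matrix.smul_mulVec]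
  congr 1
  funext j
  have hμ' : (μ : ℂ) ≠ 0 := by exact_mod_cast hμ
  have hσ' : (σ : ℂ) ≠ 0 := by exact_mod_cast hσ
  have hr' : (r : ℂ) ≠ 0 := by exact_mod_cast hr
  have hD' : (1 + e * Complex.cos s : ℂ) ≠ 0 := by exact_mod_cast Complex.ofReal_ne_zero.2 hD
  have hσμ' : (σ : ℂ) ^ 4 = μ * (r * (1 + e * Complex.cos s)) := by
    exact_mod_cast congrArg Complex.ofReal hσμ
  simp only [Pi.smul_apply, Pi.add_apply, Pi.sub_apply, Pi.neg_apply, Complex.real_smul,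
    smul_eq_mul]
  push_cast
  field_simp
  rw [hσμ']
  ring

theorem IsNormalizedCentral.linearizationReducesTo (ha : IsNormalizedCentral m a)
    (hm : ∀ i, 0 < m i) (hV : IsFrame m a V) {e : ℝ} (he₀ : 0 ≤ e) (he₁ : e < 1) :
    LinearizationReducesTo m a e V
      (reducedMatrix (((potential m a : ℝ) : ℂ)⁻¹ • hessLin m a V)
        (((potential m a : ℝ) : ℂ)⁻¹ • hessConj m a V) e) := by
  refine ⟨isSymm_reducedMatrix ?_ ((isSymm_hessConj m a V).smul _) e, fun p θ hp hθ => ?_⟩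
  · rw [← Complex.ofReal_inv]
    exact (isHermitian_hessLin m a V).smul (Complex.conj_ofReal _)
  have hμ : 0 < potential m a := potential_pos hm ha.injective Fin.zero_lt_one
  have hr (t : ℝ) : 0 < radius p e (θ t) := radius_pos he₀ he₁ hp _
  have hrd := hθ.hasDerivAt_radius he₀ he₁ hp
  have hcoords (t : ℝ) (x : Phase (k + 1)) := changeOfCoords_eq (m := m) (a := a) (V := V) (hrd t) x
  have hσ : 0 < (potential m a * p) ^ (1 / 4 : ℝ) := Real.rpow_pos_of_pos (mul_pos hμ hp) _
  have hσ2 : ((potential m a * p) ^ (1 / 4 : ℝ)) ^ 2 = Real.sqrt (potential m a * p) := by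
    rw [← Real.rpow_natCast, ← Real.rpow_mul (mul_pos hμ hp).le, Real.sqrt_eq_rpow]
    norm_num
  generalize (potential m a * p) ^ (1 / 4 : ℝ) = σ at *
  have hσ4 (s : ℝ) : σ ^ 4 = potential m a * (radius p e s * (1 + e * Real.cos s)) := by
    rw [radius_mul_one_add_mul_cos he₀ he₁, show σ ^ 4 = (σ ^ 2) ^ 2 by ring, hσ2,
      Real.sq_sqrt (mul_pos hμ hp).le]
  refine ⟨ha.solvesHamilton hm he₀ he₁ hp hθ, fun t x y => ?_, fun t => ?_, fun ξ => ?_⟩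
  · rw [hcoords, hcoords, hV.symplecticForm_frameMap, symplecticForm_rotating hσ.ne' (hr t).ne']
  · rw [funext (hcoords t), ← hV.range_frameMap hm]
    exact (surjective_rotating hσ.ne' (hr t).ne' _ _).range_comp (frameMap m V)
  obtain ⟨c, hc, hc'⟩ := exists_pos_le_sqrt_div_radius_sq he₀ he₁ hμ hp
  refine Iff.trans (forall_congr' fun t => ?_)
    (hasDerivAt_comp_iff_of_le_deriv hθ hc (fun t => hc' (θ t)) ξ _)
  have hpos : pos (ere m a p e θ t)
      = fun i => radius p e (θ t) * Complex.exp (θ t * Complex.I) * a i := pos_phasePoint _ _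
  have hreduced := J_mul_reducedMatrix_mulVec_eq (P := hessLin m a V) (Q := hessConj m a V)
    hμ.ne' hσ.ne' (hr t).ne' (one_add_mul_cos_pos he₀ he₁ _).ne' (hσ4 (θ t)) (ξ (θ t))
  rw [hσ2] at hreduced
  simp only [hcoords]
  rw [hV.J_mul_hessian_mulVec_frameMap hm ha.injective (hr t) _ _ hpos,
    hV.hasDerivAt_frameMap_iff hm, hreduced]
  simpa only [hσ2] using hasDerivAt_rotating_iff hσ.ne' (fun s => (hr s).ne') (hrd t)
    (hθ.hasDerivAt_deriv_radius hμ.le hp t) (hσ2 ▸ hθ t) (fun t => ξ (θ t)) _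

end FrameMap

/-! ### Central configurations and their normalization -/

section Normalization

variable {n : ℕ} (m : Fin n → ℝ) (q : Fin n → ℂ)

/-- The norm of the centred configuration for the mass inner product: the scaling factor used in
`normalized`. -/
def size : ℝ := Real.sqrt (∑ j, m j * ‖q j - centre m q‖ ^ 2)

lemma normalized_eq : normalized m q = fun i => ((size m q : ℝ) : ℂ)⁻¹ * (q i - centre m q) := by
  funext i
  rw [normalized, div_eq_inv_mul, size]

lemma normalized_sub (i j : Fin n) :
    normalized m q i - normalized m q j = (q i - q j) / (size m q : ℂ) := by
  simp only [normalized_eq]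
  ring

lemma norm_normalized_sub (i j : Fin n) :
    ‖normalized m q i - normalized m q j‖ = ‖q i - q j‖ / size m q := by
  rw [normalized_sub, norm_div, Complex.norm_of_nonneg (r := size m q) (Real.sqrt_nonneg _)]

lemma force_sub_const (c : ℂ) (i : Fin n) : force m (fun i => q i - c) i = force m q i := by
  simp only [force, sub_sub_sub_cancel_right]

lemma sum_erase_eq_force (i : Fin n) :
    ∑ j ∈ Finset.univ.erase i, (m i * m j : ℂ) * (q j - q i) / ((‖q i - q j‖ ^ 3 : ℝ) : ℂ)
      = force m q i := by
  rw [force, ← Finset.add_sum_erase _ _ (Finset.mem_univ i)]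
  simp only [kernel, sub_self, zero_div, mul_zero, zero_add]
  refine Finset.sum_congr rfl fun j _ => ?_
  rw [norm_sub_rev, mul_div_assoc]

variable {m}

lemma sum_mul_sub_centre (hM : ∑ i, m i ≠ 0) : ∑ i, (m i : ℂ) * (q i - centre m q) = 0 := by
  have hM' : ((∑ i, m i : ℝ) : ℂ) ≠ 0 := by exact_mod_cast hM
  simp only [mul_sub, Finset.sum_sub_distrib, ← Finset.sum_mul]
  rw [centre, ← Complex.ofReal_sum, mul_div_cancel₀ _ hM', sub_self]

variable {q}

lemma size_pos [Nontrivial (Fin n)] (hm : ∀ i, 0 < m i) (hq : Function.Injective q) :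
    0 < size m q := by
  obtain ⟨i, j, hij⟩ := exists_pair_ne (Fin n)
  obtain ⟨l, hl⟩ : ∃ l, q l - centre m q ≠ 0 := by
    by_contra! h
    exact hij (hq ((sub_eq_zero.1 (h i)).trans (sub_eq_zero.1 (h j)).symm))
  refine Real.sqrt_pos.2 (Finset.sum_pos' (fun i _ => ?_) ⟨l, Finset.mem_univ l, ?_⟩)
  · exact mul_nonneg (hm i).le (sq_nonneg _)
  · exact mul_pos (hm l) (pow_pos (norm_pos_iff.2 hl) 2)

lemma sum_mul_norm_normalized_sq (hs : 0 < size m q) :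
    ∑ i, m i * ‖normalized m q i‖ ^ 2 = 1 := by
  have hsq : size m q ^ 2 = ∑ j, m j * ‖q j - centre m q‖ ^ 2 :=
    Real.sq_sqrt (Real.sqrt_pos.1 hs).le
  have hterm : ∀ i, m i * ‖normalized m q i‖ ^ 2
      = (m i * ‖q i - centre m q‖ ^ 2) / size m q ^ 2 := fun i => by
    rw [normalized_eq, norm_mul, norm_inv, Complex.norm_of_nonneg hs.le]
    ring
  simp only [hterm]
  rw [← Finset.sum_div, ← hsq, div_self (pow_pos hs 2).ne']

lemma force_normalized (hs : 0 < size m q) {lam : ℝ}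
    (hlam : ∀ i, force m q i = -lam * m i * (q i - centre m q)) (i : Fin n) :
    force m (normalized m q) i = -((lam * size m q ^ 3 : ℝ) : ℂ) * m i * normalized m q i := by
  have hs' : (size m q : ℂ) ≠ 0 := by exact_mod_cast hs.ne'
  rw [normalized_eq, force_mul, force_sub_const, hlam i, norm_inv, Complex.norm_of_nonneg hs.le]
  push_cast
  field_simp

/-- The multiplier is determined by Euler's identity for the homogeneous function `U`. -/
lemma IsNormalizedCentral.of_force_eq (hinj : Function.Injective q)
    (hcentred : ∑ i, (m i : ℂ) * q i = 0) (hinertia : ∑ i, m i * ‖q i‖ ^ 2 = 1) {c : ℂ}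
    (hforce : ∀ i, force m q i = -c * m i * q i) : IsNormalizedCentral m q := by
  have hc : c = potential m q := by
    have hterm : ∀ i, conj (q i) * force m q i = -c * ((m i * ‖q i‖ ^ 2 : ℝ) : ℂ) := fun i => by
      rw [hforce i]
      push_cast
      rw [← Complex.mul_conj']
      ring
    have h := sum_conj_mul_force m q
    simp only [hterm, ← Finset.mul_sum] at h
    rwa [← Complex.ofReal_sum, hinertia, Complex.ofReal_one, mul_one, neg_inj] at h
  exact ⟨hinj, hcentred, hinertia, fun i => by rw [hforce i, hc]⟩

theorem IsCentralConfiguration.isNormalizedCentral [Nontrivial (Fin n)] (hm : ∀ i, 0 < m i)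
    (hq : IsCentralConfiguration m q) : IsNormalizedCentral m (normalized m q) := by
  obtain ⟨hinj, lam, hlam⟩ := hq
  simp only [sum_erase_eq_force] at hlam
  have hs := size_pos hm hinj
  have hs' : ((size m q : ℝ) : ℂ)⁻¹ ≠ 0 := inv_ne_zero (by exact_mod_cast hs.ne')
  refine .of_force_eq (fun i j h => hinj ?_) ?_ (sum_mul_norm_normalized_sq hs)
    (force_normalized hs hlam)
  · simp only [normalized_eq] at h
    exact sub_left_injective (mul_left_cancel₀ hs' h)
  · have hM : ∑ i, m i ≠ 0 := (Finset.sum_pos (fun i _ => hm i) Finset.univ_nonempty).ne'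
    simp only [normalized_eq, mul_left_comm _ ((size m q : ℝ) : ℂ)⁻¹, ← Finset.mul_sum,
      sum_mul_sub_centre q hM, mul_zero]

lemma IsNormalizedCentral.massInner_self (ha : IsNormalizedCentral m q) :
    massInner m q q = 1 := by
  rw [FourBody.massInner_self, ha.inertia, Complex.ofReal_one]

lemma IsNormalizedCentral.massInner_one (ha : IsNormalizedCentral m q) :
    massInner m 1 q = 0 := by
  rw [massInner_one_left, ha.centred]

end Normalization

/-! ### Diagonal blocks in a frame -/

section Diagonal

variable {k : ℕ} {m : Fin (k + 2) → ℝ} {a : Fin (k + 2) → ℂ}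
  {V : Matrix (Fin (k + 2)) (Fin (k + 1)) ℂ}

/-- The first column spans the homothetic direction, in which the Hessian of `U` is known from the
equation of a central configuration. -/
lemma IsFrame.hessLin_zero (hV : IsFrame m a V) (ha : IsNormalizedCentral m a) (j : Fin (k + 1)) :
    hessLin m a V j 0 = if j = 0 then (potential m a : ℂ) / 2 else 0 := by
  have hleft : ∑ i, conj (V i j) * force m a i
      = -(potential m a : ℂ) * (if j = 0 then 1 else 0) := by
    rw [← hV.orthonormal j 0, Finset.mul_sum]
    refine Finset.sum_congr rfl fun i _ => ?_
    rw [ha.force_eq, hV.first]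
    ring
  have hright : ∑ i, ∑ i', (m i * m i' : ℂ) *
        ((conj (V i' j) - conj (V i j)) * kernel (a i' - a i))
      = 4 * hessLin m a V j 0 := by
    rw [hessLin, Matrix.of_apply, ← mul_assoc, show (4 * (1 / 4) : ℂ) = 1 by norm_num, one_mul]
    refine Finset.sum_congr rfl fun i _ => Finset.sum_congr rfl fun i' _ => ?_
    rw [hV.first, hV.first, map_sub, kernel]
    ring
  have h := sum_mul_force m (fun i => conj (V i j)) a
  rw [hleft, hright] at h
  split_ifs at h ⊢ <;> linear_combination (1 / 2) * h

lemma IsFrame.hessConj_zero (hV : IsFrame m a V) (j : Fin (k + 1)) :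
    hessConj m a V j 0 = 3 * hessLin m a V j 0 := by
  have key : ∀ w : ℂ, w ^ 2 / ((‖w‖ ^ 5 : ℝ) : ℂ) * conj w = w / ((‖w‖ ^ 3 : ℝ) : ℂ) := by
    intro w
    by_cases hw : w = 0
    · simp [hw]
    have hn : (‖w‖ : ℂ) ≠ 0 := by simpa using hw
    push_cast
    field_simp
    linear_combination Complex.mul_conj' w
  simp only [hessConj, hessLin, Matrix.of_apply]
  rw [← mul_assoc, show (3 * (1 / 4) : ℂ) = 3 / 4 by norm_num]
  congr 1
  refine Finset.sum_congr rfl fun i _ => Finset.sum_congr rfl fun i' _ => ?_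
  rw [hV.first, hV.first]
  linear_combination (m i * m i' : ℂ) * conj (V i' j - V i j) * key (a i' - a i)

theorem IsNormalizedCentral.linearizationReducesTo_directSum (ha : IsNormalizedCentral m a)
    (hm : ∀ i, 0 < m i) (hV : IsFrame m a V) {e : ℝ} (he₀ : 0 ≤ e) (he₁ : e < 1)
    {f g : Fin (k + 1) → ℝ}
    (hf : hessLin m a V = (potential m a : ℂ) • Matrix.diagonal fun j => (f j : ℂ))
    (hg : hessConj m a V = (potential m a : ℂ) • Matrix.diagonal fun j => (g j : ℂ)) :
    LinearizationReducesTo m a e V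
      fun s => directSum fun j => part (1 + f j + g j) (1 + f j - g j) e s := by
  have hU : (potential m a : ℂ) ≠ 0 := by
    exact_mod_cast (potential_pos hm ha.injective (i := 0) (j := 1) (by simp)).ne'
  have h := ha.linearizationReducesTo hm hV he₀ he₁
  rw [hf, hg, inv_smul_smul₀ hU, inv_smul_smul₀ hU] at h
  rwa [show reducedMatrix _ _ e = _ from funext (reducedMatrix_diagonal f g e)] at h

lemma part_eq_keplerPart {e : ℝ} (he₀ : 0 ≤ e) (he₁ : e < 1) (s : ℝ) :
    part (1 + 1 / 2 + 3 / 2) (1 + 1 / 2 - 3 / 2) e s = keplerPart e s := by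
  rw [← part_three_zero (one_add_mul_cos_pos he₀ he₁ s).ne']
  norm_num

lemma part_eq_lagrangePart (b e s : ℝ) :
    part (1 + 1 / 2 + Real.sqrt (9 - b) / 2) (1 + 1 / 2 - Real.sqrt (9 - b) / 2) e s
      = lagrangePart b e s := by
  rw [lagrangePart]
  congr 1 <;> ring

end Diagonal

/-! ### Phases of the columns -/

section Phases

variable {n k : ℕ} (m : Fin n → ℝ) (a : Fin n → ℂ) (V : Matrix (Fin n) (Fin k) ℂ)
  (u : Fin k → ℂ)

lemma hessLin_mul_diagonal (j l : Fin k) :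
    hessLin m a (V * Matrix.diagonal u) j l = conj (u j) * hessLin m a V j l * u l := by
  simp only [hessLin, Matrix.of_apply, Matrix.mul_diagonal, Finset.mul_sum, Finset.sum_mul,
    ← sub_mul, map_mul]
  refine Finset.sum_congr rfl fun i _ => Finset.sum_congr rfl fun i' _ => by ring

lemma hessConj_mul_diagonal (j l : Fin k) :
    hessConj m a (V * Matrix.diagonal u) j l = conj (u j) * hessConj m a V j l * conj (u l) := by
  simp only [hessConj, Matrix.of_apply, Matrix.mul_diagonal, Finset.mul_sum, Finset.sum_mul,
    ← sub_mul, map_mul]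
  refine Finset.sum_congr rfl fun i _ => Finset.sum_congr rfl fun i' _ => by ring

lemma exists_unit_conj_sq_mul (X : ℂ) : ∃ u : ℂ, ‖u‖ = 1 ∧ conj u ^ 2 * X = ‖X‖ := by
  refine ⟨Complex.exp ((Complex.arg X / 2 : ℝ) * Complex.I),
    Complex.norm_exp_ofReal_mul_I _, ?_⟩
  have h : conj (Complex.exp ((Complex.arg X / 2 : ℝ) * Complex.I)) ^ 2
      = Complex.exp (-(Complex.arg X * Complex.I)) := by
    rw [← Complex.exp_conj, ← Complex.exp_nat_mul]
    congr 1
    simp [map_ofNat]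
    ring
  calc conj (Complex.exp ((Complex.arg X / 2 : ℝ) * Complex.I)) ^ 2 * X
      = Complex.exp (-(Complex.arg X * Complex.I)) *
          (‖X‖ * Complex.exp (Complex.arg X * Complex.I)) := by
        rw [h, Complex.norm_mul_exp_arg_mul_I]
    _ = ‖X‖ := by
        rw [mul_left_comm, ← Complex.exp_add, neg_add_cancel, Complex.exp_zero, mul_one]

lemma exists_phases {d : Fin (k + 1) → ℂ} (hd : d 0 = ‖d 0‖) :
    ∃ u : Fin (k + 1) → ℂ, u 0 = 1 ∧ (∀ j, ‖u j‖ = 1) ∧ ∀ j, conj (u j) ^ 2 * d j = ‖d j‖ := by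
  choose v hv hvd using fun j => exists_unit_conj_sq_mul (d j)
  refine ⟨Function.update v 0 1, Function.update_self .., fun j => ?_, fun j => ?_⟩
  · rcases eq_or_ne j 0 with rfl | hj
    · simp
    · rw [Function.update_of_ne hj, hv]
  · rcases eq_or_ne j 0 with rfl | hj
    · simpa using hd
    · rw [Function.update_of_ne hj, hvd]

variable {u} in
lemma conj_mul_diagonal_mul (hu : ∀ j, ‖u j‖ = 1) (f : Fin k → ℂ) (j l : Fin k) :
    conj (u j) * Matrix.diagonal f j l * u l = Matrix.diagonal f j l := by
  rcases eq_or_ne j l with rfl | hjl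
  · rw [Matrix.diagonal_apply_eq, mul_right_comm, Complex.conj_mul', hu]
    simp
  · rw [Matrix.diagonal_apply_ne _ hjl]
    simp

lemma conj_mul_diagonal_mul_conj {k : ℕ} (u d : Fin k → ℂ) (j l : Fin k) :
    conj (u j) * Matrix.diagonal d j l * conj (u l)
      = Matrix.diagonal (fun j => conj (u j) ^ 2 * d j) j l := by
  rcases eq_or_ne j l with rfl | hjl
  · rw [Matrix.diagonal_apply_eq, Matrix.diagonal_apply_eq]
    ring
  · rw [Matrix.diagonal_apply_ne _ hjl, Matrix.diagonal_apply_ne _ hjl]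
    simp

end Phases

lemma IsFrame.mul_diagonal {k : ℕ} {m : Fin (k + 2) → ℝ} {a : Fin (k + 2) → ℂ}
    {V : Matrix (Fin (k + 2)) (Fin (k + 1)) ℂ} (hV : IsFrame m a V) {u : Fin (k + 1) → ℂ}
    (hu₀ : u 0 = 1) (hu : ∀ j, ‖u j‖ = 1) : IsFrame m a (V * Matrix.diagonal u) := by
  refine ⟨fun i => ?_, fun j => ?_, fun j l => ?_⟩
  · rw [Matrix.mul_diagonal, hu₀, mul_one, hV.first]
  · simp only [Matrix.mul_diagonal, ← mul_assoc, ← Finset.sum_mul, hV.centred, zero_mul]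
  · have h : ∀ i, m i * conj ((V * Matrix.diagonal u) i j) * (V * Matrix.diagonal u) i l
        = conj (u j) * (m i * conj (V i j) * V i l) * u l := fun i => by
      simp only [Matrix.mul_diagonal, map_mul]
      ring
    simp only [h, ← Finset.mul_sum, ← Finset.sum_mul, hV.orthonormal]
    exact conj_mul_diagonal_mul hu (fun _ => 1) j l

/-! ### The two-body problem -/

lemma isCentralConfiguration_two {m : Fin 2 → ℝ} {q : Fin 2 → ℂ} (hm : ∑ i, m i = 1)
    (hq : q 0 ≠ q 1) : IsCentralConfiguration m q := by
  have hm' : (m 0 : ℂ) + m 1 = 1 := by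
    rw [Fin.sum_univ_two] at hm; exact_mod_cast hm
  have hn : (‖q 0 - q 1‖ : ℂ) ≠ 0 := by simpa [sub_eq_zero] using hq
  refine ⟨fun i j h => ?_, (‖q 0 - q 1‖ ^ 3)⁻¹, fun i => ?_⟩
  · fin_cases i <;> fin_cases j <;> simp_all [eq_comm]
  · rw [sum_erase_eq_force, force, Fin.sum_univ_two, centre, Fin.sum_univ_two, hm]
    have hr := norm_sub_rev (q 1) (q 0)
    fin_cases i
    · simp only [kernel, Fin.zero_eta, hr]
      push_cast
      field_simp
      linear_combination -(m 0 : ℂ) * q 0 * hm'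
    · simp only [kernel, Fin.mk_one]
      push_cast
      field_simp
      linear_combination -(m 1 : ℂ) * q 1 * hm'

lemma isFrame_singleton {m : Fin 2 → ℝ} {a : Fin 2 → ℂ} (ha : IsNormalizedCentral m a) :
    IsFrame m a (Matrix.replicateCol (Fin 1) a) := by
  refine isFrame_iff.2 ⟨rfl, fun _ => ha.massInner_one, fun j l => ?_⟩
  rw [if_pos (Subsingleton.elim (α := Fin 1) j l)]
  exact ha.massInner_self

theorem exists_linearizationReducesTo_two {e : ℝ} (he₀ : 0 ≤ e) (he₁ : e < 1) {m : Fin 2 → ℝ}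
    {q : Fin 2 → ℂ} (hm : ∀ i, 0 < m i) (hm1 : ∑ i, m i = 1) (hq : q 0 ≠ q 1) :
    ∃ V : Matrix (Fin 2) (Fin 1) ℂ, IsFrame m (normalized m q) V ∧
      LinearizationReducesTo m (normalized m q) e V (fun s => directSum ![keplerPart e s]) := by
  have ha := (isCentralConfiguration_two hm1 hq).isNormalizedCentral hm
  have hV := isFrame_singleton ha
  refine ⟨_, hV, ?_⟩
  have h := ha.linearizationReducesTo_directSum hm hV he₀ he₁ (f := fun _ => 1 / 2)
    (g := fun _ => 3 / 2) ?_ ?_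
  · convert h using 4 with s j
    rw [part_eq_keplerPart he₀ he₁, Matrix.cons_val_fin_one]
  all_goals
    ext i j
    rw [Fin.fin_one_eq_zero i, Fin.fin_one_eq_zero j, Matrix.smul_apply,
      Matrix.diagonal_apply_eq, smul_eq_mul]
  · rw [hV.hessLin_zero ha, if_pos rfl]
    push_cast
    ring
  · rw [hV.hessConj_zero, hV.hessLin_zero ha, if_pos rfl]
    push_cast
    ring

/-! ### Equilateral configurations -/

lemma sum_sum_mul_sub_mul_sub {n : ℕ} (m : Fin n → ℝ) (u v : Fin n → ℂ) :
    ∑ i, ∑ j, (m i * m j : ℂ) * (conj (u j - u i) * (v j - v i))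
      = 2 * ((∑ i, (m i : ℂ)) * massInner m u v - conj (massInner m 1 u) * massInner m 1 v) := by
  have hterm : ∀ i j, (m i * m j : ℂ) * (conj (u j - u i) * (v j - v i))
      = (m i : ℂ) * (m j * conj (u j) * v j) + (m i * conj (u i) * v i) * m j
        - (m i * conj (u i)) * (m j * v j) - (m i * v i) * (m j * conj (u j)) := by
    intro i j
    rw [map_sub]
    ring
  rw [massInner_one_left, massInner_one_left, massInner_apply]
  simp only [hterm, Finset.sum_sub_distrib, Finset.sum_add_distrib, ← Finset.sum_mul,
    ← Finset.mul_sum, map_sum, map_mul, Complex.conj_ofReal]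
  ring

section Equidistant

variable {k : ℕ} {m : Fin (k + 2) → ℝ} {a : Fin (k + 2) → ℂ} {s : ℝ}
  {V : Matrix (Fin (k + 2)) (Fin (k + 1)) ℂ}

lemma isCentralConfiguration_of_equidistant {n : ℕ} {m : Fin n → ℝ} {q : Fin n → ℂ}
    (hm : ∑ i, m i = 1) (hq : Pairwise fun i j => ‖q i - q j‖ = 1) :
    IsCentralConfiguration m q := by
  refine ⟨fun i j h => ?_, 1, fun i => ?_⟩
  · by_contra hne
    simpa [h] using hq hne
  · have hm' : ∑ i, (m i : ℂ) = 1 := by exact_mod_cast hm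
    have hterm : ∀ j ∈ Finset.univ.erase i, (m i * m j : ℂ) * (q j - q i) /
        ((‖q i - q j‖ ^ 3 : ℝ) : ℂ) = m i * (m j * q j) - m i * q i * m j := by
      intro j hj
      rw [hq (Finset.ne_of_mem_erase hj).symm, one_pow, Complex.ofReal_one, div_one]
      ring
    rw [Finset.sum_congr rfl hterm, Finset.sum_erase _ (by ring), Finset.sum_sub_distrib,
      ← Finset.mul_sum, ← Finset.mul_sum, hm', centre, hm, Complex.ofReal_one]
    ring

lemma IsFrame.hessLin_eq_of_equidistant (hV : IsFrame m a V) (hm : ∑ i, m i = 1)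
    (ha : Pairwise fun i j => ‖a i - a j‖ = s) :
    hessLin m a V = (((s ^ 3)⁻¹ / 2 : ℝ) : ℂ) • 1 := by
  have hm' : ∑ i, (m i : ℂ) = 1 := by exact_mod_cast hm
  obtain ⟨-, hcentred, horth⟩ := isFrame_iff.1 hV
  ext j l
  have hsum := sum_sum_mul_sub_mul_sub m (V.col j) (V.col l)
  rw [hcentred, hcentred, horth, hm', mul_zero, sub_zero, one_mul] at hsum
  rw [Matrix.smul_apply, Matrix.one_apply, smul_eq_mul]
  calc hessLin m a V j l
      = (((s ^ 3)⁻¹ / 4 : ℝ) : ℂ) * ∑ i, ∑ i', (m i * m i' : ℂ) *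
          (conj (V.col j i' - V.col j i) * (V.col l i' - V.col l i)) := by
        simp only [hessLin, Matrix.of_apply, Matrix.col_apply, Finset.mul_sum]
        refine Finset.sum_congr rfl fun i _ => Finset.sum_congr rfl fun i' _ => ?_
        rcases eq_or_ne i' i with rfl | hi
        · simp
        · rw [ha hi]
          push_cast
          ring
    _ = (((s ^ 3)⁻¹ / 2 : ℝ) : ℂ) * if j = l then 1 else 0 := by
        rw [hsum]
        push_cast
        ring

lemma IsFrame.potential_eq_of_equidistant (hV : IsFrame m a V) (hc : IsNormalizedCentral m a)
    (hm : ∑ i, m i = 1) (ha : Pairwise fun i j => ‖a i - a j‖ = s) :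
    potential m a = (s ^ 3)⁻¹ := by
  have h := hV.hessLin_zero hc 0
  rw [hV.hessLin_eq_of_equidistant hm ha, Matrix.smul_apply, Matrix.one_apply_eq, smul_eq_mul,
    mul_one, if_pos rfl] at h
  have h' : (s ^ 3)⁻¹ / 2 = potential m a / 2 := by exact_mod_cast h
  linarith

lemma IsFrame.hessLin_eq_potential_of_equidistant (hV : IsFrame m a V)
    (hc : IsNormalizedCentral m a) (hm : ∑ i, m i = 1)
    (ha : Pairwise fun i j => ‖a i - a j‖ = s) :
    hessLin m a V = (potential m a : ℂ) • Matrix.diagonal fun _ => ((1 / 2 : ℝ) : ℂ) := by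
  rw [hV.hessLin_eq_of_equidistant hm ha, hV.potential_eq_of_equidistant hc hm ha,
    ← Matrix.diagonal_one, ← Matrix.diagonal_smul, ← Matrix.diagonal_smul]
  congr 1
  funext _
  simp only [Pi.smul_apply, smul_eq_mul]
  push_cast
  ring

end Equidistant

/-! ### The Lagrangian triangle -/

/-- The vector `conj(a_{i+1} - a_{i+2}) / m_i`, which spans the orthogonal complement of
`(1, 1, 1)` and `a` for the mass inner product. -/
def sideVec (m : Fin 3 → ℝ) (a : Fin 3 → ℂ) (i : Fin 3) : ℂ := conj (a (i + 1) - a (i + 2)) / m i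

/-- The squared mass norm of `sideVec`. -/
def sideNormSq (m : Fin 3 → ℝ) (a : Fin 3 → ℂ) : ℝ := ∑ i, ‖a (i + 1) - a (i + 2)‖ ^ 2 / m i

/-- The unit vector in the direction of `sideVec`, for the mass norm. -/
def sideCol (m : Fin 3 → ℝ) (a : Fin 3 → ℂ) : Fin 3 → ℂ :=
  (Real.sqrt (sideNormSq m a) : ℂ)⁻¹ • sideVec m a

/-- The frame of a configuration `a` of three bodies, with columns `a` and `sideCol m a`. -/
def triangleFrame (m : Fin 3 → ℝ) (a : Fin 3 → ℂ) : Matrix (Fin 3) (Fin 2) ℂ :=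
  Matrix.of fun i => ![a i, sideCol m a i]

section Triangle

variable {m : Fin 3 → ℝ} {a : Fin 3 → ℂ} {s : ℝ}

lemma sideNormSq_pos (hm : ∀ i, 0 < m i) (ha : a 0 ≠ a 1) : 0 < sideNormSq m a := by
  have h01 : 0 < ‖a 0 - a 1‖ := norm_pos_iff.2 (sub_ne_zero.2 ha)
  refine Finset.sum_pos' (fun i _ => div_nonneg (sq_nonneg _) (hm i).le)
    ⟨2, Finset.mem_univ _, div_pos (pow_pos ?_ 2) (hm 2)⟩
  exact h01

lemma massInner_sideVec (hm : ∀ i, m i ≠ 0) (u : Fin 3 → ℂ) :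
    massInner m u (sideVec m a)
      = conj (u 0 * (a 1 - a 2) + u 1 * (a 2 - a 0) + u 2 * (a 0 - a 1)) := by
  have hterm : ∀ i, (m i : ℂ) * conj (u i) * sideVec m a i
      = conj (u i * (a (i + 1) - a (i + 2))) := by
    intro i
    have : (m i : ℂ) ≠ 0 := by exact_mod_cast hm i
    rw [sideVec, map_mul]
    field_simp
  rw [massInner_apply, Finset.sum_congr rfl fun i _ => hterm i, Fin.sum_univ_three, ← map_add,
    ← map_add]
  rfl

lemma massInner_sideVec_self (hm : ∀ i, 0 < m i) :
    massInner m (sideVec m a) (sideVec m a) = sideNormSq m a := by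
  rw [massInner_self, sideNormSq]
  congr 1
  refine Finset.sum_congr rfl fun i _ => ?_
  have := hm i
  rw [sideVec, norm_div, RCLike.norm_conj, Complex.norm_of_nonneg this.le]
  field_simp

lemma massInner_one_sideCol (hm : ∀ i, m i ≠ 0) : massInner m 1 (sideCol m a) = 0 := by
  rw [sideCol, map_smul, massInner_sideVec hm]
  simp

lemma massInner_sideCol (hm : ∀ i, m i ≠ 0) : massInner m a (sideCol m a) = 0 := by
  rw [sideCol, map_smul, massInner_sideVec hm,
    show a 0 * (a 1 - a 2) + a 1 * (a 2 - a 0) + a 2 * (a 0 - a 1) = 0 by ring, map_zero,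
    smul_zero]

lemma massInner_sideCol_self (hm : ∀ i, 0 < m i) (ha : a 0 ≠ a 1) :
    massInner m (sideCol m a) (sideCol m a) = 1 :=
  massInner_inv_sqrt_smul_self (sideNormSq_pos hm ha) (massInner_sideVec_self hm)

lemma IsNormalizedCentral.isFrame_triangleFrame (ha : IsNormalizedCentral m a)
    (hm : ∀ i, 0 < m i) : IsFrame m a (triangleFrame m a) := by
  have hm' : ∀ i, m i ≠ 0 := fun i => (hm i).ne'
  refine isFrame_of_lt rfl (Fin.forall_fin_two.2 ⟨ha.massInner_one, massInner_one_sideCol hm'⟩)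
    (Fin.forall_fin_two.2 ⟨ha.massInner_self,
      massInner_sideCol_self hm (ha.injective.ne (by decide))⟩) fun i j hij => ?_
  obtain ⟨rfl, rfl⟩ : i = 0 ∧ j = 1 := by decide +revert
  exact massInner_sideCol hm'

/-- With `w` a primitive cube root of unity, the sides of an equilateral triangle are `d`, `w d`
and `w² d`. -/
lemma exists_cube_root (hs : 0 < s) (ha : Pairwise fun i j => ‖a i - a j‖ = s) :
    ∃ w d : ℂ, ‖d‖ = s ∧ w ^ 2 = -1 - w ∧ conj w = -1 - w ∧ a 1 = a 0 + d ∧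
      a 2 = a 0 + d + w * d := by
  have hd : ‖a 1 - a 0‖ = s := ha (by decide)
  have hf : ‖a 2 - a 1‖ = s := ha (by decide)
  have hg : ‖a 2 - a 0‖ = s := ha (by decide)
  have hd0 : a 1 - a 0 ≠ 0 := norm_pos_iff.1 (hd ▸ hs)
  obtain ⟨w, hw⟩ : ∃ w, a 2 - a 1 = w * (a 1 - a 0) := ⟨_, (div_mul_cancel₀ _ hd0).symm⟩
  have hw₁ : ‖w‖ = 1 := by
    rwa [hw, norm_mul, hd, mul_eq_right₀ hs.ne'] at hf
  have hw₂ : ‖1 + w‖ = 1 := by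
    rwa [show a 2 - a 0 = (1 + w) * (a 1 - a 0) by linear_combination hw, norm_mul, hd,
      mul_eq_right₀ hs.ne'] at hg
  have h₁ : conj w * w = 1 := by rw [Complex.conj_mul', hw₁]; simp
  have h₂ : (1 + conj w) * (1 + w) = 1 := by
    rw [← map_one conj, ← map_add, map_one, Complex.conj_mul', hw₂]; simp
  refine ⟨w, a 1 - a 0, hd, ?_, ?_, by ring, by linear_combination hw⟩
  · linear_combination w * h₂ - (1 + w) * h₁
  · linear_combination h₂ - h₁

lemma sideNormSq_triangle (hm : ∀ i, 0 < m i) (ha : Pairwise fun i j => ‖a i - a j‖ = s) :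
    sideNormSq m a = s ^ 2 * (m 0 * m 1 + m 1 * m 2 + m 2 * m 0) / (m 0 * m 1 * m 2) := by
  have h0 := hm 0
  have h1 := hm 1
  have h2 := hm 2
  have hside : ∀ i : Fin 3, ‖a (i + 1) - a (i + 2)‖ = s := fun i => ha (by simp)
  simp only [sideNormSq, hside, Fin.sum_univ_three]
  field_simp
  ring

lemma norm_cube_root_sum {w : ℂ} (hw : w ^ 2 = -1 - w) (hw' : conj w = -1 - w)
    (hm1 : ∑ i, m i = 1) :
    ‖(m 2 + w * m 0 + w ^ 2 * m 1 : ℂ)‖ = Real.sqrt (9 - betaL m) / 3 := by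
  rw [Fin.sum_univ_three] at hm1
  have hm' : (m 0 + m 1 + m 2 : ℂ) = 1 := by exact_mod_cast hm1
  have w3 : w ^ 3 = 1 := by linear_combination (w - 1) * hw
  have w4 : w ^ 4 = w := by linear_combination w * w3
  have hsq : ‖(m 2 + w * m 0 + w ^ 2 * m 1 : ℂ)‖ ^ 2 = (9 - betaL m) / 3 ^ 2 := by
    have hc : ((‖(m 2 + w * m 0 + w ^ 2 * m 1 : ℂ)‖ ^ 2 : ℝ) : ℂ)
        = (((9 - betaL m) / 3 ^ 2 : ℝ) : ℂ) := by
      rw [betaL, hm1]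
      push_cast
      rw [← Complex.conj_mul']
      simp only [map_add, map_mul, map_pow, Complex.conj_ofReal, hw']
      rw [show (m 0 : ℂ) = 1 - m 1 - m 2 by linear_combination hm']
      ring_nf
      simp only [w4, w3, hw]
      ring
    exact_mod_cast hc
  rw [← Real.sqrt_sq (norm_nonneg _), hsq, Real.sqrt_div' _ (by norm_num),
    Real.sqrt_sq (by norm_num)]

lemma sum_triangle_eq (hm : ∀ i, m i ≠ 0) {w d : ℂ} (hw : w ^ 2 = -1 - w) (h1 : a 1 = a 0 + d)
    (h2 : a 2 = a 0 + d + w * d) :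
    ∑ i, ∑ i', (m i * m i' : ℂ) * (a i' - a i) ^ 2 * conj (sideVec m a i' - sideVec m a i) ^ 2
    = 2 * d ^ 4 * (((m 0 * m 1 + m 1 * m 2 + m 2 * m 0) / (m 0 * m 1 * m 2) : ℝ) : ℂ)
      * (m 2 + w * m 0 + w ^ 2 * m 1) := by
  have m0 : (m 0 : ℂ) ≠ 0 := by exact_mod_cast hm 0
  have m1 : (m 1 : ℂ) ≠ 0 := by exact_mod_cast hm 1
  have m2 : (m 2 : ℂ) ≠ 0 := by exact_mod_cast hm 2
  have w3 : w ^ 3 = 1 := by linear_combination (w - 1) * hw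
  have w4 : w ^ 4 = w := by linear_combination w * w3
  have e₀ : a (0 + 1) - a (0 + 2) = -(w * d) := by
    change a 1 - a 2 = _; rw [h1, h2]; ring
  have e₁ : a (1 + 1) - a (1 + 2) = (1 + w) * d := by
    change a 2 - a 0 = _; rw [h2]; ring
  have e₂ : a (2 + 1) - a (2 + 2) = -d := by
    change a 0 - a 1 = _; rw [h1]; ring
  simp only [sideVec, map_sub conj (_ / _), map_div₀, Complex.conj_conj, Complex.conj_ofReal,
    Fin.sum_univ_three, e₀, e₁, e₂]
  rw [h1, h2]
  push_cast
  field_simp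
  ring_nf
  simp only [w4, w3, hw]
  ring

lemma hessConj_triangleFrame_one_one (hN : 0 ≤ sideNormSq m a)
    (ha : Pairwise fun i j => ‖a i - a j‖ = s) :
    hessConj m a (triangleFrame m a) 1 1 = 3 / 4 * ((sideNormSq m a * s ^ 5 : ℝ) : ℂ)⁻¹ *
      ∑ i, ∑ i', (m i * m i' : ℂ) * (a i' - a i) ^ 2 *
        conj (sideVec m a i' - sideVec m a i) ^ 2 := by
  have hsq : (Real.sqrt (sideNormSq m a) : ℂ) ^ 2 = (sideNormSq m a : ℂ) := by
    exact_mod_cast Real.sq_sqrt hN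
  have hcol : ∀ i, triangleFrame m a i 1 = (Real.sqrt (sideNormSq m a) : ℂ)⁻¹ * sideVec m a i :=
    fun i => rfl
  simp only [hessConj, Matrix.of_apply, mul_assoc (3 / 4 : ℂ), Finset.mul_sum]
  refine Finset.sum_congr rfl fun i _ => Finset.sum_congr rfl fun i' _ => ?_
  rcases eq_or_ne i' i with rfl | hi
  · simp
  · rw [hcol, hcol, ← mul_sub, map_mul, map_inv₀, Complex.conj_ofReal, ha hi, Complex.ofReal_mul,
      ← hsq]
    ring

lemma IsNormalizedCentral.norm_hessConj_triangleFrame (hc : IsNormalizedCentral m a)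
    (hm : ∀ i, 0 < m i) (hm1 : ∑ i, m i = 1) (hs : 0 < s)
    (ha : Pairwise fun i j => ‖a i - a j‖ = s) :
    ‖hessConj m a (triangleFrame m a) 1 1‖ = potential m a * (Real.sqrt (9 - betaL m) / 2) := by
  obtain ⟨w, d, hd, hw, hw', h1, h2⟩ := exists_cube_root hs ha
  have hN := sideNormSq_pos hm fun h => absurd (hc.injective h) (by decide)
  have hM : 0 < (m 0 * m 1 + m 1 * m 2 + m 2 * m 0) / (m 0 * m 1 * m 2) := by
    have := hm 0
    have := hm 1
    have := hm 2
    positivity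
  have hM' : sideNormSq m a
      = s ^ 2 * ((m 0 * m 1 + m 1 * m 2 + m 2 * m 0) / (m 0 * m 1 * m 2)) := by
    rw [sideNormSq_triangle hm ha, mul_div_assoc]
  rw [hessConj_triangleFrame_one_one hN.le ha, sum_triangle_eq (fun i => (hm i).ne') hw h1 h2,
    (hc.isFrame_triangleFrame hm).potential_eq_of_equidistant hc hm1 ha, hM']
  generalize (m 0 * m 1 + m 1 * m 2 + m 2 * m 0) / (m 0 * m 1 * m 2) = M at hM
  simp only [norm_mul, norm_inv, norm_pow, norm_cube_root_sum hw hw' hm1, hd, norm_div,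
    Complex.norm_ofNat, Complex.norm_of_nonneg hM.le,
    Complex.norm_of_nonneg (show 0 ≤ s ^ 2 * M * s ^ 5 by positivity)]
  field_simp
  norm_num

/-- The off-diagonal entries vanish because the first column decouples. -/
lemma IsNormalizedCentral.hessConj_triangleFrame (hc : IsNormalizedCentral m a)
    (hm : ∀ i, 0 < m i) :
    hessConj m a (triangleFrame m a)
      = Matrix.diagonal ![(potential m a : ℂ) * (3 / 2 : ℝ),
          hessConj m a (triangleFrame m a) 1 1] := by
  have hV := hc.isFrame_triangleFrame hm
  have hcol : ∀ j, hessConj m a (triangleFrame m a) j 0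
      = if j = 0 then (potential m a : ℂ) * (3 / 2 : ℝ) else 0 := by
    intro j
    rw [hV.hessConj_zero, hV.hessLin_zero hc]
    split_ifs <;> push_cast <;> ring
  ext i j
  fin_cases j
  · fin_cases i <;> simp [hcol]
  · fin_cases i
    · exact ((isSymm_hessConj m a _).apply 1 0).trans (hcol 1)
    · simp

theorem exists_linearizationReducesTo_three {e : ℝ} (he₀ : 0 ≤ e) (he₁ : e < 1) {q : Fin 3 → ℂ}
    (hm : ∀ i, 0 < m i) (hm1 : ∑ i, m i = 1) (hq : Pairwise fun i j => ‖q i - q j‖ = 1) :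
    ∃ V : Matrix (Fin 3) (Fin 2) ℂ, IsFrame m (normalized m q) V ∧
      LinearizationReducesTo m (normalized m q) e V
        (fun s => directSum ![keplerPart e s, lagrangePart (betaL m) e s]) := by
  have hcc := isCentralConfiguration_of_equidistant hm1 hq
  have hc := hcc.isNormalizedCentral hm
  have hs := size_pos hm hcc.1
  have ha : Pairwise fun i j => ‖normalized m q i - normalized m q j‖ = 1 / size m q :=
    fun i j hij => (norm_normalized_sub m q i j).trans (by rw [hq hij])
  set a := normalized m q
  have hV := hc.isFrame_triangleFrame hm
  have hQ := hc.norm_hessConj_triangleFrame hm hm1 (one_div_pos.2 hs) ha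
  have hU := potential_pos hm hc.injective (i := 0) (j := 1) (by decide)
  obtain ⟨u, hu₀, hu, hud⟩ := exists_phases (d := ![(potential m a : ℂ) * (3 / 2 : ℝ),
    hessConj m a (triangleFrame m a) 1 1]) (by simp [abs_of_pos hU])
  refine ⟨_, hV.mul_diagonal hu₀ hu, ?_⟩
  have h := hc.linearizationReducesTo_directSum hm (hV.mul_diagonal hu₀ hu) he₀ he₁
    (f := fun _ => 1 / 2) (g := ![3 / 2, Real.sqrt (9 - betaL m) / 2]) ?_ ?_
  · convert h using 4 with s j
    fin_cases j
    · exact (part_eq_keplerPart he₀ he₁ s).symm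
    · exact (part_eq_lagrangePart (betaL m) e s).symm
  · ext j l
    rw [hessLin_mul_diagonal, hV.hessLin_eq_potential_of_equidistant hc hm1 ha,
      ← Matrix.diagonal_smul, conj_mul_diagonal_mul hu]
  · ext j l
    rw [hessConj_mul_diagonal, hc.hessConj_triangleFrame hm, conj_mul_diagonal_mul_conj,
      ← Matrix.diagonal_smul, funext hud]
    congr 2
    funext j
    fin_cases j <;> simp [hQ, abs_of_pos hU]

end Triangle

/-! ### Limits of reduced systems -/

section UniformLimit

variable {ι : Type*} {F : Filter ι} {e : ℝ}

lemma tendsto_realMatrix {n : ℕ} {P Q : ι → Matrix (Fin n) (Fin n) ℂ}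
    {P₀ Q₀ : Matrix (Fin n) (Fin n) ℂ} (hP : Tendsto P F (𝓝 P₀)) (hQ : Tendsto Q F (𝓝 Q₀)) :
    Tendsto (fun ε => realMatrix (P ε) (Q ε)) F (𝓝 (realMatrix P₀ Q₀)) := by
  have hP' := fun j k => (hP.apply_nhds j).apply_nhds k
  have hQ' := fun j k => (hQ.apply_nhds j).apply_nhds k
  refine tendsto_pi_nhds.2 fun x => tendsto_pi_nhds.2 fun y => ?_
  obtain ⟨c, j⟩ := x
  obtain ⟨d, k⟩ := y
  simp only [realMatrix, Matrix.of_apply]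
  split_ifs
  · exact (Complex.continuous_re.tendsto _).comp ((hP' j k).add (hQ' j k))
  · exact (Complex.continuous_im.tendsto _).comp ((hQ' j k).sub (hP' j k))
  · exact (Complex.continuous_im.tendsto _).comp ((hP' j k).add (hQ' j k))
  · exact (Complex.continuous_re.tendsto _).comp ((hP' j k).sub (hQ' j k))

lemma tendstoUniformly_mul_of_bounded {b : ℝ → ℝ} {C : ℝ} (hb : ∀ s, |b s| ≤ C) {r : ι → ℝ}
    {r₀ : ℝ} (hr : Tendsto r F (𝓝 r₀)) :
    TendstoUniformly (fun ε s => b s * r ε) (fun s => b s * r₀) F := by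
  rw [Metric.tendstoUniformly_iff]
  intro δ hδ
  have h : Tendsto (fun ε => C * |r₀ - r ε|) F (𝓝 0) := by
    simpa using ((hr.const_sub r₀).abs).const_mul C
  filter_upwards [h.eventually_lt_const hδ] with ε hε s
  rw [Real.dist_eq, ← mul_sub, abs_mul]
  exact (mul_le_mul_of_nonneg_right (hb s) (abs_nonneg _)).trans_lt hε

lemma tendstoUniformly_reducedMatrix {n : ℕ} {P Q : ι → Matrix (Fin n) (Fin n) ℂ}
    {P₀ Q₀ : Matrix (Fin n) (Fin n) ℂ} (he₀ : 0 ≤ e) (he₁ : e < 1) (hP : Tendsto P F (𝓝 P₀))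
    (hQ : Tendsto Q F (𝓝 Q₀)) (x y : Coord n ⊕ Coord n) :
    TendstoUniformly (fun ε s => reducedMatrix (P ε) (Q ε) e s x y)
      (fun s => reducedMatrix P₀ Q₀ e s x y) F := by
  have hconst : ∀ f : ℝ → ℝ, TendstoUniformly (fun _ s => f s) f F := fun f =>
    fun u hu => Eventually.of_forall fun _ _ => refl_mem_uniformity hu
  rcases x with x | x <;> rcases y with y | y
  · exact hconst _
  · exact hconst _
  · exact hconst _
  · have hb : ∀ s, |(1 + e * Real.cos s)⁻¹| ≤ (1 - e)⁻¹ := fun s => by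
      rw [abs_of_pos (inv_pos.2 (one_add_mul_cos_pos he₀ he₁ s))]
      exact inv_anti₀ (sub_pos.2 he₁) (one_sub_le_one_add_mul_cos he₀ s)
    have hR := ((tendsto_realMatrix hP hQ).apply_nhds x).apply_nhds y
    exact (hconst _).sub
      (tendstoUniformly_mul_of_bounded hb (hR.const_add ((1 : Matrix _ _ ℝ) x y)))

lemma tendsto_hessLin_mul_diagonal {n l : ℕ} {m : ι → Fin n → ℝ} {a : ι → Fin n → ℂ}
    {V : ι → Matrix (Fin n) (Fin l) ℂ} {u f : Fin l → ℂ} (hu : ∀ j, ‖u j‖ = 1)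
    (h : Tendsto (fun ε => hessLin (m ε) (a ε) (V ε)) F (𝓝 (Matrix.diagonal f))) :
    Tendsto (fun ε => hessLin (m ε) (a ε) (V ε * Matrix.diagonal u)) F
      (𝓝 (Matrix.diagonal f)) := by
  refine tendsto_pi_nhds.2 fun j => tendsto_pi_nhds.2 fun k => ?_
  simp only [hessLin_mul_diagonal]
  rw [← conj_mul_diagonal_mul hu]
  exact (((h.apply_nhds j).apply_nhds k).const_mul _).mul_const _

lemma tendsto_hessConj_mul_diagonal {n l : ℕ} {m : ι → Fin n → ℝ} {a : ι → Fin n → ℂ}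
    {V : ι → Matrix (Fin n) (Fin l) ℂ} (u : Fin l → ℂ) {d : Fin l → ℂ}
    (h : Tendsto (fun ε => hessConj (m ε) (a ε) (V ε)) F (𝓝 (Matrix.diagonal d))) :
    Tendsto (fun ε => hessConj (m ε) (a ε) (V ε * Matrix.diagonal u)) F
      (𝓝 (Matrix.diagonal fun j => conj (u j) ^ 2 * d j)) := by
  refine tendsto_pi_nhds.2 fun j => tendsto_pi_nhds.2 fun k => ?_
  simp only [hessConj_mul_diagonal, ← conj_mul_diagonal_mul_conj]
  exact (((h.apply_nhds j).apply_nhds k).const_mul _).mul_const _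

/-- Fixed phases of the columns make the limit of `hessConj` real. -/
theorem exists_tendstoUniformly_directSum {k : ℕ} {m : ι → Fin (k + 2) → ℝ}
    {a : ι → Fin (k + 2) → ℂ} {V : ι → Matrix (Fin (k + 2)) (Fin (k + 1)) ℂ}
    (he₀ : 0 ≤ e) (he₁ : e < 1) (hm : ∀ ε i, 0 < m ε i)
    (ha : ∀ ε, IsNormalizedCentral (m ε) (a ε)) (hV : ∀ ε, IsFrame (m ε) (a ε) (V ε)) {U₀ : ℝ}
    (hU₀ : 0 < U₀) {f g : Fin (k + 1) → ℝ} {d : Fin (k + 1) → ℂ} (hf₀ : f 0 = 1 / 2)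
    (hd₀ : d 0 = ‖d 0‖) (hd : ∀ j, ‖d j‖ = U₀ * g j)
    (hLin : Tendsto (fun ε => hessLin (m ε) (a ε) (V ε)) F
      (𝓝 ((U₀ : ℂ) • Matrix.diagonal fun j => (f j : ℂ))))
    (hConj : Tendsto (fun ε => hessConj (m ε) (a ε) (V ε)) F (𝓝 (Matrix.diagonal d))) :
    ∃ (W : ι → Matrix (Fin (k + 2)) (Fin (k + 1)) ℂ)
      (B : ι → ℝ → Matrix (Coord (k + 1) ⊕ Coord (k + 1)) (Coord (k + 1) ⊕ Coord (k + 1)) ℝ),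
      (∀ ε, IsFrame (m ε) (a ε) (W ε) ∧ LinearizationReducesTo (m ε) (a ε) e (W ε) (B ε)) ∧
      ∀ x y, TendstoUniformly (fun ε s => B ε s x y)
        (fun s => directSum (fun j => part (1 + f j + g j) (1 + f j - g j) e s) x y) F := by
  obtain ⟨u, hu₀, hu, hud⟩ := exists_phases hd₀
  have hU₀' : (U₀ : ℂ) ≠ 0 := by exact_mod_cast hU₀.ne'
  have hW := fun ε => (hV ε).mul_diagonal hu₀ hu
  have hU : Tendsto (fun ε => ((potential (m ε) (a ε) : ℝ) : ℂ)⁻¹) F (𝓝 (U₀ : ℂ)⁻¹) := by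
    have h := ((hLin.apply_nhds 0).apply_nhds 0).const_mul 2
    simp only [(hV _).hessLin_zero (ha _), if_true, Matrix.smul_apply, Matrix.diagonal_apply_eq,
      hf₀, smul_eq_mul] at h
    refine Tendsto.inv₀ ?_ hU₀'
    convert h using 2 <;> push_cast <;> ring
  have hLinW : Tendsto (fun ε => hessLin (m ε) (a ε) (V ε * Matrix.diagonal u)) F
      (𝓝 ((U₀ : ℂ) • Matrix.diagonal fun j => (f j : ℂ))) := by
    rw [← Matrix.diagonal_smul] at hLin ⊢
    exact tendsto_hessLin_mul_diagonal hu hLin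
  have hConjW : Tendsto (fun ε => hessConj (m ε) (a ε) (V ε * Matrix.diagonal u)) F
      (𝓝 ((U₀ : ℂ) • Matrix.diagonal fun j => (g j : ℂ))) := by
    rw [← Matrix.diagonal_smul]
    convert tendsto_hessConj_mul_diagonal u hConj using 4 with j
    rw [hud, hd, Complex.ofReal_mul, Pi.smul_apply, smul_eq_mul]
  refine ⟨_, _, fun ε => ⟨hW ε, (ha ε).linearizationReducesTo (hm ε) (hW ε) he₀ he₁⟩,
    fun x y => ?_⟩
  simp only [← reducedMatrix_diagonal]
  refine tendstoUniformly_reducedMatrix he₀ he₁ ?_ ?_ x y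
  · simpa only [inv_smul_smul₀ hU₀'] using hU.smul hLinW
  · simpa only [inv_smul_smul₀ hU₀'] using hU.smul hConjW

end UniformLimit

/-! ### A vanishing mass -/

/-- The configurations `q` of `n + 1` bodies with masses `m` converge, the last mass vanishing in
the limit and the others, called the primaries, staying apart. The limits are the masses `m₀` and
the positions `q₀` of the primaries and the position `z` of the last body. -/
structure VanishingLimit {ι : Type*} {n : ℕ} (F : Filter ι) (m : ι → Fin (n + 1) → ℝ)
    (q : ι → Fin (n + 1) → ℂ) (m₀ : Fin n → ℝ) (q₀ : Fin n → ℂ) (z : ℂ) : Prop where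
  mass_last_pos : ∀ ε, 0 < m ε (Fin.last n)
  mass : ∀ i : Fin n, Tendsto (fun ε => m ε i.castSucc) F (𝓝 (m₀ i))
  mass_last : Tendsto (fun ε => m ε (Fin.last n)) F (𝓝 0)
  pos : ∀ i : Fin n, Tendsto (fun ε => q ε i.castSucc) F (𝓝 (q₀ i))
  pos_last : Tendsto (fun ε => q ε (Fin.last n)) F (𝓝 z)
  injective : Function.Injective q₀

section VanishingLimit

variable {ι : Type*} {F : Filter ι} {n : ℕ} {m : ι → Fin (n + 1) → ℝ} {q : ι → Fin (n + 1) → ℂ}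
  {m₀ : Fin n → ℝ} {q₀ : Fin n → ℂ} {z : ℂ}

lemma VanishingLimit.mass_ofReal (h : VanishingLimit F m q m₀ q₀ z) (i : Fin n) :
    Tendsto (fun ε => (m ε i.castSucc : ℂ)) F (𝓝 (m₀ i : ℂ)) :=
  (Complex.continuous_ofReal.tendsto _).comp (h.mass i)

lemma VanishingLimit.mass_last_ofReal (h : VanishingLimit F m q m₀ q₀ z) :
    Tendsto (fun ε => (m ε (Fin.last n) : ℂ)) F (𝓝 0) :=
  (Complex.continuous_ofReal.tendsto' 0 0 Complex.ofReal_zero).comp h.mass_last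

lemma VanishingLimit.sum_mass (h : VanishingLimit F m q m₀ q₀ z) :
    Tendsto (fun ε => ∑ i, m ε i) F (𝓝 (∑ i, m₀ i)) := by
  simp only [Fin.sum_univ_castSucc]
  simpa using (tendsto_finsetSum _ fun i _ => h.mass i).add h.mass_last

lemma VanishingLimit.centre (h : VanishingLimit F m q m₀ q₀ z) (hm₀ : ∑ i, m₀ i ≠ 0) :
    Tendsto (fun ε => centre (m ε) (q ε)) F (𝓝 (centre m₀ q₀)) := by
  refine Tendsto.div ?_ ((Complex.continuous_ofReal.tendsto _).comp h.sum_mass)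
    (by exact_mod_cast hm₀)
  simp only [Fin.sum_univ_castSucc]
  simpa using (tendsto_finsetSum _ fun i _ => (h.mass_ofReal i).mul (h.pos i)).add
    (h.mass_last_ofReal.mul h.pos_last)

lemma VanishingLimit.size (h : VanishingLimit F m q m₀ q₀ z) (hm₀ : ∑ i, m₀ i ≠ 0) :
    Tendsto (fun ε => size (m ε) (q ε)) F (𝓝 (size m₀ q₀)) := by
  refine (Real.continuous_sqrt.tendsto _).comp ?_
  have hc := h.centre hm₀
  simp only [Fin.sum_univ_castSucc]
  simpa using (tendsto_finsetSum _ fun i _ =>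
    (h.mass i).mul ((((h.pos i).sub hc).norm).pow 2)).add
    (h.mass_last.mul (((h.pos_last.sub hc).norm).pow 2))

lemma VanishingLimit.normalized (h : VanishingLimit F m q m₀ q₀ z) (hm₀ : ∑ i, m₀ i ≠ 0)
    (hs : 0 < FourBody.size m₀ q₀) :
    VanishingLimit F m (fun ε => normalized (m ε) (q ε)) m₀ (normalized m₀ q₀)
      ((z - FourBody.centre m₀ q₀) / (FourBody.size m₀ q₀ : ℂ)) := by
  have hs' : (FourBody.size m₀ q₀ : ℂ) ≠ 0 := by exact_mod_cast hs.ne'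
  have hc := h.centre hm₀
  have hS := (Complex.continuous_ofReal.tendsto _).comp (h.size hm₀)
  exact ⟨h.mass_last_pos, h.mass, h.mass_last, fun i => ((h.pos i).sub hc).div hS hs',
    (h.pos_last.sub hc).div hS hs', fun i j hij => h.injective
      (sub_left_injective ((div_left_inj' hs').1 hij))⟩

lemma IsCentralConfiguration.exists_acceleration {m : Fin n → ℝ} {q : Fin n → ℂ}
    (hm : ∀ i, m i ≠ 0) (hq : IsCentralConfiguration m q) :
    ∃ lam : ℝ, ∀ i, ∑ j, (m j : ℂ) * kernel (q j - q i) = -lam * (q i - FourBody.centre m q) := by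
  obtain ⟨-, lam, hlam⟩ := hq
  refine ⟨lam, fun i => ?_⟩
  have hi : (m i : ℂ) ≠ 0 := by exact_mod_cast hm i
  refine mul_left_cancel₀ hi ?_
  have h := (sum_erase_eq_force m q i).symm.trans (hlam i)
  rw [force] at h
  simp only [mul_assoc, ← Finset.mul_sum] at h
  linear_combination h

lemma tendsto_kernel {f : ι → ℂ} {w : ℂ} (hf : Tendsto f F (𝓝 w)) (hw : w ≠ 0) :
    Tendsto (fun ε => kernel (f ε)) F (𝓝 (kernel w)) :=
  (hasFDerivAt_kernel hw).continuousAt.tendsto.comp hf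

/-- The equation of a primary away from the centre of mass and from the limit of the last body
determines the limit of the multiplier. -/
lemma VanishingLimit.exists_tendsto_multiplier (h : VanishingLimit F m q m₀ q₀ z)
    (hm₀ : ∑ i, m₀ i ≠ 0) {lam : ι → ℝ}
    (hlam : ∀ ε i, ∑ j, (m ε j : ℂ) * kernel (q ε j - q ε i)
      = -lam ε * (q ε i - FourBody.centre (m ε) (q ε)))
    {j : Fin n} (hj : q₀ j ≠ FourBody.centre m₀ q₀) (hjz : z ≠ q₀ j) :
    ∃ lam₀ : ℂ, Tendsto (fun ε => (lam ε : ℂ)) F (𝓝 lam₀) := by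
  have hdist := (h.pos j).sub (h.centre hm₀)
  have hne := sub_ne_zero.2 hj
  have hkernel : ∀ i : Fin n, Tendsto (fun ε => kernel (q ε i.castSucc - q ε j.castSucc)) F
      (𝓝 (kernel (q₀ i - q₀ j))) := fun i => by
    rcases eq_or_ne i j with rfl | hij
    · simpa only [sub_self] using tendsto_const_nhds
    · exact tendsto_kernel ((h.pos i).sub (h.pos j)) (sub_ne_zero.2 (h.injective.ne hij))
  have hlast := tendsto_kernel (h.pos_last.sub (h.pos j)) (sub_ne_zero.2 hjz)
  have hsum := (tendsto_finsetSum Finset.univ fun i _ => (h.mass_ofReal i).mul (hkernel i)).add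
    (h.mass_last_ofReal.mul hlast)
  refine ⟨_, (hsum.neg.div hdist hne).congr' ?_⟩
  filter_upwards [hdist.eventually_ne hne] with ε hε
  have heq := hlam ε j.castSucc
  rw [Fin.sum_univ_castSucc] at heq
  refine (div_eq_iff hε).2 ?_
  linear_combination -heq

/-- If the last body collided with the primary `i`, then in its own equation of motion the
attraction `m i / |q i - q_last|²` would be the only unbounded term. -/
theorem VanishingLimit.last_ne [F.NeBot] (h : VanishingLimit F m q m₀ q₀ z) (hn : 2 < n)
    (hm : ∀ ε i, m ε i ≠ 0) (hq : ∀ ε, IsCentralConfiguration (m ε) (q ε))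
    (hm₀ : ∑ i, m₀ i ≠ 0) {i : Fin n} (hi : m₀ i ≠ 0) : z ≠ q₀ i := by
  rintro rfl
  obtain ⟨j, hji, hj⟩ : ∃ j, j ≠ i ∧ q₀ j ≠ FourBody.centre m₀ q₀ := by
    by_contra! hall
    obtain ⟨j, hj, k, hk, hjk⟩ := Finset.one_lt_card.1
      (show 1 < (Finset.univ.erase i).card by
        rw [Finset.card_erase_of_mem (Finset.mem_univ i), Finset.card_fin]
        omega)
    exact hjk (h.injective ((hall j (Finset.ne_of_mem_erase hj)).trans
      (hall k (Finset.ne_of_mem_erase hk)).symm))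
  choose lam hlam using fun ε => (hq ε).exists_acceleration (hm ε)
  obtain ⟨lam₀, hlam₀⟩ := h.exists_tendsto_multiplier hm₀ hlam hj (h.injective.ne hji.symm)
  have hothers := tendsto_finsetSum (Finset.univ.erase i) fun k hk => (h.mass_ofReal k).mul
    (tendsto_kernel ((h.pos k).sub h.pos_last)
      (sub_ne_zero.2 (h.injective.ne (Finset.ne_of_mem_erase hk))))
  have hattraction := ((hlam₀.neg.mul (h.pos_last.sub (h.centre hm₀))).sub hothers).norm
  have hzero := ((h.pos i).sub h.pos_last).norm.pow 2
  rw [sub_self, norm_zero, zero_pow two_ne_zero] at hzero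
  refine hi (abs_eq_zero.1 (tendsto_nhds_unique (h.mass i).abs ?_))
  have hmul := hattraction.mul hzero
  rw [mul_zero] at hmul
  refine hmul.congr fun ε => ?_
  have hne : q ε i.castSucc - q ε (Fin.last n) ≠ 0 :=
    sub_ne_zero.2 ((hq ε).1.ne (Fin.castSucc_lt_last i).ne)
  have heq := hlam ε (Fin.last n)
  rw [Fin.sum_univ_castSucc, sub_self, show kernel 0 = 0 by simp [kernel], mul_zero, add_zero,
    ← Finset.add_sum_erase _ _ (Finset.mem_univ i)] at heq
  simp only [← heq, add_sub_cancel_right]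
  rw [norm_mul, norm_kernel, Complex.norm_real, Real.norm_eq_abs, mul_assoc,
    inv_mul_cancel₀ (pow_ne_zero 2 (norm_ne_zero_iff.2 hne)), mul_one]

end VanishingLimit

section LimitHessian

variable {ι : Type*} {F : Filter ι} {n : ℕ} {m : ι → Fin (n + 1) → ℝ} {a : ι → Fin (n + 1) → ℂ}
  {m₀ : Fin n → ℝ} {a₀ : Fin n → ℂ} {b₀ : ℂ}

lemma sum_sum_univ_castSucc {f : Fin (n + 1) → Fin (n + 1) → ℂ} (hf : ∀ i j, f j i = f i j)
    (hlast : f (Fin.last n) (Fin.last n) = 0) :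
    ∑ i, ∑ j, f i j = ∑ i : Fin n, ∑ j : Fin n, f i.castSucc j.castSucc
      + 2 * ∑ i : Fin n, f i.castSucc (Fin.last n) := by
  simp only [Fin.sum_univ_castSucc, Finset.sum_add_distrib, hlast, hf _ (Fin.last n)]
  ring

lemma VanishingLimit.sqrt_mass_last (h : VanishingLimit F m a m₀ a₀ b₀) :
    Tendsto (fun ε => (Real.sqrt (m ε (Fin.last n)) : ℂ)) F (𝓝 0) :=
  ((Complex.continuous_ofReal.comp Real.continuous_sqrt).tendsto' 0 0 (by simp)).comp h.mass_last

lemma VanishingLimit.sqrt_mass_last_mul_sub (h : VanishingLimit F m a m₀ a₀ b₀)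
    {x : ι → Fin (n + 1) → ℂ} {X : Fin n → ℂ} {E : ℂ}
    (hx : ∀ i : Fin n, Tendsto (fun ε => x ε i.castSucc) F (𝓝 (X i)))
    (hE : Tendsto (fun ε => (Real.sqrt (m ε (Fin.last n)) : ℂ) * x ε (Fin.last n)) F (𝓝 E))
    (i : Fin n) :
    Tendsto (fun ε => (Real.sqrt (m ε (Fin.last n)) : ℂ) * (x ε (Fin.last n) - x ε i.castSucc)) F
      (𝓝 E) := by
  simpa only [mul_sub, zero_mul, sub_zero] using hE.sub (h.sqrt_mass_last.mul (hx i))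

/-- The last coordinates of the vectors `x` and `y` may grow like the inverse square root of the
vanishing mass. -/
lemma VanishingLimit.tendsto_sum_sum (h : VanishingLimit F m a m₀ a₀ b₀) (hb : ∀ i, b₀ ≠ a₀ i)
    {g : ℂ → ℂ} (hg : ∀ w, g (-w) = g w) (hgc : ∀ w, w ≠ 0 → ContinuousAt g w)
    {x y : ι → Fin (n + 1) → ℂ} {X Y : Fin n → ℂ} {Ex Ey : ℂ}
    (hx : ∀ i : Fin n, Tendsto (fun ε => x ε i.castSucc) F (𝓝 (X i)))
    (hy : ∀ i : Fin n, Tendsto (fun ε => y ε i.castSucc) F (𝓝 (Y i)))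
    (hEx : Tendsto (fun ε => (Real.sqrt (m ε (Fin.last n)) : ℂ) * x ε (Fin.last n)) F (𝓝 Ex))
    (hEy : Tendsto (fun ε => (Real.sqrt (m ε (Fin.last n)) : ℂ) * y ε (Fin.last n)) F (𝓝 Ey)) :
    Tendsto (fun ε => ∑ i, ∑ j, (m ε i * m ε j : ℂ) * g (a ε j - a ε i)
        * ((x ε j - x ε i) * (y ε j - y ε i))) F
      (𝓝 (∑ i, ∑ j, (m₀ i * m₀ j : ℂ) * g (a₀ j - a₀ i) * ((X j - X i) * (Y j - Y i))
        + 2 * ∑ i, (m₀ i : ℂ) * g (a₀ i - b₀) * (Ex * Ey))) := by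
  have hlast : ∀ ε (i : Fin n), (m ε i.castSucc * m ε (Fin.last n) : ℂ)
        * g (a ε (Fin.last n) - a ε i.castSucc)
        * ((x ε (Fin.last n) - x ε i.castSucc) * (y ε (Fin.last n) - y ε i.castSucc))
      = m ε i.castSucc * g (a ε (Fin.last n) - a ε i.castSucc)
        * ((Real.sqrt (m ε (Fin.last n)) : ℂ) * (x ε (Fin.last n) - x ε i.castSucc)
          * ((Real.sqrt (m ε (Fin.last n)) : ℂ) * (y ε (Fin.last n) - y ε i.castSucc))) := by
    intro ε i
    have hsq : (Real.sqrt (m ε (Fin.last n)) : ℂ) ^ 2 = m ε (Fin.last n) := by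
      exact_mod_cast Real.sq_sqrt (h.mass_last_pos ε).le
    rw [← hsq]
    ring
  have hsymm : ∀ ε i j, (m ε j * m ε i : ℂ) * g (a ε i - a ε j)
        * ((x ε i - x ε j) * (y ε i - y ε j))
      = (m ε i * m ε j : ℂ) * g (a ε j - a ε i) * ((x ε j - x ε i) * (y ε j - y ε i)) := by
    intro ε i j
    rw [← hg, neg_sub]
    ring
  have hlim : ∀ i, g (a₀ i - b₀) = g (b₀ - a₀ i) := fun i => by rw [← hg, neg_sub]
  simp only [sum_sum_univ_castSucc (hsymm _) (by simp), hlast, hlim]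
  refine .add (tendsto_finsetSum _ fun i _ => tendsto_finsetSum _ fun j _ => ?_)
    (.const_mul 2 (tendsto_finsetSum _ fun i _ => ?_))
  · rcases eq_or_ne j i with rfl | hij
    · simpa only [sub_self, zero_mul, mul_zero] using tendsto_const_nhds
    · exact (((h.mass_ofReal i).mul (h.mass_ofReal j)).mul
        ((hgc _ (sub_ne_zero.2 (h.injective.ne hij))).tendsto.comp ((h.pos j).sub (h.pos i)))).mul
        (((hx j).sub (hx i)).mul ((hy j).sub (hy i)))
  · exact ((h.mass_ofReal i).mul ((hgc _ (sub_ne_zero.2 (hb i))).tendsto.comp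
      (h.pos_last.sub (h.pos i)))).mul
      ((h.sqrt_mass_last_mul_sub hx hEx i).mul (h.sqrt_mass_last_mul_sub hy hEy i))

variable {l : ℕ} {V : ι → Matrix (Fin (n + 1)) (Fin l) ℂ} {D : Matrix (Fin n) (Fin l) ℂ}
  {E : Fin l → ℂ}

lemma VanishingLimit.tendsto_hessLin (h : VanishingLimit F m a m₀ a₀ b₀) (hb : ∀ i, b₀ ≠ a₀ i)
    (hD : ∀ i j, Tendsto (fun ε => V ε (Fin.castSucc i) j) F (𝓝 (D i j)))
    (hE : ∀ j, Tendsto (fun ε => (Real.sqrt (m ε (Fin.last n)) : ℂ) * V ε (Fin.last n) j) F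
      (𝓝 (E j))) :
    Tendsto (fun ε => hessLin (m ε) (a ε) (V ε)) F
      (𝓝 (hessLin m₀ a₀ D + ((1 / 2 * ∑ i, m₀ i / ‖a₀ i - b₀‖ ^ 3 : ℝ) : ℂ)
        • Matrix.vecMulVec (star E) E)) := by
  refine tendsto_pi_nhds.2 fun j => tendsto_pi_nhds.2 fun k => ?_
  have hconj := Complex.continuous_conj.tendsto
  have hsum := h.tendsto_sum_sum hb (g := fun w => (((‖w‖ ^ 3 : ℝ) : ℂ))⁻¹)
    (fun w => by rw [norm_neg])
    (fun w hw => by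
      have : ((‖w‖ ^ 3 : ℝ) : ℂ) ≠ 0 := by
        exact_mod_cast (pow_pos (norm_pos_iff.2 hw) 3).ne'
      fun_prop (disch := assumption))
    (x := fun ε i => conj (V ε i j)) (y := fun ε i => V ε i k) (Ex := conj (E j))
    (fun i => (hconj _).comp (hD i j)) (fun i => hD i k)
    (by simpa only [map_mul, Complex.conj_ofReal, Function.comp_def] using (hconj _).comp (hE j))
    (hE k)
  convert hsum.const_mul (1 / 4 : ℂ) using 2
  · simp only [hessLin, Matrix.of_apply, map_sub, div_eq_mul_inv]
  · simp only [hessLin, Matrix.add_apply, Matrix.of_apply, Matrix.smul_apply,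
      Matrix.vecMulVec_apply, Pi.star_apply, smul_eq_mul, map_sub, div_eq_mul_inv,
      ← Finset.sum_mul, Complex.star_def]
    push_cast
    ring

lemma VanishingLimit.tendsto_hessConj (h : VanishingLimit F m a m₀ a₀ b₀) (hb : ∀ i, b₀ ≠ a₀ i)
    (hD : ∀ i j, Tendsto (fun ε => V ε (Fin.castSucc i) j) F (𝓝 (D i j)))
    (hE : ∀ j, Tendsto (fun ε => (Real.sqrt (m ε (Fin.last n)) : ℂ) * V ε (Fin.last n) j) F
      (𝓝 (E j))) :
    Tendsto (fun ε => hessConj (m ε) (a ε) (V ε)) F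
      (𝓝 (hessConj m₀ a₀ D
        + (3 / 2 * ∑ i, (m₀ i : ℂ) * (a₀ i - b₀) ^ 2 / ((‖a₀ i - b₀‖ ^ 5 : ℝ) : ℂ))
          • Matrix.vecMulVec (star E) (star E))) := by
  refine tendsto_pi_nhds.2 fun j => tendsto_pi_nhds.2 fun k => ?_
  have hconj := Complex.continuous_conj.tendsto
  have hDc : ∀ j i, Tendsto (fun ε => conj (V ε (Fin.castSucc i) j)) F (𝓝 (conj (D i j))) :=
    fun j i => (hconj _).comp (hD i j)
  have hEc : ∀ j, Tendsto
      (fun ε => (Real.sqrt (m ε (Fin.last n)) : ℂ) * conj (V ε (Fin.last n) j)) F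
      (𝓝 (conj (E j))) := fun j => by
    simpa only [map_mul, Complex.conj_ofReal, Function.comp_def] using (hconj _).comp (hE j)
  have hsum := h.tendsto_sum_sum hb (g := fun w => w ^ 2 * (((‖w‖ ^ 5 : ℝ) : ℂ))⁻¹)
    (fun w => by rw [norm_neg, neg_sq])
    (fun w hw => by
      have : ((‖w‖ ^ 5 : ℝ) : ℂ) ≠ 0 := by
        exact_mod_cast (pow_pos (norm_pos_iff.2 hw) 5).ne'
      fun_prop (disch := assumption))
    (x := fun ε i => conj (V ε i j)) (y := fun ε i => conj (V ε i k))
    (hDc j) (hDc k) (hEc j) (hEc k)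
  convert hsum.const_mul (3 / 4 : ℂ) using 2
  · simp only [hessConj, Matrix.of_apply, map_sub, div_eq_mul_inv, ← mul_assoc]
  · simp only [hessConj, Matrix.add_apply, Matrix.of_apply, Matrix.smul_apply,
      Matrix.vecMulVec_apply, Pi.star_apply, smul_eq_mul, map_sub, div_eq_mul_inv,
      Complex.star_def, ← mul_assoc, ← Finset.sum_mul]
    ring

end LimitHessian

/-! ### The frame of four bodies -/

section LastDirection

variable {n : ℕ} (m : Fin (n + 1) → ℝ) (a : Fin (n + 1) → ℂ)

/-- The projection, for the mass inner product, of the motion of the last body alone onto the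
orthogonal complement of `(1, …, 1)` and the normalized configuration `a`. -/
def lastDir : Fin (n + 1) → ℂ :=
  Pi.single (Fin.last n) 1 - (m (Fin.last n) : ℂ) • 1
    - ((m (Fin.last n) : ℂ) * conj (a (Fin.last n))) • a

/-- The last entry of `lastDir`; times the last mass it is the squared mass norm of `lastDir`. -/
def lastGap : ℝ := 1 - m (Fin.last n) * (1 + ‖a (Fin.last n)‖ ^ 2)

/-- The unit vector in the direction of `lastDir`, for the mass norm. -/
def lastCol : Fin (n + 1) → ℂ :=
  (Real.sqrt (m (Fin.last n) * lastGap m a) : ℂ)⁻¹ • lastDir m a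

lemma lastDir_last : lastDir m a (Fin.last n) = lastGap m a := by
  simp only [lastDir, lastGap, Pi.sub_apply, Pi.single_eq_same, Pi.smul_apply, Pi.one_apply,
    smul_eq_mul]
  push_cast
  rw [← Complex.mul_conj']
  ring

lemma lastDir_castSucc (i : Fin n) :
    lastDir m a i.castSucc
      = -(m (Fin.last n) : ℂ) * (1 + conj (a (Fin.last n)) * a i.castSucc) := by
  simp only [lastDir, Pi.sub_apply, Pi.single_eq_of_ne (Fin.castSucc_ne_last i), Pi.smul_apply,
    Pi.one_apply, smul_eq_mul]
  ring

lemma massInner_single_last (u : Fin (n + 1) → ℂ) :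
    massInner m u (Pi.single (Fin.last n) 1) = m (Fin.last n) * conj (u (Fin.last n)) := by
  simp [massInner_apply, Pi.single_apply]

variable {m a}

lemma massInner_lastDir {u : Fin (n + 1) → ℂ} (h1 : massInner m u 1 = 0)
    (ha : massInner m u a = 0) :
    massInner m u (lastDir m a) = m (Fin.last n) * conj (u (Fin.last n)) := by
  rw [lastDir, map_sub, map_sub, map_smul, map_smul, massInner_single_last, h1, ha, smul_zero,
    smul_zero, sub_zero, sub_zero]

lemma massInner_one_lastDir (hm : ∑ i, m i = 1) (ha : IsNormalizedCentral m a) :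
    massInner m 1 (lastDir m a) = 0 := by
  have h1 : massInner m 1 1 = 1 := by
    rw [massInner_one_left]
    simp only [Pi.one_apply, mul_one]
    exact_mod_cast hm
  simp [lastDir, map_sub, massInner_single_last, h1, ha.massInner_one]

lemma IsNormalizedCentral.massInner_lastDir (ha : IsNormalizedCentral m a) :
    massInner m a (lastDir m a) = 0 := by
  have h1 : massInner m a 1 = 0 := by rw [← conj_massInner, ha.massInner_one, map_zero]
  simp [lastDir, map_sub, massInner_single_last, h1, ha.massInner_self]

lemma massInner_lastDir_self (hm : ∑ i, m i = 1) (ha : IsNormalizedCentral m a) :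
    massInner m (lastDir m a) (lastDir m a) = (m (Fin.last n) * lastGap m a : ℝ) := by
  rw [FourBody.massInner_lastDir, lastDir_last, Complex.conj_ofReal, Complex.ofReal_mul]
  · rw [← conj_massInner, massInner_one_lastDir hm ha, map_zero]
  · rw [← conj_massInner, ha.massInner_lastDir, map_zero]

/-- At most one primary satisfies `1 + conj(a_last) a_i = 0`, so `lastDir` does not vanish. -/
lemma lastGap_pos (hn : 2 ≤ n) (hm : ∀ i, 0 < m i) (hm1 : ∑ i, m i = 1)
    (ha : IsNormalizedCentral m a) : 0 < lastGap m a := by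
  have hsum : ∑ i, m i * ‖lastDir m a i‖ ^ 2 = m (Fin.last n) * lastGap m a := by
    exact_mod_cast (massInner_self m (lastDir m a)).symm.trans (massInner_lastDir_self hm1 ha)
  refine pos_of_mul_pos_right (a := m (Fin.last n)) ?_ (hm _).le
  rw [← hsum]
  obtain ⟨i, hi⟩ : ∃ i, lastDir m a i ≠ 0 := by
    by_contra! h
    have hprimary : ∀ i : Fin n, conj (a (Fin.last n)) * a i.castSucc = -1 := fun i => by
      have hi := h i.castSucc
      rw [lastDir_castSucc, mul_eq_zero, neg_eq_zero, Complex.ofReal_eq_zero] at hi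
      exact eq_neg_of_add_eq_zero_right (hi.resolve_left (hm _).ne')
    have h01 := (hprimary ⟨0, by omega⟩).trans (hprimary ⟨1, by omega⟩).symm
    have hlast : conj (a (Fin.last n)) ≠ 0 := fun h0 => by
      simpa [h0] using hprimary ⟨0, by omega⟩
    simpa using ha.injective (mul_left_cancel₀ hlast h01)
  exact Finset.sum_pos' (fun j _ => mul_nonneg (hm j).le (sq_nonneg _))
    ⟨i, Finset.mem_univ _, mul_pos (hm i) (pow_pos (norm_pos_iff.2 hi) 2)⟩

lemma massInner_snoc_zero (u : Fin (n + 1) → ℂ) (w : Fin n → ℂ) :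
    massInner m u (Fin.snoc (α := fun _ => ℂ) w 0)
      = massInner (m ∘ Fin.castSucc) (u ∘ Fin.castSucc) w := by
  simp [massInner_apply, Fin.sum_univ_castSucc]

end LastDirection

/-- The frame of a configuration `a` of four bodies. Its columns are `a`, the unit vector `sideCol`
of the triangle of the primaries, and the unit vector `lastCol` close to the motion of the last body
alone. -/
def fourFrame (m : Fin 4 → ℝ) (a : Fin 4 → ℂ) : Matrix (Fin 4) (Fin 3) ℂ :=
  Matrix.of fun i => ![a i,
    Fin.snoc (α := fun _ => ℂ) (sideCol (m ∘ Fin.castSucc) (a ∘ Fin.castSucc)) 0 i, lastCol m a i]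

lemma IsNormalizedCentral.isFrame_fourFrame {m : Fin 4 → ℝ} {a : Fin 4 → ℂ}
    (ha : IsNormalizedCentral m a) (hm : ∀ i, 0 < m i) (hm1 : ∑ i, m i = 1) :
    IsFrame m a (fourFrame m a) := by
  have hm' : ∀ i, (m ∘ Fin.castSucc : Fin 3 → ℝ) i ≠ 0 := fun i => (hm _).ne'
  have hgap := lastGap_pos (by omega) hm hm1 ha
  set side : Fin 4 → ℂ :=
    Fin.snoc (α := fun _ => ℂ) (sideCol (m ∘ Fin.castSucc) (a ∘ Fin.castSucc)) 0 with hside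
  have hone_side : massInner m 1 side = 0 :=
    (massInner_snoc_zero _ _).trans (massInner_one_sideCol hm')
  have hfst_side : massInner m a side = 0 :=
    (massInner_snoc_zero _ _).trans (massInner_sideCol hm')
  have hself_side : massInner m side side = 1 := by
    rw [hside, massInner_snoc_zero, Fin.snoc_comp_castSucc]
    exact massInner_sideCol_self (fun i => hm _) (ha.injective.ne (by decide))
  have hside_last : massInner m side (lastCol m a) = 0 := by
    rw [lastCol, map_smul, FourBody.massInner_lastDir, hside, Fin.snoc_last, map_zero, mul_zero,
      smul_zero]
    · rw [← conj_massInner, hone_side, map_zero]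
    · rw [← conj_massInner, hfst_side, map_zero]
  have hone_last : massInner m 1 (lastCol m a) = 0 := by
    rw [lastCol, map_smul, massInner_one_lastDir hm1 ha, smul_zero]
  have hfst_last : massInner m a (lastCol m a) = 0 := by
    rw [lastCol, map_smul, ha.massInner_lastDir, smul_zero]
  have hself_last : massInner m (lastCol m a) (lastCol m a) = 1 :=
    massInner_inv_sqrt_smul_self (mul_pos (hm _) hgap) (massInner_lastDir_self hm1 ha)
  refine isFrame_of_lt rfl (fun j => ?_) (fun j => ?_) fun i j hij => ?_
  · fin_cases j
    exacts [ha.massInner_one, hone_side, hone_last]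
  · fin_cases j
    exacts [ha.massInner_self, hself_side, hself_last]
  · obtain ⟨rfl, rfl⟩ | ⟨rfl, rfl⟩ | ⟨rfl, rfl⟩ :
        i = 0 ∧ j = 1 ∨ i = 0 ∧ j = 2 ∨ i = 1 ∧ j = 2 := by decide +revert
    exacts [hfst_side, hfst_last, hside_last]

/-! ### The limit of the four-body frame -/

section SnocZero

variable {n l : ℕ} {m : Fin n → ℝ} {a : Fin n → ℂ} {W : Matrix (Fin n) (Fin l) ℂ} {f : Fin l → ℂ}

/-- The matrix `W` with a vanishing last column added: the limit of the rows of the primaries in a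
frame whose last column tends to the motion of the last body alone. -/
def snocZero (W : Matrix (Fin n) (Fin l) ℂ) : Matrix (Fin n) (Fin (l + 1)) ℂ :=
  Matrix.of fun i => Fin.snoc (α := fun _ => ℂ) (W i) 0

lemma snocZero_castSucc (i : Fin n) (j : Fin l) : snocZero W i j.castSucc = W i j :=
  Fin.snoc_castSucc (α := fun _ => ℂ) _ _ _

lemma snocZero_last (i : Fin n) : snocZero W i (Fin.last l) = 0 :=
  Fin.snoc_last (α := fun _ => ℂ) _ _

lemma hessLin_snocZero (hW : hessLin m a W = Matrix.diagonal f) :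
    hessLin m a (snocZero W) = Matrix.diagonal (Fin.snoc (α := fun _ => ℂ) f 0) := by
  ext j k
  cases j using Fin.lastCases <;> cases k using Fin.lastCases
  case cast.cast j k =>
    have hjk := congrFun (congrFun hW j) k
    simp only [hessLin, Matrix.of_apply] at hjk
    simp only [hessLin, Matrix.of_apply, snocZero_castSucc, hjk, Matrix.diagonal_apply,
      Fin.castSucc_inj, Fin.snoc_castSucc]
  all_goals simp [hessLin, snocZero_last, (Fin.castSucc_ne_last _).symm]

lemma hessConj_snocZero (hW : hessConj m a W = Matrix.diagonal f) :
    hessConj m a (snocZero W) = Matrix.diagonal (Fin.snoc (α := fun _ => ℂ) f 0) := by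
  ext j k
  cases j using Fin.lastCases <;> cases k using Fin.lastCases
  case cast.cast j k =>
    have hjk := congrFun (congrFun hW j) k
    simp only [hessConj, Matrix.of_apply] at hjk
    simp only [hessConj, Matrix.of_apply, snocZero_castSucc, hjk, Matrix.diagonal_apply,
      Fin.castSucc_inj, Fin.snoc_castSucc]
  all_goals simp [hessConj, snocZero_last, (Fin.castSucc_ne_last _).symm]

lemma diagonal_snoc_zero_add (f : Fin l → ℂ) (c : ℂ) :
    Matrix.diagonal (Fin.snoc (α := fun _ => ℂ) f 0)
        + c • Matrix.vecMulVec (Pi.single (Fin.last l) 1) (Pi.single (Fin.last l) 1)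
      = Matrix.diagonal (Fin.snoc (α := fun _ => ℂ) f c) := by
  ext j k
  cases j using Fin.lastCases <;> cases k using Fin.lastCases <;>
    simp [Matrix.vecMulVec_apply, Matrix.diagonal_apply, (Fin.castSucc_ne_last _).symm]

end SnocZero

section LimitFrame

variable {ι : Type*} {F : Filter ι}

section

variable {n : ℕ} {m : ι → Fin (n + 1) → ℝ} {a : ι → Fin (n + 1) → ℂ} {m₀ : Fin n → ℝ}
  {a₀ : Fin n → ℂ} {b₀ : ℂ}

lemma VanishingLimit.tendsto_sqrt_lastGap (h : VanishingLimit F m a m₀ a₀ b₀) :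
    Tendsto (fun ε => (Real.sqrt (lastGap (m ε) (a ε)) : ℂ)) F (𝓝 1) := by
  refine ((Complex.continuous_ofReal.comp Real.continuous_sqrt).tendsto' 1 1 (by simp)).comp ?_
  simpa [lastGap] using (h.mass_last.mul ((h.pos_last.norm.pow 2).const_add 1)).const_sub 1

lemma VanishingLimit.tendsto_lastCol_castSucc (h : VanishingLimit F m a m₀ a₀ b₀) (i : Fin n) :
    Tendsto (fun ε => lastCol (m ε) (a ε) i.castSucc) F (𝓝 0) := by
  have hentry : ∀ ε, lastCol (m ε) (a ε) i.castSucc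
      = -(Real.sqrt (m ε (Fin.last n)) : ℂ) * (Real.sqrt (lastGap (m ε) (a ε)) : ℂ)⁻¹
        * (1 + conj (a ε (Fin.last n)) * a ε i.castSucc) := by
    intro ε
    have hdiv : (m ε (Fin.last n) / Real.sqrt (m ε (Fin.last n)) : ℂ)
        = Real.sqrt (m ε (Fin.last n)) := by exact_mod_cast Real.div_sqrt
    rw [lastCol, Pi.smul_apply, smul_eq_mul, lastDir_castSucc,
      Real.sqrt_mul (h.mass_last_pos ε).le, Complex.ofReal_mul]
    linear_combination -(Real.sqrt (lastGap (m ε) (a ε)) : ℂ)⁻¹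
      * (1 + conj (a ε (Fin.last n)) * a ε i.castSucc) * hdiv
  have hlim := (h.sqrt_mass_last.neg.mul (h.tendsto_sqrt_lastGap.inv₀ one_ne_zero)).mul
    ((((Complex.continuous_conj.tendsto _).comp h.pos_last).mul (h.pos i)).const_add 1)
  simpa only [hentry, neg_zero, zero_mul, Function.comp_def] using hlim

lemma VanishingLimit.tendsto_sqrt_mass_last_mul_lastCol_last (h : VanishingLimit F m a m₀ a₀ b₀) :
    Tendsto (fun ε => (Real.sqrt (m ε (Fin.last n)) : ℂ) * lastCol (m ε) (a ε) (Fin.last n)) F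
      (𝓝 1) := by
  have hentry : ∀ ε, (Real.sqrt (m ε (Fin.last n)) : ℂ) * lastCol (m ε) (a ε) (Fin.last n)
      = Real.sqrt (lastGap (m ε) (a ε)) := by
    intro ε
    have hm : (Real.sqrt (m ε (Fin.last n)) : ℂ) ≠ 0 := by
      exact_mod_cast (Real.sqrt_pos.2 (h.mass_last_pos ε)).ne'
    have hdiv : (lastGap (m ε) (a ε) / Real.sqrt (lastGap (m ε) (a ε)) : ℂ)
        = Real.sqrt (lastGap (m ε) (a ε)) := by exact_mod_cast Real.div_sqrt
    rw [lastCol, Pi.smul_apply, smul_eq_mul, lastDir_last, Real.sqrt_mul (h.mass_last_pos ε).le,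
      Complex.ofReal_mul, mul_inv, mul_assoc, mul_inv_cancel_left₀ hm, inv_mul_eq_div, hdiv]
  simpa only [hentry] using h.tendsto_sqrt_lastGap

end

variable {m : ι → Fin 4 → ℝ} {a : ι → Fin 4 → ℂ} {m₀ : Fin 3 → ℝ} {a₀ : Fin 3 → ℂ} {b₀ : ℂ}

lemma VanishingLimit.tendsto_sideCol (h : VanishingLimit F m a m₀ a₀ b₀) (hm₀ : ∀ i, 0 < m₀ i)
    (i : Fin 3) :
    Tendsto (fun ε => sideCol (m ε ∘ Fin.castSucc) (a ε ∘ Fin.castSucc) i) F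
      (𝓝 (sideCol m₀ a₀ i)) := by
  have hN := sideNormSq_pos hm₀ (h.injective.ne (show (0 : Fin 3) ≠ 1 by decide))
  have hsq : Tendsto (fun ε => sideNormSq (m ε ∘ Fin.castSucc) (a ε ∘ Fin.castSucc)) F
      (𝓝 (sideNormSq m₀ a₀)) :=
    tendsto_finsetSum _ fun i _ =>
      (((h.pos (i + 1)).sub (h.pos (i + 2))).norm.pow 2).div (h.mass i) (hm₀ i).ne'
  refine .mul (.inv₀ ((Complex.continuous_ofReal.comp Real.continuous_sqrt).tendsto _ |>.comp hsq)
    ?_) (.div ((Complex.continuous_conj.tendsto _).comp ((h.pos (i + 1)).sub (h.pos (i + 2))))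
      (h.mass_ofReal i) ?_)
  · exact_mod_cast (Real.sqrt_pos.2 hN).ne'
  · exact_mod_cast (hm₀ i).ne'

lemma VanishingLimit.tendsto_fourFrame_castSucc (h : VanishingLimit F m a m₀ a₀ b₀)
    (hm₀ : ∀ i, 0 < m₀ i) (i j : Fin 3) :
    Tendsto (fun ε => fourFrame (m ε) (a ε) i.castSucc j) F
      (𝓝 (snocZero (triangleFrame m₀ a₀) i j)) := by
  fin_cases j
  · exact h.pos i
  · refine (tendsto_congr fun ε => ?_).2 (h.tendsto_sideCol hm₀ i)
    exact Fin.snoc_castSucc (α := fun _ => ℂ) _ _ _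
  · exact h.tendsto_lastCol_castSucc i

lemma VanishingLimit.tendsto_sqrt_mass_last_mul_fourFrame_last
    (h : VanishingLimit F m a m₀ a₀ b₀) (j : Fin 3) :
    Tendsto (fun ε => (Real.sqrt (m ε (Fin.last 3)) : ℂ) * fourFrame (m ε) (a ε) (Fin.last 3) j) F
      (𝓝 (Pi.single (M := fun _ => ℂ) (Fin.last 2) 1 j)) := by
  fin_cases j
  · simpa [fourFrame] using h.sqrt_mass_last.mul h.pos_last
  · have hside : ∀ ε, fourFrame (m ε) (a ε) (Fin.last 3) 1 = 0 := fun ε => rfl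
    exact (tendsto_congr fun ε => (congrArg _ (hside ε)).trans (mul_zero _)).2 tendsto_const_nhds
  · simpa [fourFrame] using h.tendsto_sqrt_mass_last_mul_lastCol_last

variable {f : Fin 2 → ℂ}

lemma VanishingLimit.tendsto_hessLin_fourFrame (h : VanishingLimit F m a m₀ a₀ b₀)
    (hb : ∀ i, b₀ ≠ a₀ i) (hm₀ : ∀ i, 0 < m₀ i)
    (hf : hessLin m₀ a₀ (triangleFrame m₀ a₀) = Matrix.diagonal f) :
    Tendsto (fun ε => hessLin (m ε) (a ε) (fourFrame (m ε) (a ε))) F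
      (𝓝 (Matrix.diagonal (Fin.snoc (α := fun _ => ℂ) f (alpha m₀ a₀ b₀ : ℂ)))) := by
  have hlim := h.tendsto_hessLin hb (h.tendsto_fourFrame_castSucc hm₀)
    h.tendsto_sqrt_mass_last_mul_fourFrame_last
  rwa [hessLin_snocZero hf, ← Pi.single_star, star_one, diagonal_snoc_zero_add] at hlim

lemma VanishingLimit.tendsto_hessConj_fourFrame (h : VanishingLimit F m a m₀ a₀ b₀)
    (hb : ∀ i, b₀ ≠ a₀ i) (hm₀ : ∀ i, 0 < m₀ i)
    (hf : hessConj m₀ a₀ (triangleFrame m₀ a₀) = Matrix.diagonal f) :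
    Tendsto (fun ε => hessConj (m ε) (a ε) (fourFrame (m ε) (a ε))) F
      (𝓝 (Matrix.diagonal (Fin.snoc (α := fun _ => ℂ) f
        (3 / 2 * ∑ i, (m₀ i : ℂ) * (a₀ i - b₀) ^ 2 / ((‖a₀ i - b₀‖ ^ 5 : ℝ) : ℂ))))) := by
  have hlim := h.tendsto_hessConj hb (h.tendsto_fourFrame_castSucc hm₀)
    h.tendsto_sqrt_mass_last_mul_fourFrame_last
  rwa [hessConj_snocZero hf, ← Pi.single_star, star_one, diagonal_snoc_zero_add] at hlim

end LimitFrame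

/-! ### The limit system -/

lemma alpha_normalized (m : Fin 3 → ℝ) (q : Fin 3 → ℂ) (z : ℂ) :
    alpha m (normalized m q) ((z - centre m q) / (size m q : ℂ)) = size m q ^ 3 * alpha m q z := by
  have hsize : 0 ≤ size m q := Real.sqrt_nonneg _
  have hsub : ∀ i, normalized m q i - (z - centre m q) / (size m q : ℂ)
      = (q i - z) / (size m q : ℂ) := fun i => by
    rw [normalized_eq]
    ring
  simp only [alpha, hsub, norm_div, Complex.norm_of_nonneg hsize, div_pow, Finset.mul_sum]
  refine Finset.sum_congr rfl fun i _ => ?_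
  rw [div_div_eq_mul_div]
  ring

lemma beta_normalized (m : Fin 3 → ℝ) (q : Fin 3 → ℂ) (z : ℂ) (hs : 0 < size m q) :
    beta m (normalized m q) ((z - centre m q) / (size m q : ℂ)) = size m q ^ 3 * beta m q z := by
  have hs' : (size m q : ℂ) ≠ 0 := by exact_mod_cast hs.ne'
  have hterm : ∀ i, (m i : ℂ) * (normalized m q i - (z - centre m q) / (size m q : ℂ)) ^ 2
        / ((‖normalized m q i - (z - centre m q) / (size m q : ℂ)‖ ^ 5 : ℝ) : ℂ)
      = (size m q : ℂ) ^ 3 * ((m i : ℂ) * (q i - z) ^ 2 / ((‖q i - z‖ ^ 5 : ℝ) : ℂ)) := by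
    intro i
    have hsub : normalized m q i - (z - centre m q) / (size m q : ℂ)
        = (q i - z) / (size m q : ℂ) := by
      rw [normalized_eq]
      ring
    rw [hsub, norm_div, Complex.norm_of_nonneg hs.le]
    push_cast
    field_simp
  rw [beta, funext hterm, ← Finset.mul_sum, norm_mul, norm_pow, Complex.norm_of_nonneg hs.le, beta]
  ring

lemma three_mul_beta (m : Fin 3 → ℝ) (q : Fin 3 → ℂ) (z : ℂ) :
    ‖3 / 2 * ∑ i, (m i : ℂ) * (q i - z) ^ 2 / ((‖q i - z‖ ^ 5 : ℝ) : ℂ)‖ = 3 * beta m q z := by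
  rw [norm_mul, beta]
  norm_num
  ring

section LimitSystem

variable {ι : Type*} {F : Filter ι} {e : ℝ} {m : ι → Fin 4 → ℝ} {m₀ : Fin 3 → ℝ}
  {a : ι → Fin 4 → ℂ} {a₀ : Fin 3 → ℂ} {b₀ : ℂ} {s : ℝ}

lemma VanishingLimit.tendsto_hessLin_fourFrame_of_equidistant {α : ℝ}
    (h : VanishingLimit F m a m₀ a₀ b₀) (hb : ∀ i, b₀ ≠ a₀ i) (hm₀ : ∀ i, 0 < m₀ i)
    (hm₀1 : ∑ i, m₀ i = 1) (ha₀ : IsNormalizedCentral m₀ a₀)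
    (hside : Pairwise fun i j => ‖a₀ i - a₀ j‖ = s) (hα : alpha m₀ a₀ b₀ = potential m₀ a₀ * α) :
    Tendsto (fun ε => hessLin (m ε) (a ε) (fourFrame (m ε) (a ε))) F
      (𝓝 ((potential m₀ a₀ : ℂ) •
        Matrix.diagonal fun j => ((![1 / 2, 1 / 2, α] : Fin 3 → ℝ) j : ℂ))) := by
  convert h.tendsto_hessLin_fourFrame hb hm₀
    (((ha₀.isFrame_triangleFrame hm₀).hessLin_eq_potential_of_equidistant ha₀ hm₀1 hside).trans
      (Matrix.diagonal_smul _ _).symm) using 2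
  rw [← Matrix.diagonal_smul]
  congr 1
  funext j
  fin_cases j
  · rfl
  · rfl
  · exact (Complex.ofReal_mul _ _).symm.trans (congrArg Complex.ofReal hα.symm)

lemma VanishingLimit.exists_tendsto_hessConj_fourFrame_of_equidistant {β : ℝ}
    (h : VanishingLimit F m a m₀ a₀ b₀) (hb : ∀ i, b₀ ≠ a₀ i) (hm₀ : ∀ i, 0 < m₀ i)
    (hm₀1 : ∑ i, m₀ i = 1) (ha₀ : IsNormalizedCentral m₀ a₀) (hs : 0 < s)
    (hside : Pairwise fun i j => ‖a₀ i - a₀ j‖ = s) (hβ : beta m₀ a₀ b₀ = potential m₀ a₀ * β) :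
    ∃ d : Fin 3 → ℂ, d 0 = ‖d 0‖ ∧
      (∀ j, ‖d j‖ = potential m₀ a₀ * ![3 / 2, Real.sqrt (9 - betaL m₀) / 2, 3 * β] j) ∧
      Tendsto (fun ε => hessConj (m ε) (a ε) (fourFrame (m ε) (a ε))) F
        (𝓝 (Matrix.diagonal d)) := by
  have hU := potential_pos hm₀ ha₀.injective (i := 0) (j := 1) (by decide)
  refine ⟨_, ?_, fun j => ?_, h.tendsto_hessConj_fourFrame hb hm₀ (ha₀.hessConj_triangleFrame hm₀)⟩
  · simp [Fin.snoc, abs_of_pos hU]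
  · fin_cases j
    · simp [Fin.snoc, abs_of_pos hU]
    · exact ha₀.norm_hessConj_triangleFrame hm₀ hm₀1 hs hside
    · exact (three_mul_beta m₀ a₀ b₀).trans (by rw [hβ]; exact mul_left_comm _ _ _)

theorem VanishingLimit.exists_tendstoUniformly (he₀ : 0 ≤ e) (he₁ : e < 1) {α β : ℝ}
    (h : VanishingLimit F m a m₀ a₀ b₀)
    (hb : ∀ i, b₀ ≠ a₀ i) (hm : ∀ ε i, 0 < m ε i) (hm1 : ∀ ε, ∑ i, m ε i = 1)
    (ha : ∀ ε, IsNormalizedCentral (m ε) (a ε)) (hm₀ : ∀ i, 0 < m₀ i) (hm₀1 : ∑ i, m₀ i = 1)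
    (ha₀ : IsNormalizedCentral m₀ a₀) (hs : 0 < s) (hside : Pairwise fun i j => ‖a₀ i - a₀ j‖ = s)
    (hα : alpha m₀ a₀ b₀ = potential m₀ a₀ * α) (hβ : beta m₀ a₀ b₀ = potential m₀ a₀ * β) :
    ∃ (V : ι → Matrix (Fin 4) (Fin 3) ℂ)
        (B : ι → ℝ → Matrix (Coord 3 ⊕ Coord 3) (Coord 3 ⊕ Coord 3) ℝ),
      (∀ ε, IsFrame (m ε) (a ε) (V ε) ∧ LinearizationReducesTo (m ε) (a ε) e (V ε) (B ε)) ∧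
      ∀ x y, TendstoUniformly (fun ε t => B ε t x y)
        (fun t => directSum ![keplerPart e t, lagrangePart (betaL m₀) e t,
          part (1 + α + 3 * β) (1 + α - 3 * β) e t] x y) F := by
  have hU := potential_pos hm₀ ha₀.injective (i := 0) (j := 1) (by decide)
  obtain ⟨d, hd₀, hd, hConj⟩ :=
    h.exists_tendsto_hessConj_fourFrame_of_equidistant hb hm₀ hm₀1 ha₀ hs hside hβ
  obtain ⟨V, B, hVB, hlim⟩ := exists_tendstoUniformly_directSum he₀ he₁ hm ha
    (fun ε => (ha ε).isFrame_fourFrame (hm ε) (hm1 ε)) hU rfl hd₀ hd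
    (h.tendsto_hessLin_fourFrame_of_equidistant hb hm₀ hm₀1 ha₀ hside hα) hConj
  refine ⟨V, B, hVB, fun x y => ?_⟩
  convert hlim x y using 4 with t j
  fin_cases j
  · exact (part_eq_keplerPart he₀ he₁ t).symm
  · exact (part_eq_lagrangePart (betaL m₀) e t).symm
  · rfl

theorem exists_linearizationReducesTo_four (he₀ : 0 ≤ e) (he₁ : e < 1) {q : ι → Fin 4 → ℂ}
    {q₀ : Fin 3 → ℂ} {z : ℂ} (h : VanishingLimit F m q m₀ q₀ z) (hz : ∀ i, z ≠ q₀ i)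
    (hm : ∀ ε i, 0 < m ε i) (hm1 : ∀ ε, ∑ i, m ε i = 1)
    (hq : ∀ ε, IsCentralConfiguration (m ε) (q ε)) (hm₀ : ∀ i, 0 < m₀ i) (hm₀1 : ∑ i, m₀ i = 1)
    (hq₀ : Pairwise fun i j => ‖q₀ i - q₀ j‖ = 1) :
    ∃ (V : ι → Matrix (Fin 4) (Fin 3) ℂ)
        (B : ι → ℝ → Matrix (Coord 3 ⊕ Coord 3) (Coord 3 ⊕ Coord 3) ℝ),
      (∀ ε, IsFrame (m ε) (normalized (m ε) (q ε)) (V ε) ∧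
        LinearizationReducesTo (m ε) (normalized (m ε) (q ε)) e (V ε) (B ε)) ∧
      ∀ x y, TendstoUniformly (fun ε t => B ε t x y)
        (fun t => directSum ![keplerPart e t, lagrangePart (betaL m₀) e t,
          part (1 + alpha m₀ q₀ z + 3 * beta m₀ q₀ z)
            (1 + alpha m₀ q₀ z - 3 * beta m₀ q₀ z) e t] x y) F := by
  have hcc := isCentralConfiguration_of_equidistant hm₀1 hq₀
  have hc := hcc.isNormalizedCentral hm₀
  have hs := size_pos hm₀ hcc.1
  have hs' : (size m₀ q₀ : ℂ) ≠ 0 := by exact_mod_cast hs.ne'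
  have hside : Pairwise fun i j => ‖normalized m₀ q₀ i - normalized m₀ q₀ j‖ = 1 / size m₀ q₀ :=
    fun i j hij => (norm_normalized_sub m₀ q₀ i j).trans (by rw [hq₀ hij])
  have hU : potential m₀ (normalized m₀ q₀) = size m₀ q₀ ^ 3 := by
    rw [(hc.isFrame_triangleFrame hm₀).potential_eq_of_equidistant hc hm₀1 hside, one_div, inv_pow,
      inv_inv]
  have hb : ∀ i, (z - centre m₀ q₀) / (size m₀ q₀ : ℂ) ≠ normalized m₀ q₀ i := fun i hi =>
    hz i (sub_left_injective ((div_left_inj' hs').1 hi))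
  exact (h.normalized (hm₀1 ▸ one_ne_zero) hs).exists_tendstoUniformly he₀ he₁ hb hm hm1
    (fun ε => (hq ε).isNormalizedCentral (hm ε)) hm₀ hm₀1 hc (one_div_pos.2 hs) hside
    (hU ▸ alpha_normalized m₀ q₀ z) (hU ▸ beta_normalized m₀ q₀ z hs)

end LimitSystem

end FourBody

end

theorem theorem1p1 {ι : Type*} (F : Filter ι) [F.NeBot]
    (e : ℝ) (he₀ : 0 ≤ e) (he₁ : e < 1)
    -- masses and central configurations
    (m : ι → Fin 4 → ℝ) (hm : ∀ ε i, 0 < m ε i) (hm_sum : ∀ ε, ∑ i, m ε i = 1)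
    (q : ι → Fin 4 → ℂ) (hq : ∀ ε, FourBody.IsCentralConfiguration (m ε) (q ε))
    -- the limit: the fourth mass vanishes, the primaries form an equilateral triangle of side `1`
    (m₀ : Fin 3 → ℝ) (hm₀ : ∀ i, 0 < m₀ i)
    (hm_lim : ∀ i : Fin 3, Tendsto (fun ε => m ε i.castSucc) F (𝓝 (m₀ i)))
    (hm4_lim : Tendsto (fun ε => m ε 3) F (𝓝 0))
    (q₀ : Fin 3 → ℂ) (z : ℂ) (hq₀ : ∀ i j, i ≠ j → ‖q₀ i - q₀ j‖ = 1)
    (hq_lim : ∀ i : Fin 3, Tendsto (fun ε => q ε i.castSucc) F (𝓝 (q₀ i)))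
    (hz_lim : Tendsto (fun ε => q ε 3) F (𝓝 z)) :
    -- the limit position of the fourth body is not a collision
    (∀ i, z ≠ q₀ i) ∧
    -- in the limit, the linearized system is the sum of three independent systems
    (∃ (V : ι → Matrix (Fin 4) (Fin 3) ℂ)
        (B : ι → ℝ → Matrix (FourBody.Coord 3 ⊕ FourBody.Coord 3)
          (FourBody.Coord 3 ⊕ FourBody.Coord 3) ℝ),
      (∀ ε, FourBody.IsFrame (m ε) (FourBody.normalized (m ε) (q ε)) (V ε) ∧
        FourBody.LinearizationReducesTo (m ε) (FourBody.normalized (m ε) (q ε)) e (V ε) (B ε)) ∧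
      ∀ x y, TendstoUniformly (fun ε s => B ε s x y)
        (fun s => FourBody.directSum
          ![FourBody.keplerPart e s,
            FourBody.lagrangePart (FourBody.betaL m₀) e s,
            FourBody.part (1 + FourBody.alpha m₀ q₀ z + 3 * FourBody.beta m₀ q₀ z)
              (1 + FourBody.alpha m₀ q₀ z - 3 * FourBody.beta m₀ q₀ z) e s] x y) F) ∧
    -- the first one is the linearized system of the two-body problem at its Kepler orbits
    (∀ (m₂ : Fin 2 → ℝ) (q₂ : Fin 2 → ℂ), (∀ i, 0 < m₂ i) → ∑ i, m₂ i = 1 → q₂ 0 ≠ q₂ 1 →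
      ∃ V : Matrix (Fin 2) (Fin 1) ℂ,
        FourBody.IsFrame m₂ (FourBody.normalized m₂ q₂) V ∧
        FourBody.LinearizationReducesTo m₂ (FourBody.normalized m₂ q₂) e V
          (fun s => FourBody.directSum ![FourBody.keplerPart e s])) ∧
    -- the second one is, next to that Kepler part, the linearized system of the three-body problem
    -- of the primaries at the elliptic Lagrangian solution
    (∃ V : Matrix (Fin 3) (Fin 2) ℂ,
      FourBody.IsFrame m₀ (FourBody.normalized m₀ q₀) V ∧
      FourBody.LinearizationReducesTo m₀ (FourBody.normalized m₀ q₀) e V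
        (fun s => FourBody.directSum
          ![FourBody.keplerPart e s, FourBody.lagrangePart (FourBody.betaL m₀) e s])) := by
  have h : FourBody.VanishingLimit F m q m₀ q₀ z :=
    ⟨fun ε => hm ε _, hm_lim, hm4_lim, hq_lim, hz_lim,
      fun i j hij => by_contra fun hne => by simpa [hij] using hq₀ i j hne⟩
  have hm₀_sum : ∑ i, m₀ i = 1 :=
    tendsto_nhds_unique h.sum_mass (by simp only [hm_sum]; exact tendsto_const_nhds)
  have hz : ∀ i, z ≠ q₀ i := fun i =>
    h.last_ne (by decide) (fun ε i => (hm ε i).ne') hq (hm₀_sum ▸ one_ne_zero) (hm₀ i).ne'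
  exact ⟨hz, FourBody.exists_linearizationReducesTo_four he₀ he₁ h hz hm hm_sum hq hm₀ hm₀_sum
      fun i j => hq₀ i j,
    fun _ _ => FourBody.exists_linearizationReducesTo_two he₀ he₁,
    FourBody.exists_linearizationReducesTo_three he₀ he₁ hm₀ hm₀_sum fun i j => hq₀ i j⟩
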